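/- Let $n\ge 1$, let $H$ be a constant with $|H|<1$, and write $y=z_{n+1}$ for $z\in\mathbb S^n\subset\mathbb R^{n+1}$. Let $\Omega$ be an open subset of the open upper hemisphere $\mathbb S^n_+=\{z\in\mathbb S^n: y>0\}$ with $\int_\Omega y^{-(n+1)}\,dz<\infty$ (for instance $\overline\Omega\subset\mathbb S^n_+$), where $dz$ is the surface measure. For $v\in BV(\Omega)$ put $$\mathcal I(v)=A(v)+nH\int_\Omega v\,y^{-(n+1)}\,dz,$$ $$A(v)=\sup\Big\{\int_\Omega v\,\mathrm{div}_z(\tilde\gamma\, y^{-n})\,dz+\int_\Omega\gamma_{n+1}\,y^{-n}\,dz:\ (\tilde\gamma,\gamma_{n+1})\in C^1_0(\Omega,T\Omega\times\mathbb R),\ |\tilde\gamma|^2+|\gamma_{n+1}|^2\le 1\Big\}\in[0,\infty],$$ where $C^1_0$ denotes $C^1$ with compact support. Call $v\in BV(\Omega)$ a local minimizer of $\mathcal I$ if $\mathcal I(v)\le\mathcal I(u)$ for every $u\in BV(\Omega)$ that coincides with $v$ a.e. outside some compact subset of $\Omega$. For $T>0$ let $$C_T=\{e^wz: z\in\Omega,\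 -T-1<w<T+1\},$$ $$\underline C_T=\{e^wz: z\in\Omega,\ -T-1<w<-T\},\qquad \overline C_T=\{e^wz: z\in\Omega,\ -T-1<w<T\},$$ and let $\mathcal E$ be the class of Lebesgue measurable sets $E$ with $\underline C_T\subseteq E\subseteq\overline C_T$ (up to Lebesgue null sets). For measurable $U\subseteq C_T$ put $\mathcal F(U)=\mathcal P(U)+nH\,\mathrm{Vol}(U)$, where $$\mathcal P(U)=\sup\Big\{\int_{C_T}\mathbf 1_U\,\mathrm{div}_x(g\,x_{n+1}^{-n})\,dx:\ g\in C^1_0(C_T;\mathbb R^{n+1}),\ |g|\le 1\Big\}\in[0,\infty],\qquad \mathrm{Vol}(U)=\int_{U\cap C_T}x_{n+1}^{-(n+1)}\,dx$$ are the perimeter in $C_T$ and the volume with respect to the hyperbolic metric of the half-space model. Theorem. Let $v\in BV(\Omega)\cap L^\infty(\Omega)$ be a local minimizer of $\mathcal I$, let $T>\|v\|_{L^\infty(\Omega)}$, and let $$V_T=\{e^wz: z\in\Omega,\ -T-1<w<T+1,\ w<v(z)\}$$ be the truncated subgraph of the radial graph of $v$. Then $V_T$ locally minimizes $\mathcal F$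 in $\mathcal E$: one has $V_T\in\mathcal E$, and $\mathcal F(V_T)\le\mathcal F(E)$ for every $E\in\mathcal E$ that coincides with $V_T$ (up to a null set) outside some compact subset of $C_T$. -/

import Mathlib

open MeasureTheory Set
open scoped ENNReal Manifold ContDiff

noncomputable section

namespace RadialGraph

/-- Euclidean space `ℝ^{n+1}`; the hyperbolic space `ℍ^{n+1}` is its open upper half `x_{n+1} > 0`. -/
abbrev Amb (n : ℕ) : Type := EuclideanSpace ℝ (Fin (n + 1))

/-- The unit sphere `𝕊^n ⊆ ℝ^{n+1}`. -/
abbrev Sph (n : ℕ) : Type := Metric.sphere (0 : Amb n) 1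

/-- The last coordinate `x_{n+1}` of a point of `ℝ^{n+1}`. On `𝕊^n` this is `y = e · z`. -/
def height {n : ℕ} (x : Amb n) : ℝ := x (Fin.last n)

/-- The open upper hemisphere `𝕊^n_+`. -/
def upperHemisphere (n : ℕ) : Set (Sph n) := {z | 0 < height (z : Amb n)}

/-- The surface measure `dz` on `𝕊^n`. -/
def surf (n : ℕ) : Measure (Sph n) := (volume : Measure (Amb n)).toSphere

/-- The Euclidean divergence `∑ i, ∂_i F_i` on `ℝ^{n+1}`. -/
def ediv {n : ℕ} (F : Amb n → Amb n) (x : Amb n) : ℝ :=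
  ∑ i, fderiv ℝ F x (EuclideanSpace.single i 1) i

/-- The extension of a map on the sphere that is constant along rays: `x ↦ X (x / |x|)` for
`x ≠ 0` (with value `0` at the origin). -/
def homExt {n : ℕ} (X : Sph n → Amb n) (x : Amb n) : Amb n :=
  Function.extend Subtype.val X 0 (‖x‖⁻¹ • x)

/-- The divergence `div_z X` on the round sphere of a tangential vector field `X`, i.e. the trace of
its tangential derivative. The extension `homExt X` has zero radial derivative, so that the trace
over the tangent space is the full Euclidean divergence of `homExt X`. -/
def sdiv {n : ℕ} (X : Sph n → Amb n) (z : Sph n) : ℝ :=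
  ediv (homExt X) (z : Amb n)

/-! ### Functions on a subset of the sphere -/

/-- `γ ∈ C^1_0(Ω, TΩ)`: a `C^1` tangential vector field on the sphere with (compact) support in
`Ω`. -/
structure IsTangentTest {n : ℕ} (Ω : Set (Sph n)) (γ : Sph n → Amb n) : Prop where
  contMDiff : ContMDiff (𝓡 n) 𝓘(ℝ, Amb n) 1 γ
  tangent : ∀ z : Sph n, inner ℝ (z : Amb n) (γ z) = 0
  support : tsupport γ ⊆ Ω

/-- `f ∈ C^1_0(Ω)`. -/
structure IsScalarTest {n : ℕ} (Ω : Set (Sph n)) (f : Sph n → ℝ) : Prop where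
  contMDiff : ContMDiff (𝓡 n) 𝓘(ℝ, ℝ) 1 f
  support : tsupport f ⊆ Ω

/-- The total variation `∫_Ω |∇v|`. -/
def totalVariation {n : ℕ} (Ω : Set (Sph n)) (v : Sph n → ℝ) : EReal :=
  ⨆ (γ : Sph n → Amb n) (_ : IsTangentTest Ω γ ∧ ∀ z, ‖γ z‖ ≤ 1),
    ((∫ z in Ω, v z * sdiv γ z ∂(surf n) : ℝ) : EReal)

/-- `v ∈ BV(Ω)`. -/
def IsBV {n : ℕ} (Ω : Set (Sph n)) (v : Sph n → ℝ) : Prop :=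
  IntegrableOn v Ω (surf n) ∧ totalVariation Ω v < ⊤

/-- The area term `A_Ω(v) = ∫_Ω √(1 + |∇v|²) y^{-n}` of a function of bounded variation. -/
def areaEnergy {n : ℕ} (Ω : Set (Sph n)) (v : Sph n → ℝ) : EReal :=
  ⨆ (γ : Sph n → Amb n) (f : Sph n → ℝ)
    (_ : IsTangentTest Ω γ ∧ IsScalarTest Ω f ∧ ∀ z, ‖γ z‖ ^ 2 + |f z| ^ 2 ≤ 1),
    (((∫ z in Ω, v z * sdiv (fun ζ => (height (ζ : Amb n) ^ n)⁻¹ • γ ζ) z ∂(surf n))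
      + ∫ z in Ω, f z * (height (z : Amb n) ^ n)⁻¹ ∂(surf n) : ℝ) : EReal)

/-- The volume term `V_Ω(v) = ∫_Ω v y^{-(n+1)} dz`. -/
def volEnergy {n : ℕ} (Ω : Set (Sph n)) (v : Sph n → ℝ) : ℝ :=
  ∫ z in Ω, v z * (height (z : Amb n) ^ (n + 1))⁻¹ ∂(surf n)

/-- The energy `I_Ω(v) = A_Ω(v) + n H V_Ω(v)`. -/
def energy {n : ℕ} (H : ℝ) (Ω : Set (Sph n)) (v : Sph n → ℝ) : EReal :=
  areaEnergy Ω v + ((n * H * volEnergy Ω v : ℝ) : EReal)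

/-- `v ∈ BV(Ω)` is a local minimizer of `I_Ω`: it minimizes `I_Ω` among all `u ∈ BV(Ω)` that
coincide with `v` (almost everywhere) outside a compact subset of `Ω`. -/
def IsLocalMinimizer {n : ℕ} (H : ℝ) (Ω : Set (Sph n)) (v : Sph n → ℝ) : Prop :=
  IsBV Ω v ∧ ∀ K : Set (Sph n), IsCompact K → K ⊆ Ω → ∀ u : Sph n → ℝ, IsBV Ω u →
    (∀ᵐ z ∂(surf n), z ∈ Ω → z ∉ K → u z = v z) → energy H Ω v ≤ energy H Ω u

/-! ### Subsets of the truncated cone -/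

/-- The part `{e^w z : z ∈ Ω, a < w < b}` of the cone over `Ω`. -/
def coneSlab {n : ℕ} (Ω : Set (Sph n)) (a b : ℝ) : Set (Amb n) :=
  {x | ∃ z ∈ Ω, ∃ w : ℝ, a < w ∧ w < b ∧ x = Real.exp w • (z : Amb n)}

/-- The truncated cone `C_T`. -/
def truncCone {n : ℕ} (Ω : Set (Sph n)) (T : ℝ) : Set (Amb n) := coneSlab Ω (-T - 1) (T + 1)

/-- The lower slab. -/
def lowerSlab {n : ℕ} (Ω : Set (Sph n)) (T : ℝ) : Set (Amb n) := coneSlab Ω (-T - 1) (-T)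

/-- The upper bound for the competitors: the part of `C_T` below the level `w = T`. -/
def upperSlab {n : ℕ} (Ω : Set (Sph n)) (T : ℝ) : Set (Amb n) := coneSlab Ω (-T - 1) T

/-- The subgraph `V` of the radial graph of `v`. -/
def subgraph {n : ℕ} (Ω : Set (Sph n)) (v : Sph n → ℝ) : Set (Amb n) :=
  {x | ∃ z ∈ Ω, ∃ w : ℝ, w < v z ∧ x = Real.exp w • (z : Amb n)}

/-- The truncated subgraph `V_T = V ∩ C_T`. -/
def truncSubgraph {n : ℕ} (Ω : Set (Sph n)) (v : Sph n → ℝ) (T : ℝ) : Set (Amb n) :=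
  subgraph Ω v ∩ truncCone Ω T

/-- The hyperbolic perimeter `P_{C_T}(U)` in `C_T`. -/
def perimeter {n : ℕ} (Ω : Set (Sph n)) (T : ℝ) (U : Set (Amb n)) : EReal :=
  ⨆ (g : Amb n → Amb n)
    (_ : ContDiff ℝ 1 g ∧ HasCompactSupport g ∧ tsupport g ⊆ truncCone Ω T ∧
      ∀ x, ‖g x‖ ^ 2 ≤ 1),
    ((∫ x in truncCone Ω T,
      U.indicator (fun _ => (1 : ℝ)) x * ediv (fun ξ => (height ξ ^ n)⁻¹ • g ξ) x : ℝ) : EReal)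

/-- The hyperbolic volume of `U ∩ C_T`. -/
def hypVol {n : ℕ} (Ω : Set (Sph n)) (T : ℝ) (U : Set (Amb n)) : ℝ :=
  ∫ x in U ∩ truncCone Ω T, (height x ^ (n + 1))⁻¹

/-- The functional `F(U) = P(U) + n H Vol(U)`. -/
def setEnergy {n : ℕ} (H : ℝ) (Ω : Set (Sph n)) (T : ℝ) (U : Set (Amb n)) : EReal :=
  perimeter Ω T U + ((n * H * hypVol Ω T U : ℝ) : EReal)

/-- The class of competitors: (Lebesgue) measurable sets `E ⊆ C_T` between the lower and the upper
slab. As `BV` functions are only defined almost everywhere, inclusions of sets are understood up to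
Lebesgue null sets. -/
structure IsCompetitor {n : ℕ} (Ω : Set (Sph n)) (T : ℝ) (E : Set (Amb n)) : Prop where
  measurable : NullMeasurableSet E
  lower : lowerSlab Ω T ≤ᵐ[volume] E
  upper : E ≤ᵐ[volume] upperSlab Ω T

/-- `U` locally minimizes `F` in the class of competitors: it belongs to the class, and
`F(U) ≤ F(E)` for every competitor `E` that coincides with `U` (up to a null set) outside a compact
subset of `C_T`. -/
def LocallyMinimizesSetEnergy {n : ℕ} (H : ℝ) (Ω : Set (Sph n)) (T : ℝ) (U : Set (Amb n)) : Prop :=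
  IsCompetitor Ω T U ∧ ∀ K : Set (Amb n), IsCompact K → K ⊆ truncCone Ω T →
    ∀ E : Set (Amb n), IsCompetitor Ω T E →
      (∀ᵐ x ∂(volume : Measure (Amb n)), x ∉ K → (x ∈ E ↔ x ∈ U)) →
      setEnergy H Ω T U ≤ setEnergy H Ω T E

end RadialGraph

end

noncomputable section

namespace RadialGraph

section

variable {n : ℕ}

/-! ### Polar coordinates -/

/-! Write points of the cone as `e^w z`. Replace a competitor `E` by the function `rearrange T E` on
`Ω` whose subgraph has the same length as `E` on every ray. The hyperbolic volume element in these
coordinates is `y^{-(n+1)} dz dw`, independent of `w`, so the volume of `E` is the volume term of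
the rearrangement plus a constant common to all competitors (`hypVol_eq`). The theorem then follows
from two inequalities between perimeter and area, with the minimality of `v` between them.

First, rearranging does not increase the energy: the area of `rearrange T E` is at most the
perimeter of `E` (`areaEnergy_rearrange_le`). A test pair `(γ, f)` on `Ω` lifts to the field `η(w)
(γ + f z)` on the cone, with a cutoff `η` equal to `1` for `|w| ≤ T`. The slab conditions fix `E`
below `-T` and above `T`, so integrating along rays gives back the test integral of the
rearrangement, up to a constant times a divergence, which integrates to zero over the sphere. In
particular finite perimeter of `E` forces the rearrangement to be `BV`, so that it is admissible
against `v`.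

Second, the perimeter of the subgraph of `v` is at most the area of `v`
(`perimeter_truncSubgraph_le`). Here the fields on the cone depend on `w` as well, and `v` is only
`BV`. Average `v` with a zonal kernel `k(z · ζ)` of radius `ε`. For the smooth average `u`,
Gauss–Green applied to a smooth step of `u - w` (`integral_step_ediv`) expresses the divergence
integral as an average over vertical translates of the flux through the graph of `u`. By Fubini the
smoothing moves from `v` to the field, which produces an almost admissible test pair for `v`: the
height weight costs a factor close to `1`, and commuting the tangential divergence with the
averaging costs `O(ε)` (`integral_smoothed_le`). `L¹` convergence of the averages then removes both
the smoothing and the step.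

Finally, the rearrangement of the subgraph of `v` is `v` itself, and a competitor differing from it
only in a compact part of the cone has a rearrangement differing from `v` only over the compact set
of directions of that part. -/

instance : IsFiniteMeasure (surf n) := inferInstanceAs (IsFiniteMeasure (Measure.toSphere _))

@[simp] lemma norm_coe_sph (z : Sph n) : ‖(z : Amb n)‖ = 1 := norm_eq_of_mem_sphere z

/-- Logarithmic polar coordinates `(z, w) ↦ e^w z`. -/
def polar (p : Sph n × ℝ) : Amb n := Real.exp p.2 • (p.1 : Amb n)

lemma continuous_polar : Continuous (polar : Sph n × ℝ → Amb n) := by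
  unfold polar; fun_prop

@[simp] lemma norm_polar (p : Sph n × ℝ) : ‖polar p‖ = Real.exp p.2 := by
  simp [polar, norm_smul]

lemma polar_ne_zero (p : Sph n × ℝ) : polar p ≠ 0 := by
  rw [← norm_ne_zero_iff, norm_polar]; exact (Real.exp_pos _).ne'

/-- The substitution `r = e^w` turns `r^n dr` into `e^{(n+1)w} dw`. This is the radial Jacobian in
all later polar integrals. -/
lemma measurePreserving_exp (n : ℕ) :
    MeasurePreserving (Real.expOrderIso : ℝ → Ioi (0 : ℝ))
      ((volume : Measure ℝ).withDensity fun w => ENNReal.ofReal (Real.exp ((n + 1) * w)))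
      (Measure.volumeIoiPow n) := by
  have hm : Measurable (Real.expOrderIso : ℝ → Ioi (0 : ℝ)) :=
    Real.expOrderIso.continuous.measurable
  refine ⟨hm, ?_⟩
  ext s hs
  rw [Measure.map_apply hm hs, withDensity_apply _ (hm hs), Measure.volumeIoiPow,
    withDensity_apply _ hs,
    setLIntegral_subtype measurableSet_Ioi _ fun a : ℝ => ENNReal.ofReal (a ^ n)]
  have him : (Subtype.val '' s : Set ℝ) = Real.exp '' (Real.expOrderIso ⁻¹' s) := by
    ext r
    constructor
    · rintro ⟨r, hr, rfl⟩
      refine ⟨Real.expOrderIso.symm r, by simpa using hr, ?_⟩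
      rw [← Real.coe_expOrderIso_apply, OrderIso.apply_symm_apply]
    · rintro ⟨w, hw, rfl⟩
      exact ⟨_, hw, Real.coe_expOrderIso_apply w⟩
  rw [him, lintegral_image_eq_lintegral_abs_deriv_mul (hm hs)
    (fun x _ => (Real.hasDerivAt_exp x).hasDerivWithinAt) Real.exp_injective.injOn]
  refine lintegral_congr fun w => ?_
  rw [abs_of_pos (Real.exp_pos w), ← ENNReal.ofReal_mul (Real.exp_pos w).le, ← Real.exp_nat_mul,
    ← Real.exp_add]
  congr 2; ring

lemma polar_eq (p : Sph n × ℝ) :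
    polar p = ((homeomorphUnitSphereProd (Amb n)).symm (p.1, Real.expOrderIso p.2) : Amb n) := by
  simp [polar]

lemma measurableEmbedding_polar : MeasurableEmbedding (polar : Sph n × ℝ → Amb n) := by
  have h : (polar : Sph n × ℝ → Amb n) = Subtype.val ∘
      (homeomorphUnitSphereProd (Amb n)).symm ∘ Prod.map id Real.expOrderIso := by
    funext p; simp [polar_eq]
  rw [h]
  exact (MeasurableEmbedding.subtype_coe (measurableSet_singleton _).compl).comp
    ((Homeomorph.measurableEmbedding _).comp
      (((Homeomorph.refl (Sph n)).prodCongr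
        Real.expOrderIso.toHomeomorph).measurableEmbedding))

lemma measurePreserving_polar : MeasurePreserving (polar : Sph n × ℝ → Amb n)
    ((surf n).prod
      ((volume : Measure ℝ).withDensity fun w => ENNReal.ofReal (Real.exp ((n + 1) * w)))) volume := by
  have h : (polar : Sph n × ℝ → Amb n) = Subtype.val ∘
      (homeomorphUnitSphereProd (Amb n)).symm ∘ Prod.map id Real.expOrderIso := by
    funext p; simp [polar_eq]
  have h1 := (Measure.measurePreserving_homeomorphUnitSphereProd (volume : Measure (Amb n)))
  have hd : Module.finrank ℝ (Amb n) - 1 = n := by simp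
  rw [hd] at h1
  have h1' : MeasurePreserving (homeomorphUnitSphereProd (Amb n)).symm
      ((volume : Measure (Amb n)).toSphere.prod (Measure.volumeIoiPow n))
      (Measure.comap Subtype.val volume) :=
    MeasurePreserving.symm (homeomorphUnitSphereProd (Amb n)).toMeasurableEquiv h1
  have h2 := ((MeasurePreserving.id (surf n)).prod (measurePreserving_exp n))
  have h3 : MeasurePreserving (Subtype.val : ({0}ᶜ : Set (Amb n)) → Amb n)
      (Measure.comap Subtype.val volume) volume := by
    refine ⟨measurable_subtype_coe, ?_⟩
    rw [(MeasurableEmbedding.subtype_coe (measurableSet_singleton _).compl).map_comap,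
      Subtype.range_coe, restrict_compl_singleton]
  rw [h]
  exact h3.comp (h1'.comp h2)

lemma prod_withDensity_exp : (surf n).prod
      ((volume : Measure ℝ).withDensity fun w => ENNReal.ofReal (Real.exp ((n + 1) * w))) =
    ((surf n).prod volume).withDensity fun p => ENNReal.ofReal (Real.exp ((n + 1) * p.2)) := by
  have h := prod_withDensity (μ := surf n) (ν := (volume : Measure ℝ))
    (f := fun _ => (1 : ℝ≥0∞)) (g := fun w => ENNReal.ofReal (Real.exp ((n + 1) * w)))
    measurable_const (by fun_prop)
  simpa using h

/-- The Jacobian `e^{(n+1)w}` is strictly positive, so it does not affect null sets, and the origin,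
which is missed, is null. -/
lemma ae_polar {p : Amb n → Prop} :
    (∀ᵐ x, p x) ↔ ∀ᵐ q ∂((surf n).prod (volume : Measure ℝ)), p (polar q) := by
  rw [← measurePreserving_polar.map_eq, measurableEmbedding_polar.ae_map_iff,
    prod_withDensity_exp, ae_withDensity_iff (by fun_prop)]
  simp [Real.exp_pos]

lemma integral_polar (f : Amb n → ℝ) :
    ∫ x, f x = ∫ q, Real.exp ((n + 1) * q.2) * f (polar q) ∂((surf n).prod (volume : Measure ℝ)) := by
  rw [← measurePreserving_polar.integral_comp measurableEmbedding_polar, prod_withDensity_exp]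
  have := integral_withDensity_eq_integral_smul (μ := (surf n).prod (volume : Measure ℝ))
    (f := fun q => (Real.exp ((n + 1) * q.2)).toNNReal) (by fun_prop) (fun q => f (polar q))
  refine this.trans (integral_congr_ae (.of_forall fun q => ?_))
  simp [NNReal.smul_def, Real.exp_nonneg]

/-! ### The divergence theorem -/

lemma ediv_continuous {F : Amb n → Amb n} (hF : ContDiff ℝ 1 F) : Continuous (ediv F) := by
  unfold ediv
  have := hF.continuous_fderiv one_ne_zero
  fun_prop

lemma ediv_eq_zero_of_notMem {F : Amb n → Amb n} {x : Amb n} (hx : x ∉ tsupport F) :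
    ediv F x = 0 := by
  have : fderiv ℝ F x = 0 := by
    by_contra h
    exact hx (support_fderiv_subset ℝ h)
  simp [ediv, this]

/-- Each partial derivative is integrated by parts against the constant function `1`. -/
lemma integral_ediv_eq_zero {F : Amb n → Amb n} (hF : ContDiff ℝ 1 F)
    (hc : HasCompactSupport F) : ∫ x, ediv F x = 0 := by
  have hfd := hF.continuous_fderiv one_ne_zero
  have hcf : HasCompactSupport (fderiv ℝ F) := hc.fderiv ℝ
  have hint : ∀ i : Fin (n + 1), Integrable
      (fun x => fderiv ℝ F x (EuclideanSpace.single i 1) i) := fun i =>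
    Continuous.integrable_of_hasCompactSupport (by fun_prop)
      (HasCompactSupport.intro hcf fun x hx => by
        rw [image_eq_zero_of_notMem_tsupport hx]; simp)
  unfold ediv
  rw [integral_finsetSum _ fun i _ => hint i]
  refine Finset.sum_eq_zero fun i _ => ?_
  have hFi : ∀ x, fderiv ℝ (fun x => F x i) x (EuclideanSpace.single i 1)
      = fderiv ℝ F x (EuclideanSpace.single i 1) i := fun x => by
    have := ((EuclideanSpace.proj (𝕜 := ℝ) i).hasFDerivAt.comp x
      (hF.differentiable one_ne_zero x).hasFDerivAt)
    have h2 : HasFDerivAt (fun x => F x i) _ x := this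
    rw [h2.fderiv]; rfl
  have h := integral_mul_fderiv_eq_neg_fderiv_mul_of_integrable (μ := (volume : Measure (Amb n)))
    (f := fun _ => (1 : ℝ)) (g := fun x => F x i) (v := EuclideanSpace.single i 1)
    (by simp) (by simpa [hFi] using hint i)
    (by
      have hFc := hF.continuous
      simpa using Continuous.integrable_of_hasCompactSupport (f := fun x => F x i) (by fun_prop)
        (HasCompactSupport.intro hc fun x hx => by
          rw [image_eq_zero_of_notMem_tsupport hx]; simp))
    (fun x _ => differentiableAt_const _)
    (fun x _ => ((EuclideanSpace.proj (𝕜 := ℝ) i).differentiableAt.comp x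
      (hF.differentiable one_ne_zero x)))
  simpa [hFi] using h

/-! ### Functions on the sphere as functions on the punctured space -/

instance : Nonempty (Sph n) := ⟨⟨EuclideanSpace.single 0 1, by simp⟩⟩

/-- The direction `x / |x|` of a nonzero vector. -/
def dir (x : Amb n) : Sph n :=
  if h : x = 0 then Classical.arbitrary _ else ⟨‖x‖⁻¹ • x, by simp [norm_smul, h]⟩

lemma coe_dir {x : Amb n} (h : x ≠ 0) : (dir x : Amb n) = ‖x‖⁻¹ • x := by
  simp [dir, h]

@[simp] lemma dir_coe (z : Sph n) : dir (z : Amb n) = z := by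
  have h : (z : Amb n) ≠ 0 := by rw [← norm_ne_zero_iff]; simp
  ext1; simp [coe_dir h]

@[simp] lemma dir_polar (p : Sph n × ℝ) : dir (polar p) = p.1 := by
  ext1; rw [coe_dir (polar_ne_zero p), norm_polar, polar, smul_smul]; simp

lemma polar_dir_log {x : Amb n} (h : x ≠ 0) : polar (dir x, Real.log ‖x‖) = x := by
  have : 0 < ‖x‖ := norm_pos_iff.2 h
  simp [polar, coe_dir h, Real.exp_log this, smul_smul, this.ne']

lemma polar_injective : Function.Injective (polar : Sph n × ℝ → Amb n) := by
  intro p q h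
  have h1 := congrArg dir h
  have h2 := congrArg norm h
  simp only [dir_polar, norm_polar, Real.exp_eq_exp] at h1 h2
  exact Prod.ext h1 h2

lemma coe_ne_zero (z : Sph n) : (z : Amb n) ≠ 0 := by rw [← norm_ne_zero_iff]; simp

lemma homExt_eq (X : Sph n → Amb n) {x : Amb n} (h : x ≠ 0) : homExt X x = X (dir x) := by
  rw [homExt, ← coe_dir h, Subtype.val_injective.extend_apply]

lemma contDiffOn_normalize : ContDiffOn ℝ 1 (fun x : Amb n => ‖x‖⁻¹ • x) {0}ᶜ :=
  fun _ hx => ((((contDiffAt_norm ℝ hx).inv (norm_ne_zero_iff.2 hx)).smul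
    contDiffAt_id).contDiffWithinAt)

/-- Transfers manifold smoothness on the sphere to the punctured space: normalization is smooth on
the open submanifold `{0}ᶜ` and takes values in the sphere, so it can be composed with `f`. -/
lemma contDiffOn_comp_dir {G : Type*} [NormedAddCommGroup G] [NormedSpace ℝ G]
    {f : Sph n → G} (hf : ContMDiff (𝓡 n) 𝓘(ℝ, G) 1 f) :
    ContDiffOn ℝ 1 (fun x => f (dir x)) {0}ᶜ := by
  intro x hx
  have : Fact (Module.finrank ℝ (Amb n) = n + 1) := ⟨finrank_euclideanSpace_fin⟩
  let U : TopologicalSpace.Opens (Amb n) := ⟨{0}ᶜ, isOpen_compl_singleton⟩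
  have h1 : ContMDiff 𝓘(ℝ, Amb n) 𝓘(ℝ, Amb n) 1 (fun y : U => ‖(y : Amb n)‖⁻¹ • (y : Amb n)) := by
    intro y
    have : ContMDiffAt 𝓘(ℝ, Amb n) 𝓘(ℝ, Amb n) 1 (fun x : Amb n => ‖x‖⁻¹ • x) (y : Amb n) :=
      ((contDiffOn_normalize.contDiffAt (isOpen_compl_singleton.mem_nhds y.2))).contMDiffAt
    exact contMDiffAt_subtype_iff.2 this
  have h2 := hf.comp (h1.codRestrict_sphere (n := n) (fun y => by
    have : (y : Amb n) ≠ 0 := y.2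
    simp [norm_smul, this]))
  have h3 := h2 ⟨x, hx⟩
  have h4 : ContMDiffAt 𝓘(ℝ, Amb n) 𝓘(ℝ, G) 1 (fun x => f (dir x)) x := by
    refine contMDiffAt_subtype_iff (U := U) (x := ⟨x, hx⟩)|>.1 ?_
    convert h3 using 1
    funext y
    simp only [Function.comp]
    congr 1
    ext1
    rw [coe_dir y.2]; rfl
  exact h4.contDiffAt.contDiffWithinAt

lemma contMDiff_of_contDiffOn {G : Type*} [NormedAddCommGroup G] [NormedSpace ℝ G]
    {F : Amb n → G} (hF : ContDiffOn ℝ 1 F {0}ᶜ) :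
    ContMDiff (𝓡 n) 𝓘(ℝ, G) 1 (fun z : Sph n => F z) := by
  intro z
  have : Fact (Module.finrank ℝ (Amb n) = n + 1) := ⟨finrank_euclideanSpace_fin⟩
  have h1 : ContMDiffAt 𝓘(ℝ, Amb n) 𝓘(ℝ, G) 1 F (z : Amb n) :=
    (hF.contDiffAt (isOpen_compl_singleton.mem_nhds (coe_ne_zero z))).contMDiffAt
  have h2 : ContMDiff (𝓡 n) 𝓘(ℝ, Amb n) 1 ((↑) : Sph n → Amb n) := contMDiff_coe_sphere
  exact h1.comp z h2.contMDiffAt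

end

section

variable {n : ℕ}

/-! ### Calculus of the divergence -/

lemma ediv_add {F G : Amb n → Amb n} {x : Amb n} (hF : DifferentiableAt ℝ F x)
    (hG : DifferentiableAt ℝ G x) : ediv (fun y => F y + G y) x = ediv F x + ediv G x := by
  simp [ediv, fderiv_fun_add hF hG, Finset.sum_add_distrib]

lemma sum_apply_single (L : Amb n →L[ℝ] ℝ) (v : Amb n) :
    ∑ i, L (EuclideanSpace.single i 1) * v i = L v := by
  conv_rhs => rw [← (EuclideanSpace.basisFun (Fin (n + 1)) ℝ).sum_repr v]
  simp [mul_comm]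

lemma ediv_smul {a : Amb n → ℝ} {F : Amb n → Amb n} {x : Amb n} (ha : DifferentiableAt ℝ a x)
    (hF : DifferentiableAt ℝ F x) :
    ediv (fun y => a y • F y) x = a x * ediv F x + fderiv ℝ a x (F x) := by
  simp [ediv, fderiv_fun_smul ha hF, Finset.sum_add_distrib, Finset.mul_sum, sum_apply_single]

lemma ediv_id (x : Amb n) : ediv (fun y => y) x = n + 1 := by
  simp [ediv]

lemma fderiv_norm_apply {x : Amb n} (hx : x ≠ 0) (h : Amb n) :
    fderiv ℝ (fun y : Amb n => ‖y‖) x h = ‖x‖⁻¹ * inner ℝ x h := by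
  have h1 := (hasStrictFDerivAt_norm_sq x).hasFDerivAt
  have h2 := ((contDiffAt_norm ℝ hx (n := 1)).differentiableAt one_ne_zero).hasFDerivAt.pow 2
  have h3 := congrArg (fun L => L h) (h2.unique h1)
  have h4 : ‖x‖ ≠ 0 := norm_ne_zero_iff.2 hx
  have h5 : 2 * ‖x‖ * fderiv ℝ (fun y : Amb n => ‖y‖) x h = 2 * inner ℝ x h := by
    simpa [two_mul] using h3
  field_simp
  linarith

lemma fderiv_radial_apply {α : ℝ → ℝ} {x : Amb n} (hx : x ≠ 0)
    (hα : DifferentiableAt ℝ α ‖x‖) (h : Amb n) :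
    fderiv ℝ (fun y : Amb n => α ‖y‖) x h = deriv α ‖x‖ * (‖x‖⁻¹ * inner ℝ x h) := by
  have h2 := ((contDiffAt_norm ℝ hx (n := 1)).differentiableAt one_ne_zero)
  have := (hα.hasDerivAt.comp_hasFDerivAt x h2.hasFDerivAt).fderiv
  have h3 : (fun y : Amb n => α ‖y‖) = α ∘ fun y : Amb n => ‖y‖ := rfl
  rw [h3, this]
  simp [fderiv_norm_apply hx]

lemma homExt_smul (X : Sph n → Amb n) {c : ℝ} (hc : 0 < c) (x : Amb n) :
    homExt X (c • x) = homExt X x := by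
  unfold homExt
  rw [norm_smul, smul_smul, Real.norm_of_nonneg hc.le]
  congr 2
  field_simp

/-- The extension is homogeneous of degree `0`, hence its derivative is homogeneous of degree `-1`.
-/
lemma ediv_homExt_polar (X : Sph n → Amb n) (p : Sph n × ℝ) :
    ediv (homExt X) (polar p) = Real.exp (-p.2) * sdiv X p.1 := by
  have h : fderiv ℝ (homExt X) (p.1 : Amb n) = Real.exp p.2 • fderiv ℝ (homExt X) (polar p) := by
    have h1 : homExt X = fun x => homExt X (Real.exp p.2 • x) := by
      funext x; rw [homExt_smul X (Real.exp_pos _)]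
    conv_lhs => rw [h1]
    exact fderiv_comp_smul (f := homExt X) _
  unfold sdiv ediv
  rw [h, Finset.mul_sum]
  refine Finset.sum_congr rfl fun i _ => ?_
  simp [← mul_assoc, ← Real.exp_add]

lemma homExt_contDiffOn {X : Sph n → Amb n} (hX : ContMDiff (𝓡 n) 𝓘(ℝ, Amb n) 1 X) :
    ContDiffOn ℝ 1 (homExt X) {0}ᶜ :=
  (contDiffOn_comp_dir hX).congr fun _ hx => homExt_eq X hx

/-- The field `x ↦ η(log r) r^{-n} (X(z) + q(z) z)` in polar coordinates `x = r z`. -/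
def radialField (η : ℝ → ℝ) (X : Sph n → Amb n) (q : Sph n → ℝ) (x : Amb n) : Amb n :=
  (η (Real.log ‖x‖) * (‖x‖ ^ n)⁻¹) • homExt X x
    + (η (Real.log ‖x‖) * (‖x‖ ^ n)⁻¹ * q (dir x) * ‖x‖⁻¹) • x

section radialField

variable {η : ℝ → ℝ} {X : Sph n → Amb n} {q : Sph n → ℝ}

lemma contDiffOn_radialCoeff (hη : ContDiff ℝ 1 η) :
    ContDiffOn ℝ 1 (fun x : Amb n => η (Real.log ‖x‖) * (‖x‖ ^ n)⁻¹) {0}ᶜ := by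
  intro x hx
  have h0 : ‖x‖ ≠ 0 := norm_ne_zero_iff.2 hx
  have h1 : ContDiffAt ℝ 1 (fun x : Amb n => ‖x‖) x := contDiffAt_norm ℝ hx
  exact ((hη.contDiffAt.comp x (h1.log h0)).mul
    ((h1.pow n).inv (pow_ne_zero n h0))).contDiffWithinAt

lemma contDiffOn_radialCoeff' (hη : ContDiff ℝ 1 η) (hq : ContMDiff (𝓡 n) 𝓘(ℝ, ℝ) 1 q) :
    ContDiffOn ℝ 1
      (fun x : Amb n => η (Real.log ‖x‖) * (‖x‖ ^ n)⁻¹ * q (dir x) * ‖x‖⁻¹) {0}ᶜ := by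
  refine ((contDiffOn_radialCoeff hη).mul (contDiffOn_comp_dir hq)).mul ?_
  intro x hx
  have h0 : ‖x‖ ≠ 0 := norm_ne_zero_iff.2 hx
  exact ((contDiffAt_norm ℝ hx).inv h0).contDiffWithinAt

lemma radialField_support (x : Amb n) (hx : radialField η X q x ≠ 0) :
    x ∈ polar '' ((tsupport X ∪ tsupport q) ×ˢ tsupport η) := by
  have h0 : x ≠ 0 := by
    rintro rfl
    refine hx ?_
    have h1 : homExt X (0 : Amb n) = 0 := by
      unfold homExt
      rw [Function.extend_apply']
      · rfl
      · rintro ⟨z, hz⟩; exact coe_ne_zero z (by simpa using hz)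
    simp [radialField, h1]
  refine ⟨(dir x, Real.log ‖x‖), ⟨?_, ?_⟩, polar_dir_log h0⟩
  · by_contra h
    simp only [mem_union, not_or] at h
    refine hx ?_
    rw [radialField, homExt_eq _ h0, image_eq_zero_of_notMem_tsupport h.1,
      image_eq_zero_of_notMem_tsupport h.2]
    simp
  · refine subset_tsupport _ fun h => hx ?_
    simp [radialField, h]

lemma radialField_tsupport (hc : HasCompactSupport η) :
    tsupport (radialField η X q) ⊆ polar '' ((tsupport X ∪ tsupport q) ×ˢ tsupport η) ∧
      IsCompact (polar '' ((tsupport X ∪ tsupport q) ×ˢ tsupport η)) := by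
  have hK : IsCompact (polar '' ((tsupport X ∪ tsupport q) ×ˢ tsupport η)) :=
    ((((isClosed_tsupport X).union (isClosed_tsupport q)).isCompact).prod hc).image
      continuous_polar
  exact ⟨closure_minimal (fun x hx => radialField_support x hx) hK.isClosed, hK⟩

lemma radialField_hasCompactSupport (hc : HasCompactSupport η) :
    HasCompactSupport (radialField η X q) :=
  (radialField_tsupport hc).2.of_isClosed_subset (isClosed_tsupport _) (radialField_tsupport hc).1

lemma contDiff_radialField (hη : ContDiff ℝ 1 η) (hc : HasCompactSupport η)
    (hX : ContMDiff (𝓡 n) 𝓘(ℝ, Amb n) 1 X) (hq : ContMDiff (𝓡 n) 𝓘(ℝ, ℝ) 1 q) :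
    ContDiff ℝ 1 (radialField η X q) := by
  rw [contDiff_iff_contDiffAt]
  intro x
  by_cases hx : x = 0
  · have h0 : x ∉ tsupport (radialField η X q) := fun h => by
      obtain ⟨p, -, hp⟩ := (radialField_tsupport hc).1 h
      exact polar_ne_zero p (hp.trans hx)
    exact contDiffAt_const.congr_of_eventuallyEq (notMem_tsupport_iff_eventuallyEq.1 h0)
  · have h : ContDiffOn ℝ 1 (radialField η X q) {0}ᶜ :=
      ((contDiffOn_radialCoeff hη).smul (homExt_contDiffOn hX)).add
        ((contDiffOn_radialCoeff' hη hq).smul contDiffOn_id)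
    exact h.contDiffAt (isOpen_compl_singleton.mem_nhds hx)

/-- The derivative of the coefficient along `X` vanishes because `X` is tangential, so the
tangential part contributes `η r^{-(n+1)} div_z X`. In the radial part the coefficient contributes
`η' - (n+1) η` and the identity field contributes `(n+1) η`, leaving only `η' q`. The factor
`r^{-n}` is chosen so that the Jacobian removes every remaining power of `r`. -/
lemma ediv_radialField (hη : ContDiff ℝ 1 η)
    (hX : ContMDiff (𝓡 n) 𝓘(ℝ, Amb n) 1 X) (hq : ContMDiff (𝓡 n) 𝓘(ℝ, ℝ) 1 q)
    (hT : ∀ z : Sph n, inner ℝ (z : Amb n) (X z) = 0) (p : Sph n × ℝ) :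
    Real.exp ((n + 1) * p.2) * ediv (radialField η X q) (polar p)
      = η p.2 * sdiv X p.1 + deriv η p.2 * q p.1 := by
  have hx := polar_ne_zero p
  have hn : {0}ᶜ ∈ nhds (polar p) := isOpen_compl_singleton.mem_nhds hx
  have ha := ((contDiffOn_radialCoeff (n := n) hη).contDiffAt hn).differentiableAt one_ne_zero
  have hb := ((contDiffOn_radialCoeff' hη hq).contDiffAt hn).differentiableAt one_ne_zero
  have hH := ((homExt_contDiffOn hX).contDiffAt hn).differentiableAt one_ne_zero
  have h1 : fderiv ℝ (fun x : Amb n => η (Real.log ‖x‖) * (‖x‖ ^ n)⁻¹) (polar p)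
      (homExt X (polar p)) = 0 := by
    have h0 : ‖polar p‖ ≠ 0 := norm_ne_zero_iff.2 hx
    have hα : DifferentiableAt ℝ (fun r : ℝ => η (Real.log r) * (r ^ n)⁻¹) ‖polar p‖ :=
      (((hη.differentiable one_ne_zero).differentiableAt.comp _
        (Real.differentiableAt_log h0)).mul
        ((differentiableAt_id.pow n).inv (pow_ne_zero n h0)))
    rw [fderiv_radial_apply (α := fun r : ℝ => η (Real.log r) * (r ^ n)⁻¹) hx hα,
      homExt_eq _ hx, dir_polar, polar, inner_smul_left, hT]
    simp
  have h2 : fderiv ℝ (fun x : Amb n => η (Real.log ‖x‖) * (‖x‖ ^ n)⁻¹ * q (dir x) * ‖x‖⁻¹)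
      (polar p) (polar p)
        = (deriv η p.2 - (n + 1) * η p.2) * Real.exp (-((n + 1) * p.2)) * q p.1 := by
    -- The ray `w ↦ e^w z` has velocity equal to its position, so the derivative in the direction
    -- `polar p` is a one-variable derivative in `w`.
    have hd : HasDerivAt (fun w : ℝ => polar (p.1, w)) (polar p) p.2 :=
      (Real.hasDerivAt_exp p.2).smul_const (p.1 : Amb n)
    have h3 := hb.hasFDerivAt.comp_hasDerivAt p.2 hd
    have h4 : HasDerivAt (fun w : ℝ => η w * Real.exp (-((n + 1) * w)) * q p.1)
        ((deriv η p.2 * Real.exp (-((n + 1) * p.2))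
          + η p.2 * (Real.exp (-((n + 1) * p.2)) * (-((n + 1) * 1)))) * q p.1) p.2 := by
      exact (((hη.differentiable one_ne_zero) p.2).hasDerivAt.mul
        (((hasDerivAt_id p.2).const_mul ((n : ℝ) + 1)).neg.exp)).mul_const _
    have h5 : ((fun x : Amb n => η (Real.log ‖x‖) * (‖x‖ ^ n)⁻¹ * q (dir x) * ‖x‖⁻¹) ∘
        fun w : ℝ => polar (p.1, w)) = fun w : ℝ => η w * Real.exp (-((n + 1) * w)) * q p.1 := by
      funext w
      simp only [Function.comp, norm_polar, dir_polar, Real.log_exp]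
      rw [← Real.exp_nat_mul, ← Real.exp_neg, ← Real.exp_neg,
        show -((n + 1) * w) = -((n : ℝ) * w) + -w by ring, Real.exp_add]
      ring
    rw [h5] at h3
    rw [h3.unique h4]; ring
  unfold radialField
  rw [ediv_add (ha.fun_smul hH) (hb.fun_smul differentiableAt_fun_id), ediv_smul ha hH,
    ediv_smul hb differentiableAt_fun_id, h1, ediv_homExt_polar, ediv_id, h2, dir_polar, norm_polar,
    Real.log_exp, ← Real.exp_nat_mul, ← Real.exp_neg, ← Real.exp_neg]
  have e1 : Real.exp (-((n + 1) * p.2)) = Real.exp (-(n * p.2)) * Real.exp (-p.2) := by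
    rw [← Real.exp_add]; congr 1; ring
  have e2 : Real.exp ((n + 1) * p.2) * (Real.exp (-(n * p.2)) * Real.exp (-p.2)) = 1 := by
    rw [← e1, ← Real.exp_add]; simp
  rw [e1]
  linear_combination (η p.2 * sdiv X p.1 + deriv η p.2 * q p.1) * e2

end radialField

/-- A smooth bump function on the line. -/
lemma exists_bump {a b : ℝ} (hb : 0 ≤ a) (hab : a < b) : ∃ η : ℝ → ℝ, ContDiff ℝ 1 η ∧
    (∀ w, 0 ≤ η w ∧ η w ≤ 1) ∧ (∀ w, |w| ≤ a → η w = 1) ∧ tsupport η ⊆ Ioo (-b) b := by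
  -- The argument is at least `1` for `|w| ≤ a` and positive only for `|w| < (a + b) / 2`. The
  -- midpoint leaves room for the closed support inside the open interval.
  refine ⟨fun w => Real.smoothTransition ((((a + b) / 2) ^ 2 - w ^ 2) / (((a + b) / 2) ^ 2 - a ^ 2)),
    ?_, fun w => ⟨Real.smoothTransition.nonneg _, Real.smoothTransition.le_one _⟩, ?_, ?_⟩
  · exact Real.smoothTransition.contDiff.comp (by fun_prop)
  · intro w hw
    apply Real.smoothTransition.one_of_one_le
    rw [one_le_div (by nlinarith)]
    have : w ^ 2 ≤ a ^ 2 := sq_le_sq' (by linarith [abs_le.1 hw]) (abs_le.1 hw).2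
    linarith
  · refine (closure_minimal (t := Icc (-((a + b) / 2)) ((a + b) / 2)) ?_ isClosed_Icc).trans ?_
    · intro w hw
      have h1 : 0 < (((a + b) / 2) ^ 2 - w ^ 2) / (((a + b) / 2) ^ 2 - a ^ 2) := by
        by_contra h
        exact hw (Real.smoothTransition.zero_of_nonpos (not_lt.1 h))
      have h2 := (div_pos_iff_of_pos_right (show 0 < ((a + b) / 2) ^ 2 - a ^ 2 by nlinarith)).1 h1
      exact abs_le.1 (abs_le_of_sq_le_sq (by linarith) (by linarith))
    · exact Icc_subset_Ioo (by linarith) (by linarith)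

/-! ### Divergence on the sphere and tangential projections. -/

lemma sdiv_continuous {X : Sph n → Amb n} (hX : ContMDiff (𝓡 n) 𝓘(ℝ, Amb n) 1 X) :
    Continuous (sdiv X) := by
  have h := (homExt_contDiffOn hX).continuousOn_fderiv_of_isOpen isOpen_compl_singleton le_rfl
  have h2 : Continuous fun z : Sph n => fderiv ℝ (homExt X) (z : Amb n) :=
    h.comp_continuous continuous_subtype_val coe_ne_zero
  unfold sdiv ediv
  fun_prop

lemma integrable_of_continuous {G : Type*} [NormedAddCommGroup G] {f : Sph n → G}
    (hf : Continuous f) : Integrable f (surf n) :=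
  hf.integrable_of_hasCompactSupport (HasCompactSupport.of_compactSpace f)

/-- The divergence theorem on the sphere. -/
lemma integral_sdiv_eq_zero {X : Sph n → Amb n} (hX : ContMDiff (𝓡 n) 𝓘(ℝ, Amb n) 1 X)
    (hT : ∀ z : Sph n, inner ℝ (z : Amb n) (X z) = 0) : ∫ z, sdiv X z ∂(surf n) = 0 := by
  -- With no radial component the divergence of the lifted field has a product form in `(z, w)`. Its
  -- vanishing integral is the spherical integral times `∫ η > 0`.
  obtain ⟨η, hη, hη01, hη1, hηs⟩ := exists_bump (a := 1) (b := 2) (by norm_num) (by norm_num)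
  have hc : HasCompactSupport η := isCompact_Icc.of_isClosed_subset (isClosed_tsupport _)
    (hηs.trans Ioo_subset_Icc_self)
  have hq : ContMDiff (𝓡 n) 𝓘(ℝ, ℝ) 1 (fun _ : Sph n => (0 : ℝ)) := contMDiff_const
  have h := integral_ediv_eq_zero (contDiff_radialField hη hc hX hq)
    (radialField_hasCompactSupport hc)
  rw [integral_polar] at h
  simp_rw [ediv_radialField hη hX hq hT, mul_zero, add_zero] at h
  have h' := integral_prod_mul (μ := surf n) (ν := (volume : Measure ℝ)) (sdiv X) η
  simp_rw [mul_comm (sdiv X _)] at h'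
  rw [h'] at h
  refine (mul_eq_zero.1 h).resolve_right (ne_of_gt ?_)
  have hi : Integrable η := hη.continuous.integrable_of_hasCompactSupport hc
  rw [integral_pos_iff_support_of_nonneg (fun w => (hη01 w).1) hi]
  refine lt_of_lt_of_le ?_ (measure_mono (s := Icc (-1 : ℝ) 1) fun w hw => ?_)
  · simp
  · simp [hη1 w (abs_le.2 hw)]

lemma continuousAt_dir {x : Amb n} (hx : x ≠ 0) : ContinuousAt (dir : Amb n → Sph n) x := by
  rw [Topology.IsInducing.subtypeVal.continuousAt_iff]
  refine ((contDiffOn_normalize.contDiffAt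
    (isOpen_compl_singleton.mem_nhds hx)).continuousAt).congr ?_
  filter_upwards [isOpen_compl_singleton.mem_nhds hx] with y hy
  exact (coe_dir hy).symm

lemma sdiv_eq_zero_of_notMem {X : Sph n → Amb n} {z : Sph n} (hz : z ∉ tsupport X) :
    sdiv X z = 0 := by
  have h1 : X =ᶠ[nhds (dir (z : Amb n))] 0 := by
    rw [dir_coe]; exact notMem_tsupport_iff_eventuallyEq.1 hz
  have h2 : homExt X =ᶠ[nhds (z : Amb n)] fun _ => 0 := by
    filter_upwards [(continuousAt_dir (coe_ne_zero z)).eventually h1,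
      isOpen_compl_singleton.mem_nhds (coe_ne_zero z)] with x hx hx0
    rw [homExt_eq _ hx0, hx]; rfl
  simp [sdiv, ediv, h2.fderiv_eq]

/-- At a unit vector the differential of `x / |x|` is the orthogonal projection onto the tangent
space. Its trace `n` is the source of the dimensional term in `sdiv_proj`. -/
lemma hasFDerivAt_normalize (z : Sph n) : HasFDerivAt (fun x : Amb n => ‖x‖⁻¹ • x)
    (ContinuousLinearMap.id ℝ (Amb n)
      - (innerSL ℝ (z : Amb n)).smulRight (z : Amb n)) (z : Amb n) := by
  have h2 := ((contDiffAt_norm ℝ (coe_ne_zero z) (n := 1)).differentiableAt one_ne_zero)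
  have h3 : HasFDerivAt (fun x : Amb n => ‖x‖⁻¹) _ (z : Amb n) :=
    (hasDerivAt_inv (norm_ne_zero_iff.2 (coe_ne_zero z))).comp_hasFDerivAt _ h2.hasFDerivAt
  convert! h3.fun_smul (hasFDerivAt_id _) using 1
  ext1 h
  simp [fderiv_norm_apply (coe_ne_zero z), sub_eq_add_neg]

/-- The divergence of the tangential projection of an ambient field. -/
lemma sdiv_proj {W : Amb n → Amb n} {z : Sph n} (hW : DifferentiableAt ℝ W (z : Amb n)) :
    sdiv (fun ζ => W ζ - inner ℝ (ζ : Amb n) (W ζ) • (ζ : Amb n)) z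
      = ediv W z - inner ℝ (z : Amb n) (fderiv ℝ W z z) - n * inner ℝ (z : Amb n) (W z) := by
  have hz : ‖(z : Amb n)‖⁻¹ • (z : Amb n) = z := by simp
  have hν := hasFDerivAt_normalize z
  have hW' : HasFDerivAt W (fderiv ℝ W (z : Amb n)) (‖(z : Amb n)‖⁻¹ • (z : Amb n)) := by
    rw [hz]; exact hW.hasFDerivAt
  have hA : HasFDerivAt (fun x : Amb n => inner ℝ x (W x)) _ (‖(z : Amb n)‖⁻¹ • (z : Amb n)) :=
    (hasFDerivAt_id _).inner ℝ hW'
  have hWν : HasFDerivAt (fun x : Amb n => W (‖x‖⁻¹ • x)) _ (z : Amb n) :=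
    HasFDerivAt.comp (f := fun x : Amb n => ‖x‖⁻¹ • x) (z : Amb n) hW' hν
  have hAν : HasFDerivAt (fun x : Amb n => inner ℝ (‖x‖⁻¹ • x) (W (‖x‖⁻¹ • x))) _ (z : Amb n) :=
    HasFDerivAt.comp (f := fun x : Amb n => ‖x‖⁻¹ • x) (z : Amb n) hA hν
  have hP : (ContinuousLinearMap.id ℝ (Amb n)
      - (innerSL ℝ (z : Amb n)).smulRight (z : Amb n)) (z : Amb n) = 0 := by simp
  have hsq : ∑ i, (z : Amb n) i * (z : Amb n) i = 1 := by
    have := EuclideanSpace.real_norm_sq_eq (z : Amb n)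
    simpa [sq] using this.symm
  have e1 : ediv (fun x : Amb n => ‖x‖⁻¹ • x) (z : Amb n) = n := by
    unfold ediv
    rw [hν.fderiv]
    simp [Finset.sum_sub_distrib, EuclideanSpace.inner_single_right, hsq]
  have e2 : ediv (fun x : Amb n => W (‖x‖⁻¹ • x)) (z : Amb n)
      = ediv W z - inner ℝ (z : Amb n) (fderiv ℝ W z z) := by
    unfold ediv
    rw [hWν.fderiv]
    simp [Finset.sum_sub_distrib, PiLp.inner_apply, mul_comm]
  have hev : homExt (fun ζ : Sph n => W ζ - inner ℝ (ζ : Amb n) (W ζ) • (ζ : Amb n))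
      =ᶠ[nhds (z : Amb n)] fun x => W (‖x‖⁻¹ • x)
        + (-inner ℝ (‖x‖⁻¹ • x) (W (‖x‖⁻¹ • x))) • (‖x‖⁻¹ • x) := by
    filter_upwards [isOpen_compl_singleton.mem_nhds (coe_ne_zero z)] with x hx
    rw [homExt_eq _ hx, coe_dir hx, neg_smul, sub_eq_add_neg]
  have e3 := ediv_smul hAν.fun_neg.differentiableAt hν.differentiableAt
  have e4 : sdiv (fun ζ => W ζ - inner ℝ (ζ : Amb n) (W ζ) • (ζ : Amb n)) z
      = ediv (fun x => W (‖x‖⁻¹ • x)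
        + (-inner ℝ (‖x‖⁻¹ • x) (W (‖x‖⁻¹ • x))) • (‖x‖⁻¹ • x)) z := by
    unfold sdiv ediv
    rw [hev.fderiv_eq]
  rw [e4, ediv_add hWν.differentiableAt
    (hAν.fun_neg.differentiableAt.fun_smul hν.differentiableAt), e3, hAν.fun_neg.fderiv, e2, e1, hz]
  simp only [neg_apply, ContinuousLinearMap.comp_apply, hP, map_zero]
  ring

end

section

variable {n : ℕ}

/-! ### Heights and cones -/

lemma contDiff_height : ContDiff ℝ 1 (height : Amb n → ℝ) := by
  unfold height; fun_prop

lemma continuous_height : Continuous (height : Amb n → ℝ) := contDiff_height.continuous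

@[simp] lemma height_polar (p : Sph n × ℝ) :
    height (polar p) = Real.exp p.2 * height (p.1 : Amb n) := by
  simp [height, polar]

lemma abs_height_le (x : Amb n) : |height x| ≤ ‖x‖ := PiLp.norm_apply_le x (Fin.last n)

lemma polar_mem_coneSlab {Ω : Set (Sph n)} {a b : ℝ} {p : Sph n × ℝ} :
    polar p ∈ coneSlab Ω a b ↔ p.1 ∈ Ω ∧ a < p.2 ∧ p.2 < b := by
  constructor
  · rintro ⟨z, hz, w, ha, hb, h⟩
    have : p = (z, w) := polar_injective h
    subst this
    exact ⟨hz, ha, hb⟩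
  · rintro ⟨hz, ha, hb⟩
    exact ⟨p.1, hz, p.2, ha, hb, rfl⟩

lemma exists_polar_of_mem_coneSlab {Ω : Set (Sph n)} {a b : ℝ} {x : Amb n}
    (hx : x ∈ coneSlab Ω a b) : ∃ p : Sph n × ℝ, polar p = x := by
  obtain ⟨z, -, w, -, -, rfl⟩ := hx
  exact ⟨(z, w), rfl⟩

lemma height_pos_of_mem_coneSlab {Ω : Set (Sph n)} (hΩ : Ω ⊆ upperHemisphere n) {a b : ℝ}
    {x : Amb n} (hx : x ∈ coneSlab Ω a b) : 0 < height x := by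
  obtain ⟨p, rfl⟩ := exists_polar_of_mem_coneSlab hx
  rw [height_polar]
  exact mul_pos (Real.exp_pos _) (hΩ (polar_mem_coneSlab.1 hx).1)

lemma measurableSet_coneSlab {Ω : Set (Sph n)} (hΩ : IsOpen Ω) (a b : ℝ) :
    MeasurableSet (coneSlab Ω a b) := by
  have : coneSlab Ω a b = polar '' (Ω ×ˢ Ioo a b) := by
    ext x
    constructor
    · intro hx
      obtain ⟨p, rfl⟩ := exists_polar_of_mem_coneSlab hx
      exact mem_image_of_mem _ ⟨(polar_mem_coneSlab.1 hx).1, (polar_mem_coneSlab.1 hx).2⟩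
    · rintro ⟨p, hp, rfl⟩
      exact polar_mem_coneSlab.2 ⟨hp.1, hp.2⟩
  rw [this]
  exact measurableEmbedding_polar.measurableSet_image.2 (hΩ.measurableSet.prod measurableSet_Ioo)

lemma contMDiff_weight {Ω : Set (Sph n)} (hΩ : Ω ⊆ upperHemisphere n) {G : Type*}
    [NormedAddCommGroup G] [NormedSpace ℝ G] {ψ : Sph n → G}
    (hψ : ContMDiff (𝓡 n) 𝓘(ℝ, G) 1 ψ) (hs : tsupport ψ ⊆ Ω) :
    ContMDiff (𝓡 n) 𝓘(ℝ, G) 1 (fun z : Sph n => (height (z : Amb n) ^ n)⁻¹ • ψ z) := by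
  intro z
  by_cases hz : z ∈ tsupport ψ
  · have hy : 0 < height (z : Amb n) := hΩ (hs hz)
    have : Fact (Module.finrank ℝ (Amb n) = n + 1) := ⟨finrank_euclideanSpace_fin⟩
    have h2 : ContMDiff (𝓡 n) 𝓘(ℝ, Amb n) 1 ((↑) : Sph n → Amb n) := contMDiff_coe_sphere
    have h1 : ContMDiffAt 𝓘(ℝ, Amb n) 𝓘(ℝ, ℝ) 1 (fun x : Amb n => (height x ^ n)⁻¹) (z : Amb n) :=
      ((contDiff_height.contDiffAt.pow n).inv (pow_ne_zero n hy.ne')).contMDiffAt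
    exact (h1.comp z h2.contMDiffAt).smul hψ.contMDiffAt
  · have h1 : (fun z : Sph n => (height (z : Amb n) ^ n)⁻¹ • ψ z) =ᶠ[nhds z] fun _ => 0 := by
      filter_upwards [notMem_tsupport_iff_eventuallyEq.1 hz] with y hy
      rw [hy]; simp
    exact contMDiffAt_const.congr_of_eventuallyEq h1

lemma tsupport_weight_subset {G : Type*} [NormedAddCommGroup G] [NormedSpace ℝ G]
    (a : Sph n → ℝ) (ψ : Sph n → G) : tsupport (fun z => a z • ψ z) ⊆ tsupport ψ :=
  tsupport_smul_subset_right _ _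

/-! ### The vertical rearrangement -/

/-- The function whose subgraph has the same length as `E` on each ray. -/
def rearrange (T : ℝ) (E : Set (Amb n)) (z : Sph n) : ℝ :=
  (∫ w in Ioo (-T - 1) (T + 1), E.indicator (fun _ => (1 : ℝ)) (polar (z, w))) - (T + 1)

lemma quasiMeasurePreserving_polar :
    Measure.QuasiMeasurePreserving (polar : Sph n × ℝ → Amb n)
      ((surf n).prod (volume : Measure ℝ)) volume := by
  refine ⟨continuous_polar.measurable, ?_⟩
  intro s hs
  rw [measurableEmbedding_polar.map_apply]
  have h1 : ∀ᵐ x : Amb n, x ∉ s := measure_eq_zero_iff_ae_notMem.1 hs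
  exact measure_eq_zero_iff_ae_notMem.2 (ae_polar.1 h1)

variable {E : Set (Amb n)} {Ω : Set (Sph n)} {T : ℝ}

lemma aestronglyMeasurable_indicator_polar (hE : NullMeasurableSet E) :
    AEStronglyMeasurable (fun p : Sph n × ℝ => E.indicator (fun _ => (1 : ℝ)) (polar p))
      ((surf n).prod (volume : Measure ℝ)) := by
  have h : NullMeasurableSet (polar ⁻¹' E) ((surf n).prod (volume : Measure ℝ)) :=
    hE.preimage quasiMeasurePreserving_polar
  exact (aemeasurable_const.indicator₀ h).aestronglyMeasurable

lemma norm_indicator_one_le {α : Type*} (s : Set α) (x : α) :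
    ‖s.indicator (fun _ => (1 : ℝ)) x‖ ≤ 1 := by
  by_cases h : x ∈ s <;> simp [h]

lemma integrable_rearrange (hT : 0 < T) (hE : NullMeasurableSet E) :
    Integrable (rearrange T E) (surf n) := by
  have h1 : AEStronglyMeasurable (fun z : Sph n =>
      ∫ w in Ioo (-T - 1) (T + 1), E.indicator (fun _ => (1 : ℝ)) (polar (z, w))) (surf n) := by
    refine AEStronglyMeasurable.integral_prod_right' (μ := surf n)
      (ν := (volume : Measure ℝ).restrict (Ioo (-T - 1) (T + 1)))
      (f := fun p : Sph n × ℝ => E.indicator (fun _ => (1 : ℝ)) (polar p)) ?_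
    have := (aestronglyMeasurable_indicator_polar hE).restrict (s := univ ×ˢ Ioo (-T - 1) (T + 1))
    rwa [← Measure.prod_restrict, Measure.restrict_univ] at this
  refine Integrable.sub ?_ (integrable_const _)
  refine Integrable.of_bound h1 (2 * (T + 1)) (.of_forall fun z => ?_)
  refine (norm_setIntegral_le_of_norm_le_const (by simp)
    (fun w _ => norm_indicator_one_le E _)).trans ?_
  rw [Real.volume_real_Ioo_of_le (by linarith)]
  linarith

lemma IsCompetitor.ae_ae (hE : IsCompetitor Ω T E) : ∀ᵐ z ∂(surf n), ∀ᵐ w : ℝ,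
    (z ∈ Ω → -T - 1 < w → w < -T → polar (z, w) ∈ E) ∧
      (polar (z, w) ∈ E → z ∈ Ω ∧ -T - 1 < w ∧ w < T) := by
  refine Measure.ae_ae_of_ae_prod (p := fun p : Sph n × ℝ =>
    (p.1 ∈ Ω → -T - 1 < p.2 → p.2 < -T → polar p ∈ E) ∧
      (polar p ∈ E → p.1 ∈ Ω ∧ -T - 1 < p.2 ∧ p.2 < T)) ?_
  filter_upwards [ae_polar.1 hE.lower, ae_polar.1 hE.upper] with p h1 h2
  exact ⟨fun a b c => h1 (polar_mem_coneSlab.2 ⟨a, b, c⟩), fun a => polar_mem_coneSlab.1 (h2 a)⟩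

lemma integrableOn_indicator_ray {z : Sph n}
    (hm : AEStronglyMeasurable (fun w => E.indicator (fun _ => (1 : ℝ)) (polar (z, w))) volume) :
    IntegrableOn (fun w => E.indicator (fun _ => (1 : ℝ)) (polar (z, w)))
      (Ioo (-T - 1) (T + 1)) :=
  Measure.integrableOn_of_bounded (by simp) hm
    (.of_forall fun w => norm_indicator_one_le E (polar (z, w)))

/-! ### Integration along rays against a cutoff. -/

section cutoff

variable {η : ℝ → ℝ}

/-- The cutoff differs from `1` only for `|w| > T`, where almost every point of the ray is known to
be in `E` (below `-T`) or not in `E` (above `T`). Replacing `η` by `1` therefore costs a constant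
that does not depend on `E` or `z`. For the same reason `η'` is only seen below `-T`, where it
integrates to `η(-T) - η(-T-1) = 1`. -/
lemma ray_integral (hT : 0 < T) (hη : ContDiff ℝ 1 η)
    (hη1 : ∀ w, |w| ≤ T → η w = 1) (hηs : tsupport η ⊆ Ioo (-(T + 1)) (T + 1)) {z : Sph n}
    (hm : AEStronglyMeasurable (fun w => E.indicator (fun _ => (1 : ℝ)) (polar (z, w))) volume)
    (hz : z ∈ Ω)
    (h : ∀ᵐ w : ℝ, (z ∈ Ω → -T - 1 < w → w < -T → polar (z, w) ∈ E) ∧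
      (polar (z, w) ∈ E → z ∈ Ω ∧ -T - 1 < w ∧ w < T)) :
    (∫ w, E.indicator (fun _ => (1 : ℝ)) (polar (z, w)) * η w
      = rearrange T E z + ((T + 1) + ∫ w in Ioo (-T - 1) (-T), (η w - 1))) ∧
    ∫ w, E.indicator (fun _ => (1 : ℝ)) (polar (z, w)) * deriv η w = 1 := by
  have hη0 : ∀ w, w ∉ Ioo (-T - 1) (T + 1) → η w = 0 := fun w hw =>
    image_eq_zero_of_notMem_tsupport fun h => hw (by rw [← neg_add']; exact hηs h)
  have hcη : Continuous η := hη.continuous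
  constructor
  · have e1 : ∫ w in Ioo (-T - 1) (-T), (η w - 1)
        = ∫ w in Ioo (-T - 1) (T + 1),
          E.indicator (fun _ => (1 : ℝ)) (polar (z, w)) * (η w - 1) := by
      rw [← integral_indicator measurableSet_Ioo, ← integral_indicator measurableSet_Ioo]
      refine integral_congr_ae ?_
      filter_upwards [h, Measure.ae_ne volume (-T)] with w hw hwT
      by_cases h1 : w ∈ Ioo (-T - 1) (-T)
      · have h2 : w ∈ Ioo (-T - 1) (T + 1) := ⟨h1.1, by linarith [h1.2]⟩
        rw [indicator_of_mem h1, indicator_of_mem h2, indicator_of_mem (hw.1 hz h1.1 h1.2), one_mul]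
      · rw [indicator_of_notMem h1]
        by_cases h2 : w ∈ Ioo (-T - 1) (T + 1)
        · rw [indicator_of_mem h2]
          by_cases h3 : polar (z, w) ∈ E
          · have h4 : w < T := (hw.2 h3).2.2
            have h5 : -T ≤ w := by
              by_contra h6
              exact h1 ⟨h2.1, not_le.1 h6⟩
            rw [hη1 w (abs_le.2 ⟨h5, h4.le⟩)]; simp
          · rw [indicator_of_notMem h3, zero_mul]
        · rw [indicator_of_notMem h2]
    have e2 : ∫ w, E.indicator (fun _ => (1 : ℝ)) (polar (z, w)) * η w
        = ∫ w in Ioo (-T - 1) (T + 1), E.indicator (fun _ => (1 : ℝ)) (polar (z, w)) * η w :=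
      (setIntegral_eq_integral_of_forall_compl_eq_zero fun w hw => by rw [hη0 w hw, mul_zero]).symm
    have hi := integrableOn_indicator_ray (T := T) hm
    have hb : IntegrableOn (fun w => E.indicator (fun _ => (1 : ℝ)) (polar (z, w)) * η w)
        (Ioo (-T - 1) (T + 1)) := by
      have hc : HasCompactSupport η := isCompact_Icc.of_isClosed_subset (isClosed_tsupport _)
        (hηs.trans Ioo_subset_Icc_self)
      exact ((hcη.integrable_of_hasCompactSupport hc).bdd_mul hm
        (.of_forall fun w => norm_indicator_one_le E (polar (z, w)))).integrableOn
    rw [e1, e2, rearrange]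
    simp_rw [mul_sub, mul_one]
    rw [integral_sub hb hi]
    ring
  · have e1 : ∫ w, E.indicator (fun _ => (1 : ℝ)) (polar (z, w)) * deriv η w
        = ∫ w in Ioo (-T - 1) (-T), deriv η w := by
      rw [← integral_indicator measurableSet_Ioo]
      have hd1 : ∀ w ∈ Ioo (-T) T, deriv η w = 0 := fun w hw => by
        have : η =ᶠ[nhds w] fun _ => 1 := by
          filter_upwards [Ioo_mem_nhds hw.1 hw.2] with s hs
          exact hη1 s (abs_le.2 ⟨hs.1.le, hs.2.le⟩)
        rw [this.deriv_eq, deriv_const]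
      refine integral_congr_ae ?_
      filter_upwards [h, Measure.ae_ne volume (-T)] with w hw hwT
      by_cases h1 : w ∈ Ioo (-T - 1) (-T)
      · rw [indicator_of_mem h1, indicator_of_mem (hw.1 hz h1.1 h1.2), one_mul]
      · rw [indicator_of_notMem h1]
        by_cases h3 : polar (z, w) ∈ E
        · have h4 := (hw.2 h3).2
          have h5 : -T ≤ w := by
            by_contra h6
            exact h1 ⟨h4.1, not_le.1 h6⟩
          rw [hd1 w ⟨lt_of_le_of_ne h5 (Ne.symm hwT), h4.2⟩, mul_zero]
        · rw [indicator_of_notMem h3, zero_mul]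
    rw [e1, ← integral_Ioc_eq_integral_Ioo, ← intervalIntegral.integral_of_le (by linarith),
      intervalIntegral.integral_deriv_eq_sub (fun w _ => hη.differentiable one_ne_zero w)
        ((hη.continuous_deriv le_rfl).intervalIntegrable _ _),
      hη1 (-T) (by rw [abs_neg, abs_of_pos hT]), hη0 (-T - 1) (by simp), sub_zero]

lemma setIntegral_ediv_radialField (hT : 0 < T) (hE : IsCompetitor Ω T E)
    (hη : ContDiff ℝ 1 η)
    (hη1 : ∀ w, |w| ≤ T → η w = 1) (hηs : tsupport η ⊆ Ioo (-(T + 1)) (T + 1))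
    {X : Sph n → Amb n} {q : Sph n → ℝ}
    (hX : ContMDiff (𝓡 n) 𝓘(ℝ, Amb n) 1 X) (hq : ContMDiff (𝓡 n) 𝓘(ℝ, ℝ) 1 q)
    (hXT : ∀ z : Sph n, inner ℝ (z : Amb n) (X z) = 0) (hXs : tsupport X ⊆ Ω)
    (hqs : tsupport q ⊆ Ω) :
    ∫ x in truncCone Ω T, E.indicator (fun _ => (1 : ℝ)) x * ediv (radialField η X q) x
      = (∫ z in Ω, rearrange T E z * sdiv X z ∂(surf n)) + ∫ z in Ω, q z ∂(surf n) := by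
  have hc : HasCompactSupport η := isCompact_Icc.of_isClosed_subset (isClosed_tsupport _)
    (hηs.trans Ioo_subset_Icc_self)
  have hsub : tsupport (radialField η X q) ⊆ truncCone Ω T := by
    refine (radialField_tsupport hc).1.trans ?_
    rintro _ ⟨p, ⟨hp1, hp2⟩, rfl⟩
    refine polar_mem_coneSlab.2 ⟨(union_subset hXs hqs) hp1, ?_, (hηs hp2).2⟩
    have := (hηs hp2).1
    linarith
  have hX0 : ∀ z ∉ Ω, sdiv X z = 0 := fun z hz => sdiv_eq_zero_of_notMem fun h => hz (hXs h)
  have hq0 : ∀ z ∉ Ω, q z = 0 := fun z hz => image_eq_zero_of_notMem_tsupport fun h => hz (hqs h)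
  have hm := aestronglyMeasurable_indicator_polar hE.measurable
  rw [setIntegral_eq_integral_of_forall_compl_eq_zero (fun x hx => by
    rw [ediv_eq_zero_of_notMem fun h => hx (hsub h), mul_zero]), integral_polar]
  have e1 : ∀ p : Sph n × ℝ, Real.exp ((n + 1) * p.2) *
      (E.indicator (fun _ => (1 : ℝ)) (polar p) * ediv (radialField η X q) (polar p))
      = E.indicator (fun _ => (1 : ℝ)) (polar p) * (sdiv X p.1 * η p.2)
        + E.indicator (fun _ => (1 : ℝ)) (polar p) * (q p.1 * deriv η p.2) := fun p => by
    rw [mul_left_comm, ediv_radialField hη hX hq hXT]; ring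
  have i1 : Integrable (fun p : Sph n × ℝ =>
      E.indicator (fun _ => (1 : ℝ)) (polar p) * (sdiv X p.1 * η p.2))
      ((surf n).prod volume) :=
    ((integrable_of_continuous (sdiv_continuous hX)).mul_prod
      (hη.continuous.integrable_of_hasCompactSupport hc)).bdd_mul hm
      (.of_forall fun p => norm_indicator_one_le E (polar p))
  have i2 : Integrable (fun p : Sph n × ℝ =>
      E.indicator (fun _ => (1 : ℝ)) (polar p) * (q p.1 * deriv η p.2))
      ((surf n).prod volume) :=
    ((integrable_of_continuous hq.continuous).mul_prod
      ((hη.continuous_deriv le_rfl).integrable_of_hasCompactSupport hc.deriv)).bdd_mul hm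
      (.of_forall fun p => norm_indicator_one_le E (polar p))
  simp_rw [e1]
  rw [integral_add i1 i2, integral_prod _ i1, integral_prod _ i2]
  have hrm := integrable_rearrange hT hE.measurable
  obtain ⟨C, hC⟩ : ∃ C, ∀ z, ‖sdiv X z‖ ≤ C := by
    obtain ⟨C, hC⟩ := isCompact_univ.exists_bound_of_continuousOn (sdiv_continuous hX).continuousOn
    exact ⟨C, fun z => hC z (mem_univ z)⟩
  have i3 : Integrable (fun z => rearrange T E z * sdiv X z) (surf n) :=
    hrm.mul_bdd (c := C) (sdiv_continuous hX).aestronglyMeasurable (.of_forall hC)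
  have key := hE.ae_ae
  have hms : ∀ᵐ z ∂(surf n), AEStronglyMeasurable
      (fun w => E.indicator (fun _ => (1 : ℝ)) (polar (z, w))) volume := hm.prodMk_left
  congr 1
  · rw [setIntegral_eq_integral_of_forall_compl_eq_zero (fun z hz => by rw [hX0 z hz, mul_zero])]
    set c : ℝ := (T + 1) + ∫ w in Ioo (-T - 1) (-T), (η w - 1)
    -- The constant left over from `ray_integral` multiplies `sdiv X`, whose integral over the
    -- sphere is zero, so it may be added freely.
    have e2 : ∫ z, rearrange T E z * sdiv X z ∂(surf n)
        = ∫ z, (rearrange T E z * sdiv X z + c * sdiv X z) ∂(surf n) := by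
      rw [integral_add i3 ((integrable_of_continuous (sdiv_continuous hX)).const_mul c),
        integral_const_mul, integral_sdiv_eq_zero hX hXT, mul_zero, add_zero]
    rw [e2]
    refine integral_congr_ae ?_
    filter_upwards [key, hms] with z hz hmz
    by_cases hzΩ : z ∈ Ω
    · rw [← add_mul, ← (ray_integral hT hη hη1 hηs hmz hzΩ hz).1, ← integral_mul_const]
      exact integral_congr_ae (.of_forall fun w => by simp only; ring)
    · simp [hX0 z hzΩ]
  · rw [setIntegral_eq_integral_of_forall_compl_eq_zero (fun z hz => hq0 z hz)]
    refine integral_congr_ae ?_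
    filter_upwards [key, hms] with z hz hmz
    by_cases hzΩ : z ∈ Ω
    · conv_rhs => rw [← one_mul (q z), ← (ray_integral hT hη hη1 hηs hmz hzΩ hz).2,
        ← integral_mul_const]
      exact integral_congr_ae (.of_forall fun w => by simp only; ring)
    · simp [hq0 z hzΩ]

end cutoff

end

section

variable {n : ℕ} {E : Set (Amb n)} {Ω : Set (Sph n)} {T : ℝ}

/-! ### The area of the rearrangement -/

lemma norm_smul_radial_sq_le {c : ℝ} (hc0 : 0 ≤ c) (hc1 : c ≤ 1) {z : Sph n} {v : Amb n} {t : ℝ}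
    (hT : inner ℝ (z : Amb n) v = 0) (h : ‖v‖ ^ 2 + |t| ^ 2 ≤ 1) :
    ‖c • (v + t • (z : Amb n))‖ ^ 2 ≤ 1 := by
  have h1 : ‖v + t • (z : Amb n)‖ ^ 2 ≤ 1 := by
    rw [norm_add_sq_real, inner_smul_right, real_inner_comm, hT, norm_smul]
    simpa using h
  rw [norm_smul, mul_pow, Real.norm_of_nonneg hc0]
  nlinarith [sq_nonneg ‖v + t • (z : Amb n)‖]

/-- The supremum defining the perimeter contains the lifts of all pairs admissible for the area.
Multiplying the radial field by `x_{n+1}^n = r^n y^n` cancels both its `r^{-n}` and the weight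
`y^{-n}` in `X` and `q`, so the lift is exactly `η (γ + f z)`, of norm at most `1` by orthogonality.
-/
theorem areaEnergy_rearrange_le (hT : 0 < T) (hΩ : Ω ⊆ upperHemisphere n)
    (hE : IsCompetitor Ω T E) : areaEnergy Ω (rearrange T E) ≤ perimeter Ω T E := by
  refine iSup_le fun γ => iSup_le fun f => iSup_le fun ⟨hγ, hf, hγf⟩ => ?_
  obtain ⟨η, hη, hη01, hη1, hηs⟩ := exists_bump hT.le (lt_add_one T)
  have hc : HasCompactSupport η := isCompact_Icc.of_isClosed_subset (isClosed_tsupport _)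
    (hηs.trans Ioo_subset_Icc_self)
  set X : Sph n → Amb n := fun z => (height (z : Amb n) ^ n)⁻¹ • γ z with hXd
  set q : Sph n → ℝ := fun z => (height (z : Amb n) ^ n)⁻¹ • f z with hqd
  have hX := contMDiff_weight hΩ hγ.contMDiff hγ.support
  have hq := contMDiff_weight hΩ hf.contMDiff hf.support
  have hXT : ∀ z : Sph n, inner ℝ (z : Amb n) (X z) = 0 := fun z => by
    rw [hXd, inner_smul_right, hγ.tangent, mul_zero]
  have hXs : tsupport X ⊆ Ω := (tsupport_weight_subset _ _).trans hγ.support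
  have hqs : tsupport q ⊆ Ω := (tsupport_weight_subset _ _).trans hf.support
  have hsub : tsupport (radialField η X q) ⊆ truncCone Ω T := by
    refine (radialField_tsupport hc).1.trans ?_
    rintro _ ⟨p, ⟨hp1, hp2⟩, rfl⟩
    refine polar_mem_coneSlab.2 ⟨(union_subset hXs hqs) hp1, ?_, (hηs hp2).2⟩
    have := (hηs hp2).1
    linarith
  have hF := contDiff_radialField hη hc hX hq
  have hgsub : tsupport (fun x => height x ^ n • radialField η X q x)
      ⊆ tsupport (radialField η X q) := tsupport_smul_subset_right _ _
  have hF0 : ∀ x, x ∉ truncCone Ω T → radialField η X q x = 0 := fun x hx =>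
    image_eq_zero_of_notMem_tsupport fun h => hx (hsub h)
  have hfield : (fun ξ => (height ξ ^ n)⁻¹ • (height ξ ^ n • radialField η X q ξ))
      = radialField η X q := by
    funext x
    by_cases hx : x ∈ truncCone Ω T
    · rw [inv_smul_smul₀ (pow_ne_zero n (height_pos_of_mem_coneSlab hΩ hx).ne')]
    · rw [hF0 x hx, smul_zero, smul_zero]
  refine le_trans (le_of_eq ?_) (le_iSup₂ (f := fun (g : Amb n → Amb n)
    (_ : ContDiff ℝ 1 g ∧ HasCompactSupport g ∧ tsupport g ⊆ truncCone Ω T ∧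
      ∀ x, ‖g x‖ ^ 2 ≤ 1) => ((∫ x in truncCone Ω T,
      E.indicator (fun _ => (1 : ℝ)) x * ediv (fun ξ => (height ξ ^ n)⁻¹ • g ξ) x : ℝ) : EReal))
    (fun x => height x ^ n • radialField η X q x)
    ⟨(contDiff_height.pow n).smul hF,
      (radialField_hasCompactSupport hc).of_isClosed_subset (isClosed_tsupport _) hgsub,
      hgsub.trans hsub, fun x => ?_⟩)
  · simp only [hfield]
    rw [setIntegral_ediv_radialField hT hE hη hη1 hηs hX hq hXT hXs hqs]
    simp only [hXd, smul_eq_mul, mul_comm]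
  · by_cases hx : x ∈ truncCone Ω T
    · obtain ⟨p, rfl⟩ := exists_polar_of_mem_coneSlab hx
      have hp : 0 < height (p.1 : Amb n) := hΩ (polar_mem_coneSlab.1 hx).1
      have h1 : height (polar p) ^ n • radialField η X q (polar p)
          = η p.2 • (γ p.1 + f p.1 • (p.1 : Amb n)) := by
        have hp' := pow_ne_zero n hp.ne'
        have he := pow_ne_zero n (Real.exp_pos p.2).ne'
        have he' := (Real.exp_pos p.2).ne'
        simp only [radialField, norm_polar, Real.log_exp, height_polar, dir_polar,
          homExt_eq _ (polar_ne_zero p), hXd, hqd, mul_pow, smul_add, smul_smul]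
        congr 1
        · congr 1; field_simp
        · rw [polar, smul_smul]; congr 1; simp only [smul_eq_mul]; field_simp
      simp only [h1]
      exact norm_smul_radial_sq_le (hη01 _).1 (hη01 _).2 (hγ.tangent _) (hγf _)
    · simp [hF0 x hx]

/-- Since `0 < y ≤ 1` on `Ω`, the pair `(y^n γ, 0)` is admissible for the area, and the weight
`y^{-n}` undoes the factor. This is how finite area yields membership in `BV`. -/
lemma totalVariation_le_areaEnergy (hΩ : Ω ⊆ upperHemisphere n) (v : Sph n → ℝ) :
    totalVariation Ω v ≤ areaEnergy Ω v := by
  refine iSup_le fun γ => iSup_le fun ⟨hγ, hγ1⟩ => ?_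
  have : Fact (Module.finrank ℝ (Amb n) = n + 1) := ⟨finrank_euclideanSpace_fin⟩
  have hsub : tsupport (fun z : Sph n => height (z : Amb n) ^ n • γ z) ⊆ tsupport γ :=
    tsupport_smul_subset_right _ _
  have hh : ContMDiff (𝓡 n) 𝓘(ℝ, ℝ) 1 (fun z : Sph n => height (z : Amb n) ^ n) :=
    contMDiff_of_contDiffOn (contDiff_height.pow n).contDiffOn
  have hfield : (fun ζ : Sph n => (height (ζ : Amb n) ^ n)⁻¹ • (height (ζ : Amb n) ^ n • γ ζ))
      = γ := by
    funext z
    by_cases hz : z ∈ Ω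
    · have : 0 < height (z : Amb n) := hΩ hz
      rw [inv_smul_smul₀ (pow_ne_zero n this.ne')]
    · rw [image_eq_zero_of_notMem_tsupport fun h => hz (hγ.support h), smul_zero, smul_zero]
  refine le_trans (le_of_eq ?_) (le_iSup₂_of_le (fun z : Sph n => height (z : Amb n) ^ n • γ z)
    (fun _ => 0) (le_iSup_of_le (?_ : IsTangentTest Ω (fun z : Sph n => height (z : Amb n) ^ n • γ z)
      ∧ IsScalarTest Ω (fun _ : Sph n => (0 : ℝ)) ∧ ∀ z : Sph n,
        ‖height (z : Amb n) ^ n • γ z‖ ^ 2 + |(0 : ℝ)| ^ 2 ≤ 1) le_rfl))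
  · simp only [hfield]; simp
  · refine ⟨⟨hh.smul hγ.contMDiff, fun z => ?_, hsub.trans hγ.support⟩,
      ⟨contMDiff_const, ?_⟩, fun z => ?_⟩
    · rw [inner_smul_right, hγ.tangent, mul_zero]
    · have : tsupport (fun _ : Sph n => (0 : ℝ)) = ∅ := tsupport_eq_empty_iff.2 rfl
      simp [this]
    · have h1 : |height (z : Amb n)| ^ n ≤ 1 :=
        pow_le_one₀ (abs_nonneg _) ((abs_height_le _).trans_eq (norm_coe_sph z))
      have h2 : ‖height (z : Amb n) ^ n • γ z‖ ≤ 1 := by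
        rw [norm_smul, norm_pow, Real.norm_eq_abs]
        exact mul_le_one₀ h1 (norm_nonneg _) (hγ1 z)
      simpa using pow_le_one₀ (norm_nonneg _) h2 (n := 2)

lemma isBV_rearrange (hT : 0 < T) (hΩ : Ω ⊆ upperHemisphere n) (hE : IsCompetitor Ω T E)
    (hP : perimeter Ω T E < ⊤) : IsBV Ω (rearrange T E) :=
  ⟨(integrable_rearrange hT hE.measurable).integrableOn,
    ((totalVariation_le_areaEnergy hΩ _).trans (areaEnergy_rearrange_le hT hΩ hE)).trans_lt hP⟩

lemma abs_rearrange_le (hT : 0 < T) (z : Sph n) : |rearrange T E z| ≤ T + 1 := by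
  have h1 : 0 ≤ ∫ w in Ioo (-T - 1) (T + 1), E.indicator (fun _ => (1 : ℝ)) (polar (z, w)) :=
    integral_nonneg fun w => indicator_nonneg (fun _ _ => zero_le_one) _
  have h2 := norm_setIntegral_le_of_norm_le_const (μ := (volume : Measure ℝ))
    (s := Ioo (-T - 1) (T + 1)) (by simp) (fun w _ => norm_indicator_one_le E (polar (z, w)))
  rw [Real.volume_real_Ioo_of_le (by linarith)] at h2
  have h3 := (le_abs_self _).trans h2
  rw [rearrange, abs_le]
  constructor <;> linarith

/-- The volume of a set in terms of its rearrangement. -/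
theorem hypVol_eq (hT : 0 < T) (hΩ : IsOpen Ω)
    (hΩ_int : IntegrableOn (fun z : Sph n => (height (z : Amb n) ^ (n + 1))⁻¹) Ω (surf n))
    (hE : NullMeasurableSet E) :
    hypVol Ω T E = volEnergy Ω (rearrange T E)
      + (T + 1) * ∫ z in Ω, (height (z : Amb n) ^ (n + 1))⁻¹ ∂(surf n) := by
  have hC : MeasurableSet (truncCone Ω T) := measurableSet_coneSlab hΩ _ _
  have e1 : hypVol Ω T E = ∫ x, (truncCone Ω T).indicator
      (fun x => E.indicator (fun _ => (1 : ℝ)) x * (height x ^ (n + 1))⁻¹) x := by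
    rw [hypVol, ← integral_indicator₀ (hE.inter hC.nullMeasurableSet)]
    refine integral_congr_ae (.of_forall fun x => ?_)
    by_cases hx : x ∈ E <;> by_cases hx' : x ∈ truncCone Ω T <;> simp [hx, hx']
  -- The hyperbolic density scales like `e^{-(n+1)w}` along rays and cancels the Jacobian, so the
  -- volume depends only on the length of each slice.
  have e2 : ∀ p : Sph n × ℝ, Real.exp ((n + 1) * p.2) *
      (truncCone Ω T).indicator
        (fun x => E.indicator (fun _ => (1 : ℝ)) x * (height x ^ (n + 1))⁻¹) (polar p)
      = (Ω ×ˢ Ioo (-T - 1) (T + 1)).indicator (fun p : Sph n × ℝ =>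
        E.indicator (fun _ => (1 : ℝ)) (polar p) * (height (p.1 : Amb n) ^ (n + 1))⁻¹) p := fun p => by
    by_cases hp : polar p ∈ truncCone Ω T
    · have hp' : p ∈ Ω ×ˢ Ioo (-T - 1) (T + 1) := polar_mem_coneSlab.1 hp
      rw [indicator_of_mem hp, indicator_of_mem hp', height_polar, mul_pow, mul_inv,
        ← Real.exp_nat_mul, ← Real.exp_neg]
      have : Real.exp ((n + 1) * p.2) * Real.exp (-(((n + 1 : ℕ) : ℝ) * p.2)) = 1 := by
        rw [← Real.exp_add]; push_cast; simp
      linear_combination (E.indicator (fun _ => (1 : ℝ)) (polar p)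
        * (height (p.1 : Amb n) ^ (n + 1))⁻¹) * this
    · have hp' : p ∉ Ω ×ˢ Ioo (-T - 1) (T + 1) := fun h => hp (polar_mem_coneSlab.2 h)
      rw [indicator_of_notMem hp, indicator_of_notMem hp', mul_zero]
  have hm := aestronglyMeasurable_indicator_polar hE
  have i1 : IntegrableOn (fun p : Sph n × ℝ =>
      E.indicator (fun _ => (1 : ℝ)) (polar p) * (height (p.1 : Amb n) ^ (n + 1))⁻¹)
      (Ω ×ˢ Ioo (-T - 1) (T + 1)) ((surf n).prod volume) := by
    rw [IntegrableOn, ← Measure.prod_restrict]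
    refine Integrable.bdd_mul (c := 1) (Integrable.comp_fst hΩ_int _) ?_
      (.of_forall fun p => norm_indicator_one_le E (polar p))
    rw [Measure.prod_restrict]
    exact hm.restrict
  rw [e1, integral_polar]
  simp_rw [e2]
  rw [integral_indicator (hΩ.measurableSet.prod measurableSet_Ioo), setIntegral_prod _ i1,
    volEnergy, ← integral_const_mul, ← integral_add]
  · refine integral_congr_ae (.of_forall fun z => ?_)
    simp only [rearrange, integral_mul_const]
    ring
  · refine Integrable.bdd_mul (c := T + 1) hΩ_int
      (integrable_rearrange hT hE).aestronglyMeasurable.restrict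
      (.of_forall fun z => abs_rearrange_le hT z)
  · exact hΩ_int.const_mul _

end

section

variable {n : ℕ}

/-! ### Zonal kernels -/

section zonal

variable {G : Type*} [NormedAddCommGroup G] [NormedSpace ℝ G]

/-- The zonal convolution `x ↦ ∫ k(x · z) Y(z) dz`. -/
def zonal (k : ℝ → ℝ) (Y : Sph n → G) (x : Amb n) : G :=
  ∫ z, k (inner ℝ x (z : Amb n)) • Y z ∂(surf n)

/-- The derivative of the zonal convolution. -/
def zonalDeriv (k : ℝ → ℝ) (Y : Sph n → G) (x : Amb n) : Amb n →L[ℝ] G :=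
  ∫ z, deriv k (inner ℝ x (z : Amb n)) • (innerSL ℝ (z : Amb n)).smulRight (Y z) ∂(surf n)

variable {k : ℝ → ℝ} {Y : Sph n → G}

lemma exists_bound_on_ball {φ : ℝ → ℝ} (hφ : Continuous φ) (x₀ : Amb n) :
    ∃ C, ∀ x ∈ Metric.ball x₀ 1, ∀ z : Sph n, ‖φ (inner ℝ x (z : Amb n))‖ ≤ C := by
  obtain ⟨C, hC⟩ := (isCompact_Icc (a := -(‖x₀‖ + 1)) (b := ‖x₀‖ + 1)).exists_bound_of_continuousOn
    hφ.continuousOn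
  refine ⟨C, fun x hx z => hC _ (abs_le.1 ?_)⟩
  have h1 : ‖x‖ ≤ ‖x₀‖ + 1 := by
    have := norm_le_norm_add_norm_sub' x x₀
    rw [Metric.mem_ball, dist_eq_norm] at hx
    linarith
  have h2 := abs_real_inner_le_norm x (z : Amb n)
  rw [norm_coe_sph, mul_one] at h2
  exact h2.trans h1

lemma integrable_kernel_smul {φ : ℝ → ℝ} (hφ : Continuous φ) {H : Type*} [NormedAddCommGroup H]
    [NormedSpace ℝ H] {Y : Sph n → H} (hY : Integrable Y (surf n)) (x : Amb n) :
    Integrable (fun z : Sph n => φ (inner ℝ x (z : Amb n)) • Y z) (surf n) := by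
  obtain ⟨C, hC⟩ := exists_bound_on_ball hφ x
  refine hY.bdd_smul C (Continuous.aestronglyMeasurable (by fun_prop))
    (.of_forall fun z => hC x (Metric.mem_ball_self one_pos) z)

lemma integrable_smulRight (hY : Integrable Y (surf n)) :
    Integrable (fun z : Sph n => (innerSL ℝ (z : Amb n)).smulRight (Y z)) (surf n) := by
  have hm : AEStronglyMeasurable
      (fun z : Sph n => (innerSL ℝ (z : Amb n)).smulRight (Y z)) (surf n) :=
    (ContinuousLinearMap.smulRightL ℝ (Amb n) G).aestronglyMeasurable_comp₂
      (Continuous.aestronglyMeasurable (by fun_prop)) hY.aestronglyMeasurable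
  refine hY.norm.mono' hm (.of_forall fun z => ?_)
  rw [ContinuousLinearMap.norm_smulRight_apply]
  simp

lemma hasFDerivAt_zonal (hk : ContDiff ℝ 1 k) (hY : Integrable Y (surf n)) (x : Amb n) :
    HasFDerivAt (zonal k Y) (zonalDeriv k Y x) x := by
  obtain ⟨C, hC⟩ := exists_bound_on_ball (hk.continuous_deriv le_rfl) x
  refine hasFDerivAt_integral_of_dominated_of_fderiv_le
    (F := fun x (z : Sph n) => k (inner ℝ x (z : Amb n)) • Y z)
    (F' := fun x (z : Sph n) => deriv k (inner ℝ x (z : Amb n)) • (innerSL ℝ (z : Amb n)).smulRight (Y z))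
    (s := Metric.ball x 1) (bound := fun z => C * ‖Y z‖)
    (Metric.ball_mem_nhds x one_pos)
    (.of_forall fun x => (integrable_kernel_smul hk.continuous hY x).aestronglyMeasurable)
    (integrable_kernel_smul hk.continuous hY x)
    (integrable_kernel_smul (hk.continuous_deriv le_rfl)
      (integrable_smulRight hY) x).aestronglyMeasurable
    (.of_forall fun z y hy => ?_) (hY.norm.const_mul C) (.of_forall fun z y _ => ?_)
  · rw [norm_smul, ContinuousLinearMap.norm_smulRight_apply, innerSL_apply_norm, norm_coe_sph,
      one_mul]
    exact mul_le_mul_of_nonneg_right (hC y hy z) (norm_nonneg _)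
  · have h1 : HasFDerivAt (fun x : Amb n => inner ℝ x (z : Amb n)) (innerSL ℝ (z : Amb n)) y := by
      have := (innerSL ℝ (z : Amb n)).hasFDerivAt (x := y)
      refine this.congr_of_eventuallyEq (.of_forall fun x => ?_)
      simp [real_inner_comm]
    have h2 := ((hk.differentiable one_ne_zero _).hasDerivAt.comp_hasFDerivAt y h1).smul_const (Y z)
    convert! h2 using 1
    ext h
    simp [mul_smul]

lemma contDiff_zonal (hk : ContDiff ℝ 1 k) (hY : Integrable Y (surf n)) :
    ContDiff ℝ 1 (zonal k Y) := by
  rw [contDiff_one_iff_hasFDerivAt]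
  refine ⟨zonalDeriv k Y, ?_, hasFDerivAt_zonal hk hY⟩
  rw [continuous_iff_continuousAt]
  intro x
  have hk' := hk.continuous_deriv le_rfl
  obtain ⟨C, hC⟩ := exists_bound_on_ball hk' x
  refine continuousAt_of_dominated (bound := fun z => C * ‖Y z‖)
    (.of_forall fun x => (integrable_kernel_smul hk'
      (integrable_smulRight hY) x).aestronglyMeasurable) ?_ (hY.norm.const_mul C)
      (.of_forall fun z => by fun_prop)
  filter_upwards [Metric.ball_mem_nhds x one_pos] with y hy
  refine .of_forall fun z => ?_
  rw [norm_smul, ContinuousLinearMap.norm_smulRight_apply, innerSL_apply_norm, norm_coe_sph,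
    one_mul]
  exact mul_le_mul_of_nonneg_right (hC y hy z) (norm_nonneg _)

lemma fderiv_zonal_apply [CompleteSpace G] (hk : ContDiff ℝ 1 k) (hY : Integrable Y (surf n))
    (x h : Amb n) :
    fderiv ℝ (zonal k Y) x h
      = ∫ z, (deriv k (inner ℝ x (z : Amb n)) * inner ℝ (z : Amb n) h) • Y z ∂(surf n) := by
  rw [(hasFDerivAt_zonal hk hY x).fderiv, zonalDeriv, ContinuousLinearMap.integral_apply
    (integrable_kernel_smul (hk.continuous_deriv le_rfl) (integrable_smulRight hY) x)]
  simp [mul_smul]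

end zonal

/-- Under the integral, the divergence in `x` of `k(x · z) Y(z)` is `k'(x · z) (z · Y(z))`, and `Y`
is tangential. -/
lemma ediv_zonal {k : ℝ → ℝ} {Y : Sph n → Amb n} (hk : ContDiff ℝ 1 k)
    (hY : Integrable Y (surf n)) (hT : ∀ z : Sph n, inner ℝ (z : Amb n) (Y z) = 0) (x : Amb n) :
    ediv (zonal k Y) x = 0 := by
  have hi : ∀ i : Fin (n + 1), Integrable (fun z : Sph n => (deriv k (inner ℝ x (z : Amb n)) *
      inner ℝ (z : Amb n) (EuclideanSpace.single i (1 : ℝ))) • Y z) (surf n) := fun i => by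
    have h1 : Integrable (fun z : Sph n =>
        (inner ℝ (z : Amb n) (EuclideanSpace.single i (1 : ℝ))) • Y z) (surf n) := by
      have hc : Continuous fun z : Sph n =>
          inner ℝ (z : Amb n) (EuclideanSpace.single i (1 : ℝ)) := by fun_prop
      refine hY.bdd_smul 1 hc.aestronglyMeasurable (.of_forall fun z => ?_)
      exact (abs_real_inner_le_norm _ _).trans (by simp)
    simpa only [mul_smul] using integrable_kernel_smul (hk.continuous_deriv le_rfl) h1 x
  have h2 : ∀ i : Fin (n + 1), fderiv ℝ (zonal k Y) x (EuclideanSpace.single i 1) i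
      = ∫ z, (deriv k (inner ℝ x (z : Amb n)) * ((z : Amb n) i * Y z i)) ∂(surf n) := fun i => by
    rw [fderiv_zonal_apply hk hY]
    have := (EuclideanSpace.proj i : Amb n →L[ℝ] ℝ).integral_comp_comm (hi i)
    refine Eq.trans this.symm ?_
    refine integral_congr_ae (.of_forall fun z => ?_)
    simp [EuclideanSpace.inner_single_right, mul_assoc]
  unfold ediv
  simp_rw [h2]
  rw [← integral_finsetSum]
  · simp_rw [← Finset.mul_sum]
    have : ∀ z : Sph n, ∑ i, (z : Amb n) i * Y z i = 0 := fun z => by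
      rw [← hT z, PiLp.inner_apply]; simp [mul_comm]
    simp [this]
  · intro i _
    have := (EuclideanSpace.proj i : Amb n →L[ℝ] ℝ).integrable_comp (hi i)
    refine this.congr (.of_forall fun z => ?_)
    simp [EuclideanSpace.inner_single_right, mul_assoc]

/-! ### The mass of a zonal kernel -/

lemma dir_map (L : Amb n ≃ₗᵢ[ℝ] Amb n) {x : Amb n} (hx : x ≠ 0) :
    (dir (L x) : Amb n) = L (dir x) := by
  rw [coe_dir hx, coe_dir (by simpa using hx), L.norm_map, map_smul]

/-- Rotation invariance of the surface measure, deduced from that of Lebesgue measure: the integral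
is written over the shell `0 < log |x| < 1`, with a radial weight that cancels the Jacobian. -/
lemma integral_kernel_eq (k : ℝ → ℝ) (ζ ζ' : Sph n) :
    ∫ z : Sph n, k (inner ℝ (ζ : Amb n) (z : Amb n)) ∂(surf n)
      = ∫ z : Sph n, k (inner ℝ (ζ' : Amb n) (z : Amb n)) ∂(surf n) := by
  have h1 : ∀ ζ : Sph n, ∫ z : Sph n, k (inner ℝ (ζ : Amb n) (z : Amb n)) ∂(surf n)
      = ∫ x : Amb n, Real.exp (-((n + 1) * Real.log ‖x‖)) *
        ((Ioo (0 : ℝ) 1).indicator (fun _ => (1 : ℝ)) (Real.log ‖x‖) *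
          k (inner ℝ (ζ : Amb n) (dir x : Amb n))) := fun ζ => by
    rw [integral_polar]
    have h2 : ∀ p : Sph n × ℝ, Real.exp ((n + 1) * p.2) *
        (Real.exp (-((n + 1) * Real.log ‖polar p‖)) *
        ((Ioo (0 : ℝ) 1).indicator (fun _ => (1 : ℝ)) (Real.log ‖polar p‖) *
          k (inner ℝ (ζ : Amb n) (dir (polar p) : Amb n))))
        = k (inner ℝ (ζ : Amb n) (p.1 : Amb n)) * (Ioo (0 : ℝ) 1).indicator (fun _ => (1 : ℝ)) p.2 :=
      fun p => by
        rw [norm_polar, Real.log_exp, dir_polar, ← mul_assoc, ← Real.exp_add]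
        simp [mul_comm]
    simp_rw [h2]
    rw [integral_prod_mul (μ := surf n) (ν := (volume : Measure ℝ))
      (fun z : Sph n => k (inner ℝ (ζ : Amb n) (z : Amb n))), integral_indicator measurableSet_Ioo]
    simp
  rw [h1, h1]
  symm
  -- Reflection in the hyperplane orthogonal to `ζ - ζ'` carries `ζ` to `ζ'`.
  let L : Amb n ≃ₗᵢ[ℝ] Amb n := (ℝ ∙ ((ζ : Amb n) - ζ'))ᗮ.reflection
  have hL : L ζ = ζ' := Submodule.reflection_sub (by simp)
  rw [← (L.measurePreserving).integral_comp L.toHomeomorph.measurableEmbedding]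
  refine integral_congr_ae ?_
  filter_upwards [Measure.ae_ne volume (0 : Amb n)] with x hx
  rw [L.norm_map, dir_map L hx, ← hL, L.inner_map_map]

lemma inner_sub_proj (z : Sph n) (v : Amb n) :
    inner ℝ (z : Amb n) (v - inner ℝ (z : Amb n) v • (z : Amb n)) = 0 := by
  rw [inner_sub_right, inner_smul_right, real_inner_self_eq_norm_sq, norm_coe_sph]; ring

/-- This is the divergence theorem on the sphere for the tangential projection of the field `x ↦ k(ζ
· x) ζ`. With `t = ζ · z`, its divergence is `k'(t) (1 - t²) - n k(t) t`. -/
lemma integral_deriv_kernel {k : ℝ → ℝ} (hk : ContDiff ℝ 1 k) (ζ : Sph n) :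
    ∫ z : Sph n, deriv k (inner ℝ (ζ : Amb n) (z : Amb n)) *
        (1 - inner ℝ (ζ : Amb n) (z : Amb n) ^ 2) ∂(surf n)
      = n * ∫ z : Sph n, k (inner ℝ (ζ : Amb n) (z : Amb n)) *
        inner ℝ (ζ : Amb n) (z : Amb n) ∂(surf n) := by
  set W : Amb n → Amb n := fun x => k (inner ℝ (ζ : Amb n) x) • (ζ : Amb n) with hWd
  have ha : ∀ x : Amb n, HasFDerivAt (fun x : Amb n => k (inner ℝ (ζ : Amb n) x))
      (deriv k (inner ℝ (ζ : Amb n) x) • innerSL ℝ (ζ : Amb n)) x := fun x =>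
    (hk.differentiable one_ne_zero _).hasDerivAt.comp_hasFDerivAt x
      (innerSL ℝ (ζ : Amb n)).hasFDerivAt
  have hW : ContDiff ℝ 1 W := by
    have : ContDiff ℝ 1 (fun x : Amb n => inner ℝ (ζ : Amb n) x) :=
      contDiff_const.inner ℝ contDiff_id
    exact (hk.comp this).smul contDiff_const
  have hX : ContMDiff (𝓡 n) 𝓘(ℝ, Amb n) 1
      (fun z : Sph n => W z - inner ℝ (z : Amb n) (W z) • (z : Amb n)) :=
    contMDiff_of_contDiffOn (F := fun x => W x - inner ℝ x (W x) • x)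
      (hW.sub ((contDiff_id.inner ℝ hW).smul contDiff_id)).contDiffOn
  have h0 := integral_sdiv_eq_zero hX fun z => inner_sub_proj z _
  have h1 : ∀ z : Sph n, sdiv (fun z : Sph n => W z - inner ℝ (z : Amb n) (W z) • (z : Amb n)) z
      = deriv k (inner ℝ (ζ : Amb n) (z : Amb n)) * (1 - inner ℝ (ζ : Amb n) (z : Amb n) ^ 2)
        - n * (k (inner ℝ (ζ : Amb n) (z : Amb n)) * inner ℝ (ζ : Amb n) (z : Amb n)) := fun z => by
    rw [sdiv_proj (hW.differentiable one_ne_zero _)]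
    have e1 : ediv W z = deriv k (inner ℝ (ζ : Amb n) (z : Amb n)) := by
      rw [hWd, ediv_smul (F := fun _ => (ζ : Amb n)) (ha z).differentiableAt
        (differentiableAt_const _), (ha z).fderiv]
      simp [ediv]
    have e2 : fderiv ℝ W z z = (deriv k (inner ℝ (ζ : Amb n) (z : Amb n)) *
        inner ℝ (ζ : Amb n) (z : Amb n)) • (ζ : Amb n) := by
      rw [hWd, ((ha z).smul_const (ζ : Amb n)).fderiv]
      simp
    rw [e1, e2, hWd]
    simp only [inner_smul_right, real_inner_comm (ζ : Amb n) (z : Amb n)]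
    ring
  simp_rw [h1] at h0
  have hkc := hk.continuous
  have hk' := hk.continuous_deriv le_rfl
  rw [integral_sub (integrable_of_continuous (by fun_prop))
    (integrable_of_continuous (by fun_prop)), integral_const_mul] at h0
  linarith

/-- A nondecreasing nonnegative `C^1` kernel `k` such that `k(z · ζ)` is supported in
`|z - ζ| ≤ ε`. -/
structure IsZonalKernel (ε : ℝ) (k : ℝ → ℝ) : Prop where
  contDiff : ContDiff ℝ 1 k
  mono : Monotone k
  zero : ∀ t ≤ 1 - ε ^ 2 / 2, k t = 0
  pos : ∀ t, 1 - ε ^ 2 / 2 < t → 0 < k t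

lemma exists_isZonalKernel (ε : ℝ) : ∃ k, IsZonalKernel ε k :=
  ⟨fun t => Real.smoothTransition (t - (1 - ε ^ 2 / 2)),
    Real.smoothTransition.contDiff.comp (by fun_prop),
    fun _ _ h => Real.smoothTransition.monotone (by linarith),
    fun _ h => Real.smoothTransition.zero_of_nonpos (by linarith),
    fun _ h => Real.smoothTransition.pos_of_pos (by linarith)⟩

namespace IsZonalKernel

variable {ε : ℝ} {k : ℝ → ℝ}

lemma nonneg (hk : IsZonalKernel ε k) (t : ℝ) : 0 ≤ k t := by
  rcases le_or_gt t (1 - ε ^ 2 / 2) with h | h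
  · rw [hk.zero t h]
  · exact (hk.pos t h).le

lemma deriv_nonneg (hk : IsZonalKernel ε k) (t : ℝ) : 0 ≤ deriv k t := hk.mono.deriv_nonneg

lemma deriv_eq_zero (hk : IsZonalKernel ε k) {t : ℝ} (ht : t < 1 - ε ^ 2 / 2) :
    deriv k t = 0 := by
  have : k =ᶠ[nhds t] fun _ => 0 := by
    filter_upwards [Iio_mem_nhds ht] with s hs using hk.zero s (le_of_lt hs)
  rw [this.deriv_eq, deriv_const]

lemma inner_lt_of_lt_dist (hε : 0 ≤ ε) {z ζ : Sph n} (h : ε < dist ζ z) :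
    inner ℝ (ζ : Amb n) (z : Amb n) < 1 - ε ^ 2 / 2 := by
  have h1 := norm_sub_sq_real (ζ : Amb n) (z : Amb n)
  rw [norm_coe_sph, norm_coe_sph, ← dist_eq_norm, ← Subtype.dist_eq] at h1
  nlinarith [pow_lt_pow_left₀ h hε two_ne_zero]

/-- The mass of the kernel. -/
lemma mass_pos (hk : IsZonalKernel ε k) (hε : 0 < ε) (ζ : Sph n) :
    0 < ∫ z : Sph n, k (inner ℝ (ζ : Amb n) (z : Amb n)) ∂(surf n) := by
  have hkc := hk.contDiff.continuous
  have : Measure.IsOpenPosMeasure (surf n) :=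
    inferInstanceAs (Measure.IsOpenPosMeasure (Measure.toSphere _))
  refine Continuous.integral_pos_of_hasCompactSupport_nonneg_nonzero (x := ζ) (by fun_prop)
    (HasCompactSupport.of_compactSpace _) (fun z => hk.nonneg _) ?_
  refine (hk.pos _ ?_).ne'
  rw [real_inner_self_eq_norm_sq, norm_coe_sph]
  have := pow_pos hε 2
  linarith

/-- Where `k'` does not vanish, `t ≥ 1 - ε²/2 ≥ 0`, so `1 - t ≤ 1 - t²` and `integral_deriv_kernel`
applies. Although `k'` may be large, the factor `1 - t` keeps its contribution comparable to the
mass. This bounds the commutator error of the smoothing. -/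
lemma integral_deriv_mul_le (hk : IsZonalKernel ε k) (hε : 0 ≤ ε) (hε1 : ε ≤ 1) (ζ : Sph n) :
    ∫ z : Sph n, deriv k (inner ℝ (ζ : Amb n) (z : Amb n)) *
        (1 - inner ℝ (ζ : Amb n) (z : Amb n)) ∂(surf n)
      ≤ n * ∫ z : Sph n, k (inner ℝ (ζ : Amb n) (z : Amb n)) ∂(surf n) := by
  have hkc := hk.contDiff.continuous
  have hk' := hk.contDiff.continuous_deriv le_rfl
  have hle : ∀ z : Sph n, inner ℝ (ζ : Amb n) (z : Amb n) ≤ 1 := fun z =>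
    (le_abs_self _).trans ((abs_real_inner_le_norm _ _).trans (by simp))
  calc _ ≤ ∫ z : Sph n, deriv k (inner ℝ (ζ : Amb n) (z : Amb n)) *
        (1 - inner ℝ (ζ : Amb n) (z : Amb n) ^ 2) ∂(surf n) := by
        refine integral_mono (integrable_of_continuous (by fun_prop))
          (integrable_of_continuous (by fun_prop)) fun z => ?_
        rcases lt_or_ge (inner ℝ (ζ : Amb n) (z : Amb n)) (1 - ε ^ 2 / 2) with h | h
        · simp [hk.deriv_eq_zero h]
        · refine mul_le_mul_of_nonneg_left ?_ (hk.deriv_nonneg _)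
          have h0 : 0 ≤ inner ℝ (ζ : Amb n) (z : Amb n) := by nlinarith
          nlinarith [mul_nonneg h0 (sub_nonneg.2 (hle z))]
    _ = n * ∫ z : Sph n, k (inner ℝ (ζ : Amb n) (z : Amb n)) *
        inner ℝ (ζ : Amb n) (z : Amb n) ∂(surf n) := integral_deriv_kernel hk.contDiff ζ
    _ ≤ _ := by
        refine mul_le_mul_of_nonneg_left ?_ (Nat.cast_nonneg n)
        refine integral_mono (integrable_of_continuous (by fun_prop))
          (integrable_of_continuous (by fun_prop)) fun z => ?_
        exact mul_le_of_le_one_right (hk.nonneg _) (hle z)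

end IsZonalKernel

end

section

variable {n : ℕ} {Ω : Set (Sph n)}

/-! ### Smoothing and the area -/

lemma sdiv_const_smul (c : ℝ) (X : Sph n → Amb n) (z : Sph n) :
    sdiv (fun ζ => c • X ζ) z = c * sdiv X z := by
  have h : homExt (fun ζ => c • X ζ) = c • homExt X := by
    funext x
    by_cases hx : x = 0
    · have h1 : ∀ X : Sph n → Amb n, homExt X (0 : Amb n) = 0 := fun X => by
        unfold homExt
        rw [Function.extend_apply']
        · rfl
        · rintro ⟨z, hz⟩; exact coe_ne_zero z (by simpa using hz)
      rw [hx, Pi.smul_apply, h1, h1, smul_zero]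
    · rw [Pi.smul_apply, homExt_eq _ hx, homExt_eq _ hx]
  unfold sdiv ediv
  rw [h, fderiv_const_smul_field, Finset.mul_sum]
  simp

/-- The definition of the area applied to the pair `(y^n X / R, y^n q / R)`. This form takes fields
already carrying the weight `y^{-n}` and allows the norm bound to be exceeded by a factor. -/
lemma areaEnergy_test (hΩ : Ω ⊆ upperHemisphere n) {v : Sph n → ℝ} {A R : ℝ} (hR : 0 < R)
    (hA : areaEnergy Ω v ≤ (A : EReal)) {X : Sph n → Amb n} {q : Sph n → ℝ}
    (hX : IsTangentTest Ω X) (hq : IsScalarTest Ω q)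
    (hXq : ∀ z ∈ Ω, height (z : Amb n) ^ n * ‖X z + q z • (z : Amb n)‖ ≤ R) :
    (∫ z in Ω, v z * sdiv X z ∂(surf n)) + ∫ z in Ω, q z ∂(surf n) ≤ R * A := by
  have hh : ContMDiff (𝓡 n) 𝓘(ℝ, ℝ) 1 (fun z : Sph n => R⁻¹ * height (z : Amb n) ^ n) :=
    contMDiff_of_contDiffOn (F := fun x : Amb n => R⁻¹ * height x ^ n)
      (contDiff_const.mul (contDiff_height.pow n)).contDiffOn
  have hX0 : ∀ z ∉ Ω, X z = 0 := fun z hz =>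
    image_eq_zero_of_notMem_tsupport fun h => hz (hX.support h)
  have hq0 : ∀ z ∉ Ω, q z = 0 := fun z hz =>
    image_eq_zero_of_notMem_tsupport fun h => hz (hq.support h)
  have hfield : (fun ζ : Sph n => (height (ζ : Amb n) ^ n)⁻¹ •
      ((R⁻¹ * height (ζ : Amb n) ^ n) • X ζ)) = fun ζ => R⁻¹ • X ζ := by
    funext z
    by_cases hz : z ∈ Ω
    · have : 0 < height (z : Amb n) := hΩ hz
      rw [smul_smul]; congr 1; field_simp
    · simp [hX0 z hz]
  have hfield' : ∀ z : Sph n, (R⁻¹ * height (z : Amb n) ^ n) • q z * (height (z : Amb n) ^ n)⁻¹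
      = R⁻¹ * q z := fun z => by
    by_cases hz : z ∈ Ω
    · have : 0 < height (z : Amb n) := hΩ hz
      rw [smul_eq_mul]; field_simp
    · simp [hq0 z hz]
  have key : (((∫ z in Ω, v z * sdiv (fun ζ : Sph n => (height (ζ : Amb n) ^ n)⁻¹ •
      ((R⁻¹ * height (ζ : Amb n) ^ n) • X ζ)) z ∂(surf n))
      + ∫ z in Ω, (R⁻¹ * height (z : Amb n) ^ n) • q z * (height (z : Amb n) ^ n)⁻¹ ∂(surf n) : ℝ)
      : EReal) ≤ areaEnergy Ω v := by
    refine le_iSup₂_of_le (fun z : Sph n => (R⁻¹ * height (z : Amb n) ^ n) • X z)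
      (fun z : Sph n => (R⁻¹ * height (z : Amb n) ^ n) • q z) (le_iSup_of_le ⟨⟨hh.smul hX.contMDiff,
        fun z => by rw [inner_smul_right, hX.tangent, mul_zero],
        (tsupport_smul_subset_right _ _).trans hX.support⟩,
        ⟨hh.smul hq.contMDiff, (tsupport_smul_subset_right _ _).trans hq.support⟩,
        fun z => ?_⟩ le_rfl)
    by_cases hz : z ∈ Ω
    · have hy : 0 < height (z : Amb n) := hΩ hz
      have h1 : ‖X z + q z • (z : Amb n)‖ ^ 2 = ‖X z‖ ^ 2 + |q z| ^ 2 := by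
        rw [norm_add_sq_real, inner_smul_right, real_inner_comm, hX.tangent, norm_smul]
        simp
      have h2 : (R⁻¹ * height (z : Amb n) ^ n * ‖X z + q z • (z : Amb n)‖) ^ 2 ≤ 1 := by
        refine pow_le_one₀ (by positivity) ?_
        rw [mul_assoc, inv_mul_le_iff₀ hR, mul_one]
        exact hXq z hz
      simp only []
      rw [norm_smul, smul_eq_mul, abs_mul, Real.norm_eq_abs, mul_pow, mul_pow, ← mul_add, ← h1,
        sq_abs, ← mul_pow]
      exact h2
    · simp [hX0 z hz, hq0 z hz]
  have key2 := key.trans hA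
  rw [EReal.coe_le_coe_iff, hfield] at key2
  simp_rw [hfield', sdiv_const_smul, mul_left_comm _ R⁻¹] at key2
  rw [integral_const_mul, integral_const_mul, ← mul_add, inv_mul_le_iff₀ hR] at key2
  exact key2

section smoothing

variable {ε : ℝ} {k : ℝ → ℝ}

/-- The mass of a zonal kernel. -/
def mass (n : ℕ) (k : ℝ → ℝ) : ℝ :=
  ∫ z : Sph n, k (inner ℝ ((Classical.arbitrary (Sph n) : Sph n) : Amb n) (z : Amb n)) ∂(surf n)

lemma integral_kernel_eq_mass (k : ℝ → ℝ) (ζ : Sph n) :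
    ∫ z : Sph n, k (inner ℝ (ζ : Amb n) (z : Amb n)) ∂(surf n) = mass n k :=
  integral_kernel_eq k _ _

lemma IsZonalKernel.eq_zero_of_lt_dist (hk : IsZonalKernel ε k) (hε : 0 ≤ ε) {z ζ : Sph n}
    (h : ε < dist ζ z) : k (inner ℝ (ζ : Amb n) (z : Amb n)) = 0 :=
  hk.zero _ (inner_lt_of_lt_dist hε h).le

lemma zonal_tsupport_subset {G : Type*} [NormedAddCommGroup G] [NormedSpace ℝ G]
    (hk : IsZonalKernel ε k) (hε : 0 ≤ ε) {K : Set (Sph n)}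
    {Y : Sph n → G} (hY : ∀ z ∉ K, Y z = 0) {ζ : Sph n} (hζ : ζ ∉ Metric.cthickening ε K) :
    zonal k Y (ζ : Amb n) = 0 := by
  refine integral_eq_zero_of_ae (.of_forall fun z => ?_)
  by_cases hz : z ∈ K
  · have : ε < dist ζ z := by
      by_contra h
      exact hζ (Metric.mem_cthickening_of_dist_le ζ z ε K hz (not_lt.1 h))
    simp [hk.eq_zero_of_lt_dist hε this]
  · simp [hY z hz]

lemma integrable_kernel_prod {φ : ℝ → ℝ} (hφ : Continuous φ) {Z : Sph n → Amb n}
    (hZ : Continuous Z) {v : Sph n → ℝ} (hv : Integrable v (surf n)) :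
    Integrable (fun p : Sph n × Sph n => (φ (inner ℝ (p.1 : Amb n) (p.2 : Amb n)) *
      inner ℝ (p.2 : Amb n) (Z p.1)) * v p.2) ((surf n).prod (surf n)) := by
  have hc : Continuous (fun p : Sph n × Sph n => φ (inner ℝ (p.1 : Amb n) (p.2 : Amb n)) *
      inner ℝ (p.2 : Amb n) (Z p.1)) := by fun_prop
  obtain ⟨C, hC⟩ := isCompact_univ.exists_bound_of_continuousOn hc.continuousOn
  exact (hv.comp_snd (surf n)).bdd_mul hc.aestronglyMeasurable
    (.of_forall fun p => hC p (mem_univ p))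

lemma norm_tangent_sq (z : Sph n) (y : Amb n) :
    ‖y - inner ℝ (z : Amb n) y • (z : Amb n)‖ ^ 2 = ‖y‖ ^ 2 - (inner ℝ (z : Amb n) y) ^ 2 := by
  rw [norm_sub_sq_real, inner_smul_right, norm_smul, norm_coe_sph, real_inner_comm, mul_one,
    Real.norm_eq_abs, sq_abs]
  ring

lemma norm_tangent_le (z : Sph n) (y : Amb n) :
    ‖y - inner ℝ (z : Amb n) y • (z : Amb n)‖ ≤ ‖y‖ := by
  rw [← pow_le_pow_iff_left₀ (norm_nonneg _) (norm_nonneg _) two_ne_zero, norm_tangent_sq]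
  linarith [sq_nonneg (inner ℝ (z : Amb n) y)]

/-- The smoothed function `u = m⁻¹ ∫ k(· , ζ) v(ζ) dζ` satisfies the area inequality up to a small
error. -/
theorem integral_smoothed_le (hk : IsZonalKernel ε k) (hε : 0 < ε) (hε1 : ε ≤ 1)
    (hΩ : Ω ⊆ upperHemisphere n) {K : Set (Sph n)} (hK : Metric.cthickening ε K ⊆ Ω)
    {ρ : ℝ} (hρ : 0 < ρ)
    (hKρ : ∀ z ∈ K, ∀ ζ : Sph n, dist ζ z ≤ ε → height (ζ : Amb n) ≤ ρ * height (z : Amb n))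
    {Y : Sph n → Amb n} (hY : Continuous Y) (hY0 : ∀ z ∉ K, Y z = 0)
    (hY1 : ∀ z : Sph n, height (z : Amb n) ^ n * ‖Y z‖ ≤ 1) {M : ℝ} (hM : ∀ z, ‖Y z‖ ≤ M)
    {v : Sph n → ℝ} (hv : Integrable v (surf n)) (hv0 : ∀ z ∉ Ω, v z = 0)
    {A : ℝ} (hA : areaEnergy Ω v ≤ (A : EReal)) :
    ∫ z, (inner ℝ (z : Amb n) (Y z) - fderiv ℝ (zonal k fun ζ => (mass n k)⁻¹ * v ζ) (z : Amb n)
        (Y z - inner ℝ (z : Amb n) (Y z) • (z : Amb n))) ∂(surf n)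
      ≤ ρ ^ n * A + 2 * n * ε * M * ∫ z, |v z| ∂(surf n) := by
  set m := mass n k with hmd
  have hm : 0 < m := hk.mass_pos hε _
  have hkc := hk.contDiff.continuous
  have hk' := hk.contDiff.continuous_deriv le_rfl
  set Z : Sph n → Amb n := fun z => Y z - inner ℝ (z : Amb n) (Y z) • (z : Amb n) with hZd
  set q₀ : Sph n → ℝ := fun z => inner ℝ (z : Amb n) (Y z) with hq₀d
  have hZ : Continuous Z := by fun_prop
  have hq₀ : Continuous q₀ := by fun_prop
  have hZT : ∀ z : Sph n, inner ℝ (z : Amb n) (Z z) = 0 := fun z => inner_sub_proj z _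
  have hZ0 : ∀ z ∉ K, Z z = 0 := fun z hz => by simp [hZd, hY0 z hz]
  have hq₀0 : ∀ z ∉ K, q₀ z = 0 := fun z hz => by simp [hq₀d, hY0 z hz]
  have hZM : ∀ z, ‖Z z‖ ≤ M := fun z => (norm_tangent_le z (Y z)).trans (hM z)
  have hM0 : 0 ≤ M := (norm_nonneg _).trans (hM (Classical.arbitrary _))
  have hZi : Integrable (fun z => m⁻¹ • Z z) (surf n) :=
    integrable_of_continuous (by fun_prop)
  have hqi : Integrable (fun z => m⁻¹ * q₀ z) (surf n) :=
    integrable_of_continuous (by fun_prop)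
  -- The averaging is moved from `v` to the tangential and radial parts of `Y`. The average of
  -- tangent vectors at nearby points is no longer tangent at `ζ`, so it is projected there to give
  -- the test field `X`.
  set V : Amb n → Amb n := zonal k fun z => m⁻¹ • Z z with hVd
  set Q : Amb n → ℝ := zonal k fun z => m⁻¹ * q₀ z with hQd
  have hV : ContDiff ℝ 1 V := contDiff_zonal hk.contDiff hZi
  have hQ : ContDiff ℝ 1 Q := contDiff_zonal hk.contDiff hqi
  set X : Sph n → Amb n := fun ζ => V ζ - inner ℝ (ζ : Amb n) (V ζ) • (ζ : Amb n) with hXd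
  have hXC : ContMDiff (𝓡 n) 𝓘(ℝ, Amb n) 1 X :=
    contMDiff_of_contDiffOn (F := fun x => V x - inner ℝ x (V x) • x)
      (hV.sub ((contDiff_id.inner ℝ hV).smul contDiff_id)).contDiffOn
  have hQC : ContMDiff (𝓡 n) 𝓘(ℝ, ℝ) 1 (fun ζ : Sph n => Q ζ) :=
    contMDiff_of_contDiffOn hQ.contDiffOn
  have hV0 : ∀ ζ : Sph n, ζ ∉ Metric.cthickening ε K → V ζ = 0 := fun ζ hζ =>
    zonal_tsupport_subset hk hε.le (fun z hz => by rw [hZ0 z hz, smul_zero]) hζ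
  have hQ0 : ∀ ζ : Sph n, ζ ∉ Metric.cthickening ε K → Q ζ = 0 := fun ζ hζ =>
    zonal_tsupport_subset hk hε.le (fun z hz => by rw [hq₀0 z hz, mul_zero]) hζ
  have hX0 : ∀ ζ : Sph n, ζ ∉ Metric.cthickening ε K → X ζ = 0 := fun ζ hζ => by
    simp [hXd, hV0 ζ hζ]
  have hXtest : IsTangentTest Ω X := ⟨hXC, fun ζ => inner_sub_proj ζ _,
    (closure_minimal (fun ζ hζ => by_contra fun h => Function.mem_support.1 hζ (hX0 ζ h))
      Metric.isClosed_cthickening).trans hK⟩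
  have hQtest : IsScalarTest Ω (fun ζ : Sph n => Q ζ) := ⟨hQC,
    (closure_minimal (fun ζ hζ => by_contra fun h => Function.mem_support.1 hζ (hQ0 ζ h))
      Metric.isClosed_cthickening).trans hK⟩
  -- the divergence of the smoothed field
  have hsdiv : ∀ ζ : Sph n, sdiv X ζ = -∫ z : Sph n, (m⁻¹ * (deriv k (inner ℝ (ζ : Amb n) (z : Amb n))
      * inner ℝ (ζ : Amb n) (z : Amb n) + n * k (inner ℝ (ζ : Amb n) (z : Amb n)))) *
        inner ℝ (ζ : Amb n) (Z z) ∂(surf n) := fun ζ => by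
    rw [hXd, sdiv_proj (hV.differentiable one_ne_zero _), hVd,
      ediv_zonal hk.contDiff hZi (fun z => by rw [inner_smul_right, hZT, mul_zero]),
      fderiv_zonal_apply hk.contDiff hZi, zonal, ← integral_inner, ← integral_inner,
      zero_sub, ← neg_add', ← integral_const_mul, ← integral_add]
    · congr 1
      refine integral_congr_ae (.of_forall fun z => ?_)
      simp only [inner_smul_right, real_inner_comm (ζ : Amb n) (z : Amb n)]
      ring
    · exact integrable_of_continuous (by fun_prop)
    · exact integrable_of_continuous (by fun_prop)
    · exact integrable_of_continuous (by fun_prop)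
    · exact integrable_of_continuous (by fun_prop)
  -- the error term
  set D : Sph n → ℝ := fun ζ => ∫ z : Sph n, (deriv k (inner ℝ (z : Amb n) (ζ : Amb n)) *
      inner ℝ (ζ : Amb n) (Z z)) * m⁻¹ ∂(surf n) with hDd
  have herr : ∀ ζ : Sph n, |-D ζ - sdiv X ζ| ≤ 2 * n * ε * M := fun ζ => by
    -- `-D` is what Fubini produces from differentiating the smoothed function, while `sdiv X` is
    -- what the area of `v` controls. They differ by replacing `k'` with `k' t` and by the curvature
    -- term `n k`.
    have e1 : -D ζ - sdiv X ζ = ∫ z : Sph n, m⁻¹ *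
        (deriv k (inner ℝ (ζ : Amb n) (z : Amb n)) * (inner ℝ (ζ : Amb n) (z : Amb n) - 1)
          + n * k (inner ℝ (ζ : Amb n) (z : Amb n))) * inner ℝ (ζ : Amb n) (Z z) ∂(surf n) := by
      rw [hsdiv, hDd, sub_neg_eq_add, neg_add_eq_sub, ← integral_sub]
      · refine integral_congr_ae (.of_forall fun z => ?_)
        simp only [real_inner_comm (ζ : Amb n) (z : Amb n)]
        ring
      · exact integrable_of_continuous (by fun_prop)
      · exact integrable_of_continuous (by fun_prop)
    have hle : ∀ z : Sph n, inner ℝ (ζ : Amb n) (z : Amb n) ≤ 1 := fun z =>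
      (le_abs_self _).trans ((abs_real_inner_le_norm _ _).trans (by simp))
    have e2 : ∀ z : Sph n, ‖m⁻¹ *
        (deriv k (inner ℝ (ζ : Amb n) (z : Amb n)) * (inner ℝ (ζ : Amb n) (z : Amb n) - 1)
          + n * k (inner ℝ (ζ : Amb n) (z : Amb n))) * inner ℝ (ζ : Amb n) (Z z)‖
        ≤ m⁻¹ * (ε * M) * (deriv k (inner ℝ (ζ : Amb n) (z : Amb n)) *
          (1 - inner ℝ (ζ : Amb n) (z : Amb n)) + n * k (inner ℝ (ζ : Amb n) (z : Amb n))) := by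
      intro z
      have hd := hk.deriv_nonneg (inner ℝ (ζ : Amb n) (z : Amb n))
      have hkn := hk.nonneg (inner ℝ (ζ : Amb n) (z : Amb n))
      have h1 := sub_nonneg.2 (hle z)
      rcases lt_or_ge ε (dist ζ z) with h | h
      · rw [hk.deriv_eq_zero (IsZonalKernel.inner_lt_of_lt_dist hε.le h),
          hk.eq_zero_of_lt_dist hε.le h]
        simp
      · have h2 : |inner ℝ (ζ : Amb n) (Z z)| ≤ ε * M := by
          -- Tangency of `Z z` at `z` lets `ζ` be replaced by `ζ - z`, which gains the factor `ε`.
          have h3 : inner ℝ (ζ : Amb n) (Z z) = inner ℝ ((ζ : Amb n) - z) (Z z) := by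
            rw [inner_sub_left, hZT, sub_zero]
          rw [h3]
          refine (abs_real_inner_le_norm _ _).trans (mul_le_mul ?_ (hZM z) (norm_nonneg _) hε.le)
          rwa [← dist_eq_norm, ← Subtype.dist_eq]
        have h4 : |deriv k (inner ℝ (ζ : Amb n) (z : Amb n)) *
            (inner ℝ (ζ : Amb n) (z : Amb n) - 1) + n * k (inner ℝ (ζ : Amb n) (z : Amb n))|
            ≤ deriv k (inner ℝ (ζ : Amb n) (z : Amb n)) *
          (1 - inner ℝ (ζ : Amb n) (z : Amb n)) + n * k (inner ℝ (ζ : Amb n) (z : Amb n)) := by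
          have h5 := mul_nonneg hd h1
          have h6 := mul_nonneg (Nat.cast_nonneg (α := ℝ) n) hkn
          rw [abs_le]
          constructor <;> nlinarith
        rw [norm_mul, norm_mul, Real.norm_of_nonneg (inv_nonneg.2 hm.le), Real.norm_eq_abs,
          Real.norm_eq_abs, mul_assoc, mul_assoc, mul_comm (ε * M)]
        refine mul_le_mul_of_nonneg_left ?_ (inv_nonneg.2 hm.le)
        exact mul_le_mul h4 h2 (abs_nonneg _) ((abs_nonneg _).trans h4)
    rw [e1, ← Real.norm_eq_abs]
    refine (norm_integral_le_of_norm_le (integrable_of_continuous (by fun_prop))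
      (.of_forall e2)).trans ?_
    rw [integral_const_mul, integral_add (integrable_of_continuous (by fun_prop))
      (integrable_of_continuous (by fun_prop)), integral_const_mul, integral_kernel_eq_mass]
    have h7 := hk.integral_deriv_mul_le hε.le hε1 ζ
    rw [integral_kernel_eq_mass, ← hmd] at h7
    calc m⁻¹ * (ε * M) * _ ≤ m⁻¹ * (ε * M) * (n * m + n * m) := by
          refine mul_le_mul_of_nonneg_left (by linarith) (by positivity)
      _ = 2 * n * ε * M := by field_simp; ring
  -- the admissibility of the smoothed field
  have hρn : 0 < ρ ^ n := pow_pos hρ n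
  have hadm : ∀ ζ ∈ Ω, height (ζ : Amb n) ^ n * ‖X ζ + Q ζ • (ζ : Amb n)‖ ≤ ρ ^ n := fun ζ hζ => by
    have hyζ : 0 < height (ζ : Amb n) := hΩ hζ
    have e1 : X ζ + Q ζ • (ζ : Amb n) = ∫ z : Sph n, (k (inner ℝ (ζ : Amb n) (z : Amb n)) * m⁻¹) •
        ((Z z - inner ℝ (ζ : Amb n) (Z z) • (ζ : Amb n)) + q₀ z • (ζ : Amb n)) ∂(surf n) := by
      have i1 : Integrable (fun z : Sph n => k (inner ℝ (ζ : Amb n) (z : Amb n)) • m⁻¹ • Z z)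
        (surf n) := integrable_of_continuous (by fun_prop)
      simp only [hXd, hVd, hQd, zonal]
      rw [← integral_inner i1, ← integral_smul_const, ← integral_smul_const,
        ← integral_sub i1, ← integral_add]
      · refine integral_congr_ae (.of_forall fun z => ?_)
        simp only [inner_smul_right, smul_add, smul_sub, smul_smul, smul_eq_mul]
        simp only [mul_assoc]
      · exact integrable_of_continuous (by fun_prop)
      · exact integrable_of_continuous (by fun_prop)
      · exact integrable_of_continuous (by fun_prop)
    have e2 : ∀ z : Sph n, ‖height (ζ : Amb n) ^ n • (k (inner ℝ (ζ : Amb n) (z : Amb n)) * m⁻¹) •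
        ((Z z - inner ℝ (ζ : Amb n) (Z z) • (ζ : Amb n)) + q₀ z • (ζ : Amb n))‖
        ≤ m⁻¹ * ρ ^ n * k (inner ℝ (ζ : Amb n) (z : Amb n)) := fun z => by
      have hkn := hk.nonneg (inner ℝ (ζ : Amb n) (z : Amb n))
      by_cases hz : z ∈ K
      · rcases lt_or_ge ε (dist ζ z) with h | h
        · simp [hk.eq_zero_of_lt_dist hε.le h]
        · have h1 : ‖(Z z - inner ℝ (ζ : Amb n) (Z z) • (ζ : Amb n)) + q₀ z • (ζ : Amb n)‖
              ≤ ‖Y z‖ := by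
            rw [← pow_le_pow_iff_left₀ (norm_nonneg _) (norm_nonneg _) two_ne_zero,
              norm_add_sq_real, inner_smul_right, real_inner_comm (ζ : Amb n) (Z z - _),
              inner_sub_proj, norm_tangent_sq,
              norm_smul, norm_coe_sph, hZd, norm_tangent_sq, mul_one, Real.norm_eq_abs, sq_abs]
            nlinarith [sq_nonneg (inner ℝ (ζ : Amb n) (Z z))]
          have h2 : height (ζ : Amb n) ^ n ≤ ρ ^ n * height (z : Amb n) ^ n := by
            rw [← mul_pow]; exact pow_le_pow_left₀ hyζ.le (hKρ z hz ζ h) n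
          have h3 : height (ζ : Amb n) ^ n *
              ‖(Z z - inner ℝ (ζ : Amb n) (Z z) • (ζ : Amb n)) + q₀ z • (ζ : Amb n)‖ ≤ ρ ^ n :=
            calc _ ≤ ρ ^ n * height (z : Amb n) ^ n * ‖Y z‖ :=
                  mul_le_mul h2 h1 (norm_nonneg _) ((pow_pos hyζ n).le.trans h2)
              _ = ρ ^ n * (height (z : Amb n) ^ n * ‖Y z‖) := by ring
              _ ≤ ρ ^ n := mul_le_of_le_one_right hρn.le (hY1 z)
          rw [norm_smul, norm_smul, Real.norm_of_nonneg (pow_pos hyζ n).le, Real.norm_of_nonneg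
            (mul_nonneg hkn (inv_nonneg.2 hm.le)), mul_left_comm]
          calc _ ≤ k (inner ℝ (ζ : Amb n) (z : Amb n)) * m⁻¹ * ρ ^ n :=
                mul_le_mul_of_nonneg_left h3 (mul_nonneg hkn (inv_nonneg.2 hm.le))
            _ = _ := by ring
      · rw [hZ0 z hz, hq₀0 z hz]
        simp only [inner_zero_right, zero_smul, sub_zero, add_zero, smul_zero, norm_zero]
        positivity
    have e3 : height (ζ : Amb n) ^ n * ‖X ζ + Q ζ • (ζ : Amb n)‖
        = ‖∫ z : Sph n, height (ζ : Amb n) ^ n • (k (inner ℝ (ζ : Amb n) (z : Amb n)) * m⁻¹) •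
        ((Z z - inner ℝ (ζ : Amb n) (Z z) • (ζ : Amb n)) + q₀ z • (ζ : Amb n)) ∂(surf n)‖ := by
      rw [integral_smul, ← e1, norm_smul, Real.norm_of_nonneg (pow_pos hyζ n).le]
    rw [e3]
    refine (norm_integral_le_of_norm_le (integrable_of_continuous (by fun_prop))
      (.of_forall e2)).trans_eq ?_
    rw [integral_const_mul, integral_kernel_eq_mass, ← hmd]
    field_simp
  have htest := areaEnergy_test hΩ hρn hA hXtest hQtest hadm
  -- the two terms
  have hF := integrable_kernel_prod hk' hZ (hv.const_mul m⁻¹)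
  -- The normalized kernel is symmetric with total mass one in either variable, so averaging
  -- preserves the integral.
  have t1 : ∫ z : Sph n, q₀ z ∂(surf n) = ∫ z in Ω, Q z ∂(surf n) := by
    rw [setIntegral_eq_integral_of_forall_compl_eq_zero
      (fun ζ hζ => hQ0 ζ fun h => hζ (hK h))]
    simp only [hQd, zonal]
    rw [integral_integral_swap]
    · refine integral_congr_ae (.of_forall fun z => ?_)
      simp only [smul_eq_mul]
      rw [integral_mul_const]
      simp_rw [real_inner_comm (z : Amb n)]
      rw [integral_kernel_eq_mass, ← hmd]
      field_simp
    · have hc : Continuous (fun p : Sph n × Sph n =>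
          k (inner ℝ (p.1 : Amb n) (p.2 : Amb n)) • (m⁻¹ * q₀ p.2)) := by fun_prop
      exact hc.integrable_of_hasCompactSupport (HasCompactSupport.of_compactSpace _)
  have t2 : ∫ z, fderiv ℝ (zonal k fun ζ => m⁻¹ * v ζ) (z : Amb n) (Z z) ∂(surf n)
      = ∫ ζ, v ζ * D ζ ∂(surf n) := by
    simp_rw [fderiv_zonal_apply hk.contDiff (hv.const_mul m⁻¹), smul_eq_mul]
    rw [integral_integral_swap hF]
    refine integral_congr_ae (.of_forall fun ζ => ?_)
    simp only [hDd]
    rw [← integral_const_mul]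
    refine integral_congr_ae (.of_forall fun z => ?_)
    simp only []
    ring
  have i2 : Integrable (fun z : Sph n => fderiv ℝ (zonal k fun ζ => m⁻¹ * v ζ) (z : Amb n) (Z z))
      (surf n) := by
    have := hF.integral_prod_left
    refine this.congr (.of_forall fun z => ?_)
    simp only [fderiv_zonal_apply hk.contDiff (hv.const_mul m⁻¹), smul_eq_mul]
  have i3 : Integrable (fun ζ => v ζ * D ζ) (surf n) := by
    have := hF.integral_prod_right
    refine this.congr (.of_forall fun ζ => ?_)
    simp only [hDd]
    rw [← integral_const_mul]
    refine integral_congr_ae (.of_forall fun z => ?_)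
    simp only []
    ring
  obtain ⟨C, hC⟩ := isCompact_univ.exists_bound_of_continuousOn (sdiv_continuous hXC).continuousOn
  have i4 : Integrable (fun ζ => v ζ * sdiv X ζ) (surf n) :=
    hv.mul_bdd (c := C) (sdiv_continuous hXC).aestronglyMeasurable
      (.of_forall fun z => hC z (mem_univ z))
  rw [integral_sub (integrable_of_continuous hq₀) i2, t1, t2]
  have t3 : -∫ ζ, v ζ * D ζ ∂(surf n) ≤ (∫ ζ, v ζ * sdiv X ζ ∂(surf n))
      + 2 * n * ε * M * ∫ z, |v z| ∂(surf n) := by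
    rw [← integral_neg, ← integral_const_mul, ← integral_add i4 (hv.abs.const_mul _)]
    refine integral_mono i3.neg (i4.add (hv.abs.const_mul _)) fun ζ => ?_
    have h1 : v ζ * (-D ζ - sdiv X ζ) ≤ |v ζ| * (2 * n * ε * M) := by
      refine (le_abs_self _).trans ?_
      rw [abs_mul]
      exact mul_le_mul_of_nonneg_left (herr ζ) (abs_nonneg _)
    simp only []
    linarith
  have t4 : ∫ ζ in Ω, v ζ * sdiv X ζ ∂(surf n) = ∫ ζ, v ζ * sdiv X ζ ∂(surf n) :=
    setIntegral_eq_integral_of_forall_compl_eq_zero fun ζ hζ => by rw [hv0 ζ hζ, zero_mul]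
  rw [t4] at htest
  linarith

end smoothing

end

section

variable {n : ℕ} {ε : ℝ} {k : ℝ → ℝ}

/-! ### Convergence of the smoothing -/

lemma continuous_zonal (hk : IsZonalKernel ε k) {v : Sph n → ℝ} (hv : Integrable v (surf n)) :
    Continuous fun z : Sph n => zonal k v (z : Amb n) :=
  (contDiff_zonal hk.contDiff hv).continuous.comp continuous_subtype_val

/-- Fubini, using that the symmetric kernel has the same mass in both variables. After normalization
this makes the averaging an `L¹` contraction. -/
lemma integral_abs_zonal_le (hk : IsZonalKernel ε k) {v : Sph n → ℝ}
    (hv : Integrable v (surf n)) :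
    ∫ z : Sph n, |zonal k v z| ∂(surf n) ≤ mass n k * ∫ z, |v z| ∂(surf n) := by
  have hkc := hk.contDiff.continuous
  have hc : Continuous (fun p : Sph n × Sph n => k (inner ℝ (p.1 : Amb n) (p.2 : Amb n))) := by
    fun_prop
  obtain ⟨C, hC⟩ := isCompact_univ.exists_bound_of_continuousOn hc.continuousOn
  have hi : Integrable (fun p : Sph n × Sph n =>
      k (inner ℝ (p.1 : Amb n) (p.2 : Amb n)) * |v p.2|) ((surf n).prod (surf n)) :=
    (hv.abs.comp_snd (surf n)).bdd_mul hc.aestronglyMeasurable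
      (.of_forall fun p => hC p (mem_univ p))
  calc ∫ z : Sph n, |zonal k v z| ∂(surf n)
      ≤ ∫ z : Sph n, ∫ ζ : Sph n, k (inner ℝ (z : Amb n) (ζ : Amb n)) * |v ζ| ∂(surf n)
          ∂(surf n) := by
        refine integral_mono (integrable_of_continuous (continuous_zonal hk hv).abs)
          hi.integral_prod_left fun z => ?_
        refine (abs_integral_le_integral_abs).trans_eq ?_
        refine integral_congr_ae (.of_forall fun ζ => ?_)
        simp only [smul_eq_mul, abs_mul, abs_of_nonneg (hk.nonneg _)]
    _ = mass n k * ∫ z, |v z| ∂(surf n) := by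
        rw [integral_integral_swap hi, ← integral_const_mul]
        refine integral_congr_ae (.of_forall fun ζ => ?_)
        simp only [integral_mul_const]
        simp_rw [real_inner_comm (ζ : Amb n)]
        rw [integral_kernel_eq_mass]

lemma zonal_sub_le (hk : IsZonalKernel ε k) (hε : 0 < ε) {φ : Sph n → ℝ} (hφ : Continuous φ)
    {δ : ℝ} (h : ∀ z ζ : Sph n, dist z ζ ≤ ε → |φ ζ - φ z| ≤ δ) (z : Sph n) :
    |zonal k (fun ζ => (mass n k)⁻¹ * φ ζ) z - φ z| ≤ δ := by
  have hm : 0 < mass n k := hk.mass_pos hε _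
  have hkc := hk.contDiff.continuous
  have e1 : zonal k (fun ζ => (mass n k)⁻¹ * φ ζ) z - φ z
      = ∫ ζ : Sph n, k (inner ℝ (z : Amb n) (ζ : Amb n)) * (mass n k)⁻¹ * (φ ζ - φ z)
        ∂(surf n) := by
    have e2 : φ z = ∫ ζ : Sph n, k (inner ℝ (z : Amb n) (ζ : Amb n)) * ((mass n k)⁻¹ * φ z)
        ∂(surf n) := by
      rw [integral_mul_const, integral_kernel_eq_mass]; field_simp
    conv_lhs => rw [e2]
    rw [zonal, ← integral_sub (integrable_of_continuous (by fun_prop))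
      (integrable_of_continuous (by fun_prop))]
    refine integral_congr_ae (.of_forall fun ζ => ?_)
    simp only [smul_eq_mul]
    ring
  have e2 : ∀ ζ : Sph n, ‖k (inner ℝ (z : Amb n) (ζ : Amb n)) * (mass n k)⁻¹ * (φ ζ - φ z)‖
      ≤ (mass n k)⁻¹ * δ * k (inner ℝ (z : Amb n) (ζ : Amb n)) := fun ζ => by
    have hkn := hk.nonneg (inner ℝ (z : Amb n) (ζ : Amb n))
    rcases lt_or_ge ε (dist z ζ) with hd | hd
    · simp [hk.eq_zero_of_lt_dist hε.le hd]
    · rw [norm_mul, Real.norm_of_nonneg (mul_nonneg hkn (inv_nonneg.2 hm.le)), Real.norm_eq_abs]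
      calc _ ≤ k (inner ℝ (z : Amb n) (ζ : Amb n)) * (mass n k)⁻¹ * δ :=
            mul_le_mul_of_nonneg_left (h z ζ hd) (mul_nonneg hkn (inv_nonneg.2 hm.le))
        _ = _ := by ring
  rw [e1, ← Real.norm_eq_abs]
  refine (norm_integral_le_of_norm_le (integrable_of_continuous (by fun_prop))
    (.of_forall e2)).trans_eq ?_
  rw [integral_const_mul, integral_kernel_eq_mass]
  field_simp

/-- Approximate `v` in `L¹` by a continuous `φ`. The averages of `φ` converge uniformly by uniform
continuity, and the averages of `v - φ` are controlled by `L¹` contraction. -/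
theorem exists_integral_zonal_sub_le {v : Sph n → ℝ} (hv : Integrable v (surf n)) {η : ℝ}
    (hη : 0 < η) : ∃ ε₀ > 0, ∀ ε k, 0 < ε → ε < ε₀ → IsZonalKernel ε k →
      ∫ z : Sph n, |zonal k (fun ζ => (mass n k)⁻¹ * v ζ) z - v z| ∂(surf n) ≤ η := by
  obtain ⟨φ, -, hφv, hφ, hφi⟩ := hv.exists_hasCompactSupport_integral_sub_le
    (show 0 < η / 3 by linarith)
  set S : ℝ := (surf n).real univ
  have hS : 0 ≤ S := measureReal_nonneg
  -- Using `S + 1` keeps the tolerance well defined without positivity of `S`, and still leaves a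
  -- total error below `η / 3` after integration over the sphere.
  obtain ⟨ε₀, hε₀, hu⟩ := Metric.uniformContinuous_iff.1
    (CompactSpace.uniformContinuous_of_continuous hφ) (η / (3 * (S + 1))) (by positivity)
  refine ⟨ε₀, hε₀, fun ε k hε hεε hk => ?_⟩
  have hm : 0 < mass n k := hk.mass_pos hε _
  have hd : ∀ z ζ : Sph n, dist z ζ ≤ ε → |φ ζ - φ z| ≤ η / (3 * (S + 1)) := fun z ζ h => by
    have := hu (a := z) (b := ζ) (h.trans_lt hεε)
    rw [Real.dist_eq, abs_sub_comm] at this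
    exact this.le
  have hvφ : Integrable (fun ζ => (mass n k)⁻¹ * (v ζ - φ ζ)) (surf n) :=
    (hv.sub hφi).const_mul _
  have e1 : ∀ z : Sph n, zonal k (fun ζ => (mass n k)⁻¹ * v ζ) z
      = zonal k (fun ζ => (mass n k)⁻¹ * (v ζ - φ ζ)) (z : Amb n)
        + zonal k (fun ζ => (mass n k)⁻¹ * φ ζ) z := fun z => by
    rw [zonal, zonal, zonal, ← integral_add
      (integrable_kernel_smul hk.contDiff.continuous hvφ _)
      (integrable_kernel_smul hk.contDiff.continuous (hφi.const_mul _) _)]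
    refine integral_congr_ae (.of_forall fun ζ => ?_)
    simp only [smul_eq_mul]
    ring
  have i1 : Integrable (fun z : Sph n => zonal k (fun ζ => (mass n k)⁻¹ * v ζ) z) (surf n) :=
    integrable_of_continuous (continuous_zonal hk (hv.const_mul _))
  have i2 : Integrable (fun z : Sph n => |zonal k (fun ζ => (mass n k)⁻¹ * (v ζ - φ ζ)) z|)
      (surf n) := integrable_of_continuous (continuous_zonal hk hvφ).abs
  have i3 : Integrable (fun z => ‖v z - φ z‖) (surf n) := (hv.sub hφi).norm
  have e2 := integral_abs_zonal_le hk hvφ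
  have e3 : mass n k * ∫ z, |(mass n k)⁻¹ * (v z - φ z)| ∂(surf n) = ∫ z, ‖v z - φ z‖ ∂(surf n) := by
    simp_rw [abs_mul, abs_of_pos (inv_pos.2 hm), integral_const_mul, Real.norm_eq_abs]
    field_simp
  calc ∫ z : Sph n, |zonal k (fun ζ => (mass n k)⁻¹ * v ζ) z - v z| ∂(surf n)
      ≤ ∫ z : Sph n, (|zonal k (fun ζ => (mass n k)⁻¹ * (v ζ - φ ζ)) z|
          + η / (3 * (S + 1)) + ‖v z - φ z‖) ∂(surf n) := by
        refine integral_mono (i1.sub hv).abs ((i2.add (integrable_const _)).add i3) fun z => ?_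
        have h1 := zonal_sub_le hk hε hφ hd z
        simp only [e1 z, Real.norm_eq_abs]
        have h2 := abs_add_three (zonal k (fun ζ => (mass n k)⁻¹ * (v ζ - φ ζ)) (z : Amb n))
          (zonal k (fun ζ => (mass n k)⁻¹ * φ ζ) (z : Amb n) - φ z) (φ z - v z)
        rw [abs_sub_comm (φ z)] at h2
        refine le_trans (le_of_eq ?_) (h2.trans (by linarith))
        congr 1; ring
    _ = (∫ z : Sph n, |zonal k (fun ζ => (mass n k)⁻¹ * (v ζ - φ ζ)) z| ∂(surf n))
          + S * (η / (3 * (S + 1))) + ∫ z, ‖v z - φ z‖ ∂(surf n) := by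
        have i4 : Integrable (fun z : Sph n =>
            |zonal k (fun ζ => (mass n k)⁻¹ * (v ζ - φ ζ)) z| + η / (3 * (S + 1))) (surf n) :=
          i2.add (integrable_const _)
        rw [integral_add i4 i3, integral_add i2 (integrable_const _),
          integral_const, smul_eq_mul]
    _ ≤ η / 3 + η / 3 + η / 3 := by
        have h4 : S * (η / (3 * (S + 1))) ≤ η / 3 := by
          rw [mul_div_assoc', div_le_div_iff₀ (by positivity) (by norm_num)]
          nlinarith
        linarith
    _ = η := by ring

end

section

variable {n : ℕ} {Ω : Set (Sph n)}

/-! ### The perimeter of a subgraph -/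

lemma hasFDerivAt_normalize_polar (p : Sph n × ℝ) : HasFDerivAt (fun x : Amb n => ‖x‖⁻¹ • x)
    (Real.exp (-p.2) • (ContinuousLinearMap.id ℝ (Amb n)
      - (innerSL ℝ (p.1 : Amb n)).smulRight (p.1 : Amb n))) (polar p) := by
  have h0 : Real.exp (-p.2) • polar p = p.1 := by
    rw [polar, smul_smul, ← Real.exp_add]; simp
  have h1 : HasFDerivAt (fun x : Amb n => Real.exp (-p.2) • x)
      (Real.exp (-p.2) • ContinuousLinearMap.id ℝ (Amb n)) (polar p) :=
    (hasFDerivAt_id _).fun_const_smul _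
  have h2 := hasFDerivAt_normalize p.1
  rw [← h0] at h2
  have h3 := HasFDerivAt.comp (f := fun x : Amb n => Real.exp (-p.2) • x) (polar p) h2 h1
  rw [h0] at h3
  have h4 : ((fun x : Amb n => ‖x‖⁻¹ • x) ∘ fun x : Amb n => Real.exp (-p.2) • x)
      = fun x : Amb n => ‖x‖⁻¹ • x := by
    funext x
    have he := (Real.exp_pos (-p.2)).ne'
    simp only [Function.comp, norm_smul, Real.norm_of_nonneg (Real.exp_pos (-p.2)).le, smul_smul]
    congr 1; field_simp
  rw [h4] at h3
  convert! h3 using 1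
  ext1 h
  simp

lemma fderiv_log_norm_polar (p : Sph n × ℝ) (h : Amb n) :
    fderiv ℝ (fun x : Amb n => Real.log ‖x‖) (polar p) h
      = Real.exp (-p.2) * inner ℝ (p.1 : Amb n) h := by
  have h0 : ‖polar p‖ ≠ 0 := norm_ne_zero_iff.2 (polar_ne_zero p)
  rw [fderiv_radial_apply (polar_ne_zero p) (Real.differentiableAt_log h0), norm_polar,
    Real.deriv_log, polar, inner_smul_left, Real.exp_neg]
  have := (Real.exp_pos p.2).ne'
  simp only [conj_trivial]
  field_simp

/-- Chain rule for the function `u(z) - w` on the punctured space: `u(x / |x|)` sees only the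
tangential part of a direction and `log |x|` only its radial part. The result is minus the
derivative of the step times the graph flux, up to the factor `e^{-w}`. -/
lemma fderiv_step_polar {U : Amb n → ℝ} (hU : ContDiff ℝ 1 U) {θ : ℝ → ℝ} (hθ : ContDiff ℝ 1 θ)
    (p : Sph n × ℝ) (h : Amb n) :
    fderiv ℝ (fun x => θ (U (‖x‖⁻¹ • x) - Real.log ‖x‖)) (polar p) h
      = deriv θ (U p.1 - p.2) * (Real.exp (-p.2) *
        (fderiv ℝ U p.1 (h - inner ℝ (p.1 : Amb n) h • (p.1 : Amb n))
          - inner ℝ (p.1 : Amb n) h)) := by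
  have hx := polar_ne_zero p
  have hz : ‖polar p‖⁻¹ • polar p = p.1 := by rw [← coe_dir hx, dir_polar]
  have h2 : HasFDerivAt U (fderiv ℝ U (p.1 : Amb n)) (‖polar p‖⁻¹ • polar p) := by
    rw [hz]; exact (hU.differentiable one_ne_zero _).hasFDerivAt
  have h3 : HasFDerivAt (fun x : Amb n => U (‖x‖⁻¹ • x)) _ (polar p) :=
    HasFDerivAt.comp (f := fun x : Amb n => ‖x‖⁻¹ • x) (polar p) h2
      (hasFDerivAt_normalize_polar p)
  have h4 : DifferentiableAt ℝ (fun x : Amb n => Real.log ‖x‖) (polar p) :=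
    (((contDiffAt_norm ℝ hx (n := 1)).log (norm_ne_zero_iff.2 hx)).differentiableAt one_ne_zero)
  have h6 := h3.fun_sub h4.hasFDerivAt
  have h7 : U (‖polar p‖⁻¹ • polar p) - Real.log ‖polar p‖ = U p.1 - p.2 := by
    rw [hz, norm_polar, Real.log_exp]
  have h8 : HasDerivAt θ (deriv θ (U p.1 - p.2))
      (U (‖polar p‖⁻¹ • polar p) - Real.log ‖polar p‖) := by
    rw [h7]; exact (hθ.differentiable one_ne_zero _).hasDerivAt
  have h5 : HasFDerivAt (fun x => θ (U (‖x‖⁻¹ • x) - Real.log ‖x‖)) _ (polar p) :=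
    h8.comp_hasFDerivAt (polar p) h6
  rw [h5.fderiv]
  simp only [smul_apply, sub_apply, ContinuousLinearMap.comp_apply, fderiv_log_norm_polar,
    ContinuousLinearMap.id_apply, ContinuousLinearMap.smulRight_apply, innerSL_apply_apply,
    map_smul, smul_eq_mul]
  ring

/-- The field `y^{-n} g` in logarithmic polar coordinates, for `F = x_{n+1}^{-n} g`. -/
def polarField (F : Amb n → Amb n) (p : Sph n × ℝ) : Amb n := Real.exp (n * p.2) • F (polar p)

/-- The divergence of `F` in logarithmic polar coordinates. -/
def polarDiv (F : Amb n → Amb n) (p : Sph n × ℝ) : ℝ :=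
  Real.exp ((n + 1) * p.2) * ediv F (polar p)

/-- The flux of a vector `y` at the point `z` through the radial graph of `U`. -/
def graphFlux (U : Amb n → ℝ) (z : Sph n) (y : Amb n) : ℝ :=
  inner ℝ (z : Amb n) y - fderiv ℝ U (z : Amb n) (y - inner ℝ (z : Amb n) y • (z : Amb n))

lemma graphFlux_smul (U : Amb n → ℝ) (z : Sph n) (c : ℝ) (y : Amb n) :
    graphFlux U z (c • y) = c * graphFlux U z y := by
  simp only [graphFlux, inner_smul_right, map_sub, map_smul, smul_eq_mul]
  ring

/-- The Gauss–Green formula for a smooth approximation `θ(u - w)` of the subgraph of `u`. -/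
lemma integral_step_ediv {U : Amb n → ℝ} (hU : ContDiff ℝ 1 U) {θ : ℝ → ℝ} (hθ : ContDiff ℝ 1 θ)
    {F : Amb n → Amb n} (hF : ContDiff ℝ 1 F) (hFc : HasCompactSupport F)
    (hF0 : (0 : Amb n) ∉ tsupport F)
    (hi : Integrable (fun p : Sph n × ℝ => θ (U p.1 - p.2) * polarDiv F p)
      ((surf n).prod volume))
    (hi' : Integrable (fun p : Sph n × ℝ => deriv θ (U p.1 - p.2) *
      graphFlux U p.1 (polarField F p)) ((surf n).prod volume)) :
    ∫ p : Sph n × ℝ, θ (U p.1 - p.2) * polarDiv F p ∂((surf n).prod volume)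
      = ∫ p : Sph n × ℝ, deriv θ (U p.1 - p.2) * graphFlux U p.1 (polarField F p)
        ∂((surf n).prod volume) := by
  obtain ⟨a, had⟩ : ∃ a : Amb n → ℝ, a = fun x => θ (U (‖x‖⁻¹ • x) - Real.log ‖x‖) := ⟨_, rfl⟩
  have haC : ContDiffOn ℝ 1 a {0}ᶜ := by
    intro x hx
    have h0 : ‖x‖ ≠ 0 := norm_ne_zero_iff.2 hx
    have h1 := contDiffOn_normalize.contDiffAt (isOpen_compl_singleton.mem_nhds hx)
    have h2 : ContDiffAt ℝ 1 (fun x : Amb n => U (‖x‖⁻¹ • x)) x :=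
      ContDiffAt.comp (f := fun x : Amb n => ‖x‖⁻¹ • x) x hU.contDiffAt h1
    have h3 : ContDiffAt ℝ 1 (fun x : Amb n => U (‖x‖⁻¹ • x) - Real.log ‖x‖) x :=
      h2.sub ((contDiffAt_norm ℝ hx).log h0)
    have h4 : ContDiffAt ℝ 1 a x := had ▸
      ContDiffAt.comp (f := fun x : Amb n => U (‖x‖⁻¹ • x) - Real.log ‖x‖) x hθ.contDiffAt h3
    exact h4.contDiffWithinAt
  have hQ : ContDiff ℝ 1 (fun x => a x • F x) := by
    rw [contDiff_iff_contDiffAt]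
    intro x
    obtain rfl | hx := eq_or_ne x 0
    · have h1 : (fun x => a x • F x) =ᶠ[nhds 0] fun _ => 0 := by
        filter_upwards [notMem_tsupport_iff_eventuallyEq.1 hF0] with y hy
        rw [hy]; simp
      exact contDiffAt_const.congr_of_eventuallyEq h1
    · exact (haC.contDiffAt (isOpen_compl_singleton.mem_nhds hx)).smul hF.contDiffAt
  have hQc : HasCompactSupport (fun x => a x • F x) :=
    HasCompactSupport.intro hFc fun x hx => by
      rw [image_eq_zero_of_notMem_tsupport hx, smul_zero]
  -- The whole formula is the product rule for the divergence of `a • F` integrated over space.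
  -- Although `a` is singular at the origin, `F` vanishes near it.
  have h0 := integral_ediv_eq_zero hQ hQc
  rw [integral_polar] at h0
  have h1 : ∀ p : Sph n × ℝ, Real.exp ((n + 1) * p.2) * ediv (fun x => a x • F x) (polar p)
      = θ (U p.1 - p.2) * polarDiv F p
        - deriv θ (U p.1 - p.2) * graphFlux U p.1 (polarField F p) := fun p => by
    have hx := polar_ne_zero p
    have hn : {0}ᶜ ∈ nhds (polar p) := isOpen_compl_singleton.mem_nhds hx
    have hz : ‖polar p‖⁻¹ • polar p = p.1 := by rw [← coe_dir hx, dir_polar]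
    have e0 : a (polar p) = θ (U p.1 - p.2) := by
      rw [had]; simp only []; rw [hz, norm_polar, Real.log_exp]
    have e : Real.exp ((n + 1) * p.2) * Real.exp (-p.2) = Real.exp (n * p.2) := by
      rw [← Real.exp_add]; congr 1; ring
    have e1 : fderiv ℝ a (polar p) (F (polar p)) = _ :=
      had ▸ fderiv_step_polar hU hθ p (F (polar p))
    rw [ediv_smul ((haC.contDiffAt hn).differentiableAt one_ne_zero)
      (hF.differentiable one_ne_zero _), e0, e1, polarDiv, polarField,
      graphFlux_smul, graphFlux, ← e]
    ring
  simp_rw [h1] at h0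
  rw [integral_sub hi hi'] at h0
  linarith

/-- A smooth nondecreasing step of width `δ`. -/
def step (δ s : ℝ) : ℝ := Real.smoothTransition (s / δ)

lemma contDiff_step (δ : ℝ) : ContDiff ℝ 1 (step δ) :=
  Real.smoothTransition.contDiff.comp (by fun_prop)

section step

variable {δ : ℝ}

lemma step_mem (s : ℝ) : 0 ≤ step δ s ∧ step δ s ≤ 1 :=
  ⟨Real.smoothTransition.nonneg _, Real.smoothTransition.le_one _⟩

lemma step_of_nonpos (hδ : 0 < δ) {s : ℝ} (hs : s ≤ 0) : step δ s = 0 :=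
  Real.smoothTransition.zero_of_nonpos (div_nonpos_of_nonpos_of_nonneg hs hδ.le)

lemma step_of_ge (hδ : 0 < δ) {s : ℝ} (hs : δ ≤ s) : step δ s = 1 :=
  Real.smoothTransition.one_of_one_le ((one_le_div hδ).2 hs)

lemma deriv_step_nonneg (hδ : 0 < δ) (s : ℝ) : 0 ≤ deriv (step δ) s := by
  have : Monotone (step δ) := fun a b h =>
    Real.smoothTransition.monotone (div_le_div_of_nonneg_right h hδ.le)
  exact this.deriv_nonneg

lemma hasCompactSupport_deriv_step (hδ : 0 < δ) : HasCompactSupport (deriv (step δ)) := by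
  refine HasCompactSupport.intro (isCompact_Icc (a := 0) (b := δ)) fun s hs => ?_
  rw [mem_Icc, not_and_or, not_le, not_le] at hs
  rcases hs with hs | hs
  · have : step δ =ᶠ[nhds s] fun _ => 0 := by
      filter_upwards [Iio_mem_nhds hs] with t ht using step_of_nonpos hδ (le_of_lt ht)
    rw [this.deriv_eq, deriv_const]
  · have : step δ =ᶠ[nhds s] fun _ => 1 := by
      filter_upwards [Ioi_mem_nhds hs] with t ht using step_of_ge hδ (le_of_lt ht)
    rw [this.deriv_eq, deriv_const]

lemma integrable_deriv_step (hδ : 0 < δ) : Integrable (deriv (step δ)) :=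
  ((contDiff_step δ).continuous_deriv le_rfl).integrable_of_hasCompactSupport
    (hasCompactSupport_deriv_step hδ)

lemma integral_deriv_step (hδ : 0 < δ) : ∫ s, deriv (step δ) s = 1 := by
  rw [integral_of_hasDerivAt_of_tendsto (f := step δ) (m := 0) (n := 1)
    (fun s => ((contDiff_step δ).differentiable one_ne_zero s).hasDerivAt)
    (integrable_deriv_step hδ), sub_zero]
  · refine tendsto_const_nhds.congr' ?_
    filter_upwards [Filter.eventually_le_atBot 0] with s hs using (step_of_nonpos hδ hs).symm
  · refine tendsto_const_nhds.congr' ?_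
    filter_upwards [Filter.eventually_ge_atTop δ] with s hs using (step_of_ge hδ hs).symm

/-- The subgraph is approximated by the smoothed step. -/
lemma abs_integral_step_sub_le (hδ : 0 < δ) {u v M : ℝ} (hM : 0 ≤ M) {D : ℝ → ℝ}
    (hD : ∀ w, |D w| ≤ M) :
    |∫ w, ((Iio v).indicator (fun _ => (1 : ℝ)) w - step δ (u - w)) * D w| ≤ M * (|u - v| + δ) := by
  -- Below `u - δ` and `v` both functions equal `1`, and above `u` and `v` both vanish. The
  -- remaining interval has length at most `|u - v| + δ`.
  have h0 : ∀ w, w ∉ Icc (min (u - δ) v) (max u v) →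
      ((Iio v).indicator (fun _ => (1 : ℝ)) w - step δ (u - w)) * D w = 0 := fun w hw => by
    rw [mem_Icc, not_and_or, not_le, not_le, lt_min_iff, max_lt_iff] at hw
    rcases hw with hw | hw
    · rw [indicator_of_mem (show w ∈ Iio v from hw.2), step_of_ge hδ (by linarith [hw.1]), sub_self,
        zero_mul]
    · rw [indicator_of_notMem (show w ∉ Iio v from not_lt.2 hw.2.le),
        step_of_nonpos hδ (by linarith [hw.1]), sub_self, zero_mul]
  have h1 : ∀ w, ‖((Iio v).indicator (fun _ => (1 : ℝ)) w - step δ (u - w)) * D w‖ ≤ M := fun w => by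
    have h2 : |(Iio v).indicator (fun _ => (1 : ℝ)) w - step δ (u - w)| ≤ 1 := by
      have h3 := step_mem (δ := δ) (u - w)
      rw [abs_le]
      by_cases hw : w ∈ Iio v
      · rw [indicator_of_mem hw]; constructor <;> linarith [h3.1, h3.2]
      · rw [indicator_of_notMem hw]; constructor <;> linarith [h3.1, h3.2]
    rw [norm_mul]
    exact (mul_le_mul h2 (hD w) (abs_nonneg _) zero_le_one).trans_eq (one_mul M)
  rw [← setIntegral_eq_integral_of_forall_compl_eq_zero h0, ← Real.norm_eq_abs]
  refine (norm_setIntegral_le_of_norm_le_const (by simp) fun w _ => h1 w).trans ?_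
  refine mul_le_mul_of_nonneg_left ?_ hM
  have h4 : max u v - min (u - δ) v ≤ |u - v| + δ := by
    rcases le_total u v with h | h
    · rw [max_eq_right h, abs_of_nonpos (by linarith), min_eq_left (by linarith)]; linarith
    · rw [max_eq_left h, abs_of_nonneg (by linarith)]
      rcases min_choice (u - δ) v with h' | h' <;> rw [h'] <;> linarith
  rw [Real.volume_real_Icc_of_le ((min_le_right _ _).trans (le_max_right _ _))]
  exact h4

end step

end

/-! ### Flux bounds for smooth subgraphs and passage to the limit. -/

section

variable {n : ℕ} {Ω : Set (Sph n)} {T : ℝ} {F : Amb n → Amb n}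

section polarField

lemma continuous_polarField (hF : Continuous F) : Continuous (polarField F) := by
  have h := hF.comp (continuous_polar (n := n))
  have h2 : Continuous fun p : Sph n × ℝ => Real.exp (n * p.2) := by fun_prop
  exact h2.smul h

lemma continuous_polarDiv (hF : ContDiff ℝ 1 F) : Continuous (polarDiv F) := by
  have h := (ediv_continuous hF).comp (continuous_polar (n := n))
  have h2 : Continuous fun p : Sph n × ℝ => Real.exp ((n + 1) * p.2) := by fun_prop
  exact h2.mul h

lemma polarField_eq_zero {p : Sph n × ℝ} (hp : polar p ∉ tsupport F) : polarField F p = 0 := by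
  rw [polarField, image_eq_zero_of_notMem_tsupport hp, smul_zero]

lemma polarDiv_eq_zero {p : Sph n × ℝ} (hp : polar p ∉ tsupport F) : polarDiv F p = 0 := by
  rw [polarDiv, ediv_eq_zero_of_notMem hp, mul_zero]

lemma polar_notMem_of_notMem_Icc (hF : tsupport F ⊆ truncCone Ω T) {p : Sph n × ℝ}
    (hp : p ∉ (univ : Set (Sph n)) ×ˢ Icc (-T - 1) (T + 1)) : polar p ∉ tsupport F := fun h => by
  have := polar_mem_coneSlab.1 (hF h)
  exact hp ⟨mem_univ _, this.2.1.le, this.2.2.le⟩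

lemma isCompact_slab : IsCompact ((univ : Set (Sph n)) ×ˢ Icc (-T - 1) (T + 1)) :=
  isCompact_univ.prod isCompact_Icc

lemma hasCompactSupport_polarField (hF : tsupport F ⊆ truncCone Ω T) :
    HasCompactSupport (polarField F) :=
  HasCompactSupport.intro isCompact_slab fun _ hp =>
    polarField_eq_zero (polar_notMem_of_notMem_Icc hF hp)

lemma hasCompactSupport_polarDiv (hF : tsupport F ⊆ truncCone Ω T) :
    HasCompactSupport (polarDiv F) :=
  HasCompactSupport.intro isCompact_slab fun _ hp =>
    polarDiv_eq_zero (polar_notMem_of_notMem_Icc hF hp)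

end polarField

lemma continuous_graphFlux {U : Amb n → ℝ} (hU : ContDiff ℝ 1 U) {α : Type*} [TopologicalSpace α]
    {f : α → Sph n} {y : α → Amb n} (hf : Continuous f) (hy : Continuous y) :
    Continuous fun a => graphFlux U (f a) (y a) := by
  have h1 := (hU.continuous_fderiv one_ne_zero).comp (continuous_subtype_val.comp hf)
  have h2 : Continuous fun a => fderiv ℝ U (f a : Amb n)
      (y a - inner ℝ (f a : Amb n) (y a) • (f a : Amb n)) := h1.clm_apply (by fun_prop)
  unfold graphFlux
  exact Continuous.sub (by fun_prop) h2

@[simp] lemma graphFlux_zero (U : Amb n → ℝ) (z : Sph n) : graphFlux U z 0 = 0 := by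
  simp [graphFlux]

/-- The smoothed subgraph satisfies the perimeter inequality up to a small error. -/
theorem integral_step_polarDiv_le {ε : ℝ} {k : ℝ → ℝ} (hk : IsZonalKernel ε k) (hε : 0 < ε)
    (hε1 : ε ≤ 1) (hΩ : Ω ⊆ upperHemisphere n) (hF : ContDiff ℝ 1 F)
    (hFc : HasCompactSupport F) (hFs : tsupport F ⊆ truncCone Ω T)
    (hF1 : ∀ x, height x ^ n * ‖F x‖ ≤ 1) {K : Set (Sph n)}
    (hFK : ∀ p : Sph n × ℝ, polar p ∈ tsupport F → p.1 ∈ K)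
    (hK : Metric.cthickening ε K ⊆ Ω) {ρ : ℝ} (hρ : 0 < ρ)
    (hKρ : ∀ z ∈ K, ∀ ζ : Sph n, dist ζ z ≤ ε → height (ζ : Amb n) ≤ ρ * height (z : Amb n))
    {M : ℝ} (hM : ∀ p, ‖polarField F p‖ ≤ M)
    {v : Sph n → ℝ} (hv : Integrable v (surf n)) (hv0 : ∀ z ∉ Ω, v z = 0)
    {A : ℝ} (hA : areaEnergy Ω v ≤ (A : EReal)) {δ : ℝ} (hδ : 0 < δ) :
    ∫ p : Sph n × ℝ, step δ (zonal k (fun ζ => (mass n k)⁻¹ * v ζ) (p.1 : Amb n) - p.2)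
        * polarDiv F p ∂((surf n).prod volume)
      ≤ ρ ^ n * A + 2 * n * ε * M * ∫ z, |v z| ∂(surf n) := by
  obtain ⟨U, hUd⟩ : ∃ U : Amb n → ℝ, U = zonal k fun ζ => (mass n k)⁻¹ * v ζ := ⟨_, rfl⟩
  have hU : ContDiff ℝ 1 U := hUd ▸ contDiff_zonal hk.contDiff (hv.const_mul _)
  have hUc := hU.continuous
  rw [← hUd]
  have hsc := (contDiff_step δ).continuous
  have hdc := (contDiff_step δ).continuous_deriv le_rfl
  have hpF := continuous_polarField (n := n) hF.continuous
  have hpD := continuous_polarDiv (n := n) hF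
  have i1 : Integrable (fun p : Sph n × ℝ => step δ (U p.1 - p.2) * polarDiv F p)
      ((surf n).prod volume) :=
    Continuous.integrable_of_hasCompactSupport (by fun_prop)
      (HasCompactSupport.intro (isCompact_slab (T := T)) fun p hp => by
        rw [polarDiv_eq_zero (polar_notMem_of_notMem_Icc hFs hp), mul_zero])
  have hgf : Continuous fun p : Sph n × ℝ => graphFlux U p.1 (polarField F p) :=
    continuous_graphFlux hU continuous_fst hpF
  have i2 : Integrable (fun p : Sph n × ℝ => deriv (step δ) (U p.1 - p.2) *
      graphFlux U p.1 (polarField F p)) ((surf n).prod volume) :=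
    Continuous.integrable_of_hasCompactSupport (by fun_prop)
      (HasCompactSupport.intro (isCompact_slab (T := T)) fun p hp => by
        rw [polarField_eq_zero (polar_notMem_of_notMem_Icc hFs hp), graphFlux_zero, mul_zero])
  have hF0 : (0 : Amb n) ∉ tsupport F := fun h => by
    obtain ⟨p, hp⟩ := exists_polar_of_mem_coneSlab (hFs h)
    exact polar_ne_zero p hp
  rw [integral_step_ediv hU (contDiff_step δ) hF hFc hF0 i1 i2, integral_prod _ i2]
  have hgf' : Continuous fun p : Sph n × ℝ => graphFlux U p.1 (polarField F (p.1, U p.1 - p.2)) :=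
    continuous_graphFlux hU continuous_fst (hpF.comp (by fun_prop))
  have i3 : Integrable (fun p : Sph n × ℝ => deriv (step δ) p.2 *
      graphFlux U p.1 (polarField F (p.1, U p.1 - p.2))) ((surf n).prod volume) := by
    refine Continuous.integrable_of_hasCompactSupport (by fun_prop)
      (HasCompactSupport.intro (isCompact_univ.prod (hasCompactSupport_deriv_step hδ)) fun p hp => ?_)
    have : p.2 ∉ tsupport (deriv (step δ)) := fun h => hp ⟨mem_univ _, h⟩
    rw [image_eq_zero_of_notMem_tsupport this, zero_mul]
  -- Substituting `s = U z - w` slices by the vertical translates of the graph of `U`. For fixed `s`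
  -- the field on the graph depends on `z` only.
  have e1 : ∀ z : Sph n, ∫ w, deriv (step δ) (U z - w) * graphFlux U z (polarField F (z, w))
      = ∫ s, deriv (step δ) s * graphFlux U z (polarField F (z, U z - s)) := fun z => by
    rw [← integral_sub_left_eq_self
      (fun w => deriv (step δ) (U z - w) * graphFlux U z (polarField F (z, w))) volume (U z)]
    simp
  simp_rw [e1]
  rw [integral_integral_swap i3]
  set B : ℝ := ρ ^ n * A + 2 * n * ε * M * ∫ z, |v z| ∂(surf n)
  -- The bound is uniform in `s`: dilations preserve the hyperbolic metric, so `F` restricted to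
  -- each translate is an admissible weighted field. Averaging with the unit-mass weight `deriv
  -- (step δ)` then keeps the bound.
  have hB : ∀ s, ∫ z, graphFlux U z (polarField F (z, U z - s)) ∂(surf n) ≤ B := fun s => by
    have h := integral_smoothed_le hk hε hε1 hΩ hK hρ hKρ
      (Y := fun z => polarField F (z, U z - s)) (hpF.comp (by fun_prop))
      (fun z hz => polarField_eq_zero fun h => hz (hFK _ h)) (fun z => ?_) (fun z => hM _) hv hv0 hA
    · rw [← hUd] at h
      exact h
    · have h1 := hF1 (polar (z, U z - s))
      rw [height_polar, mul_pow, ← Real.exp_nat_mul] at h1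
      rw [polarField, norm_smul, Real.norm_of_nonneg (Real.exp_pos _).le]
      refine le_trans (le_of_eq ?_) h1
      ring
  calc ∫ s, ∫ z, deriv (step δ) s * graphFlux U z (polarField F (z, U z - s)) ∂(surf n)
      ≤ ∫ s, deriv (step δ) s * B := by
        refine integral_mono i3.integral_prod_right ((integrable_deriv_step hδ).mul_const B)
          fun s => ?_
        simp only [integral_const_mul]
        exact mul_le_mul_of_nonneg_left (hB s) (deriv_step_nonneg hδ s)
    _ = B := by rw [integral_mul_const, integral_deriv_step hδ, one_mul]

/-- Replacing the subgraph by its smooth approximation. -/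
lemma integral_subgraph_le (hF : ContDiff ℝ 1 F) (hFs : tsupport F ⊆ truncCone Ω T)
    {M : ℝ} (hM : ∀ p, |polarDiv F p| ≤ M) {v : Sph n → ℝ} (hv : Integrable v (surf n))
    {u : Sph n → ℝ} (hu : Continuous u) {δ : ℝ} (hδ : 0 < δ) :
    ∫ p : Sph n × ℝ, (Iio (v p.1)).indicator (fun _ => (1 : ℝ)) p.2 * polarDiv F p
        ∂((surf n).prod volume)
      ≤ (∫ p : Sph n × ℝ, step δ (u p.1 - p.2) * polarDiv F p ∂((surf n).prod volume))
        + M * ((∫ z, |u z - v z| ∂(surf n)) + δ * (surf n).real univ) := by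
  have hM0 : 0 ≤ M := (abs_nonneg _).trans (hM (Classical.arbitrary _, 0))
  have hsc := (contDiff_step δ).continuous
  have hpD := continuous_polarDiv (n := n) hF
  have hDi : Integrable (polarDiv F) ((surf n).prod volume) :=
    hpD.integrable_of_hasCompactSupport (hasCompactSupport_polarDiv hFs)
  have i1 : Integrable (fun p : Sph n × ℝ => step δ (u p.1 - p.2) * polarDiv F p)
      ((surf n).prod volume) :=
    Continuous.integrable_of_hasCompactSupport (by fun_prop)
      (HasCompactSupport.intro (isCompact_slab (T := T)) fun p hp => by
        rw [polarDiv_eq_zero (polar_notMem_of_notMem_Icc hFs hp), mul_zero])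
  have hm : AEStronglyMeasurable
      (fun p : Sph n × ℝ => (Iio (v p.1)).indicator (fun _ => (1 : ℝ)) p.2)
      ((surf n).prod volume) := by
    have h1 : AEMeasurable (fun p : Sph n × ℝ => v p.1) ((surf n).prod (volume : Measure ℝ)) :=
      hv.aestronglyMeasurable.aemeasurable.comp_fst
    have h2 : NullMeasurableSet {p : Sph n × ℝ | p.2 < v p.1} ((surf n).prod volume) :=
      nullMeasurableSet_lt measurable_snd.aemeasurable h1
    have h3 : (fun p : Sph n × ℝ => (Iio (v p.1)).indicator (fun _ => (1 : ℝ)) p.2)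
        = {p : Sph n × ℝ | p.2 < v p.1}.indicator fun _ => (1 : ℝ) := by
      funext p; simp [indicator]
    rw [h3]
    exact (aemeasurable_const.indicator₀ h2).aestronglyMeasurable
  have i2 : Integrable (fun p : Sph n × ℝ =>
      (Iio (v p.1)).indicator (fun _ => (1 : ℝ)) p.2 * polarDiv F p) ((surf n).prod volume) :=
    hDi.bdd_mul hm (.of_forall fun p => norm_indicator_one_le _ _)
  have i3 : Integrable (fun p : Sph n × ℝ => ((Iio (v p.1)).indicator (fun _ => (1 : ℝ)) p.2
      - step δ (u p.1 - p.2)) * polarDiv F p) ((surf n).prod volume) := by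
    simp only [sub_mul]
    exact i2.sub i1
  have i4 : Integrable (fun z => |u z - v z|) (surf n) := ((integrable_of_continuous hu).sub hv).abs
  have e1 : ∫ p : Sph n × ℝ, ((Iio (v p.1)).indicator (fun _ => (1 : ℝ)) p.2
      - step δ (u p.1 - p.2)) * polarDiv F p ∂((surf n).prod volume)
      ≤ M * ((∫ z, |u z - v z| ∂(surf n)) + δ * (surf n).real univ) := by
    rw [integral_prod _ i3]
    calc _ ≤ ∫ z, M * (|u z - v z| + δ) ∂(surf n) := by
          refine integral_mono i3.integral_prod_left ((i4.add (integrable_const δ)).const_mul M)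
            fun z => ?_
          refine (le_abs_self _).trans ?_
          exact abs_integral_step_sub_le hδ hM0 (u := u z) (v := v z)
            (D := fun w => polarDiv F (z, w)) fun w => hM (z, w)
      _ = _ := by
          rw [integral_const_mul, integral_add i4 (integrable_const δ), integral_const, smul_eq_mul,
            mul_comm δ]
  simp_rw [sub_mul] at e1
  rw [integral_sub i2 i1] at e1
  linarith

lemma zero_le_areaEnergy (Ω : Set (Sph n)) (v : Sph n → ℝ) : 0 ≤ areaEnergy Ω v := by
  have hs : tsupport (fun _ : Sph n => (0 : ℝ)) = ∅ := tsupport_eq_empty_iff.2 rfl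
  have hs' : tsupport (fun _ : Sph n => (0 : Amb n)) = ∅ := tsupport_eq_empty_iff.2 rfl
  refine le_trans (le_of_eq ?_) (le_iSup₂_of_le (fun _ => 0) (fun _ => 0) (le_iSup_of_le
    (⟨⟨contMDiff_const, fun z => inner_zero_right _, by simp [hs']⟩,
      ⟨contMDiff_const, by simp [hs]⟩, fun z => by simp⟩ :
      IsTangentTest Ω (fun _ : Sph n => (0 : Amb n)) ∧ IsScalarTest Ω (fun _ : Sph n => (0 : ℝ)) ∧
        ∀ z : Sph n, ‖(0 : Amb n)‖ ^ 2 + |(0 : ℝ)| ^ 2 ≤ 1) le_rfl))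
  have : ∀ z : Sph n, sdiv (fun _ : Sph n => (0 : Amb n)) z = 0 := fun z =>
    sdiv_eq_zero_of_notMem (by simp [hs'])
  simp [this]

lemma contDiff_weight (hΩ : Ω ⊆ upperHemisphere n) {g : Amb n → Amb n} (hg : ContDiff ℝ 1 g)
    (hs : tsupport g ⊆ truncCone Ω T) :
    ContDiff ℝ 1 (fun x => (height x ^ n)⁻¹ • g x) := by
  rw [contDiff_iff_contDiffAt]
  intro x
  by_cases hx : x ∈ tsupport g
  · have hy : 0 < height x := height_pos_of_mem_coneSlab hΩ (hs hx)
    exact ((contDiff_height.contDiffAt.pow n).inv (pow_ne_zero n hy.ne')).smul hg.contDiffAt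
  · have h1 : (fun x => (height x ^ n)⁻¹ • g x) =ᶠ[nhds x] fun _ => 0 := by
      filter_upwards [notMem_tsupport_iff_eventuallyEq.1 hx] with y hy
      rw [hy]; simp
    exact contDiffAt_const.congr_of_eventuallyEq h1

/-- Allows `v` to be extended by zero outside `Ω`, so that the smoothing can be defined on the whole
sphere. -/
lemma areaEnergy_congr {u v : Sph n → ℝ} (hΩ : MeasurableSet Ω) (h : ∀ z ∈ Ω, u z = v z) :
    areaEnergy Ω u = areaEnergy Ω v := by
  have e : ∀ γ : Sph n → Amb n,
      ∫ z in Ω, u z * sdiv (fun ζ => (height (ζ : Amb n) ^ n)⁻¹ • γ ζ) z ∂(surf n)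
        = ∫ z in Ω, v z * sdiv (fun ζ => (height (ζ : Amb n) ^ n)⁻¹ • γ ζ) z ∂(surf n) := fun γ =>
    setIntegral_congr_fun hΩ fun z hz => by simp only [h z hz]
  simp only [areaEnergy, e]

end

section

variable {n : ℕ} {Ω : Set (Sph n)} {T : ℝ} {F : Amb n → Amb n} {v : Sph n → ℝ}

lemma isCompact_image_dir {K : Set (Amb n)} (hK : IsCompact K) (hs : K ⊆ truncCone Ω T) :
    IsCompact (dir '' K) := by
  refine hK.image_of_continuousOn fun x hx => (continuousAt_dir ?_).continuousWithinAt
  obtain ⟨p, rfl⟩ := exists_polar_of_mem_coneSlab (hs hx)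
  exact polar_ne_zero p

lemma image_dir_subset {K : Set (Amb n)} (hs : K ⊆ truncCone Ω T) : dir '' K ⊆ Ω := by
  rintro _ ⟨x, hx, rfl⟩
  obtain ⟨p, rfl⟩ := exists_polar_of_mem_coneSlab (hs hx)
  rw [dir_polar]
  exact (polar_mem_coneSlab.1 (hs hx)).1

/-- The flux through the graph of `v` of a field in the cone is bounded by the area of `v`. -/
theorem integral_subgraph_polarDiv_le (hΩo : IsOpen Ω) (hΩ : Ω ⊆ upperHemisphere n)
    (hF : ContDiff ℝ 1 F) (hFc : HasCompactSupport F) (hFs : tsupport F ⊆ truncCone Ω T)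
    (hF1 : ∀ x, height x ^ n * ‖F x‖ ≤ 1) (hv : Integrable v (surf n)) (hv0 : ∀ z ∉ Ω, v z = 0)
    {A : ℝ} (hA : areaEnergy Ω v ≤ (A : EReal)) :
    ∫ p : Sph n × ℝ, (Iio (v p.1)).indicator (fun _ => (1 : ℝ)) p.2 * polarDiv F p
        ∂((surf n).prod volume) ≤ A := by
  have hKc := isCompact_image_dir hFc hFs
  have hKΩ := image_dir_subset hFs
  have hFK : ∀ p : Sph n × ℝ, polar p ∈ tsupport F → p.1 ∈ dir '' tsupport F := fun p hp =>
    ⟨_, hp, dir_polar p⟩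
  -- Heights are bounded below by `c > 0` on the compact set of directions. Moving by at most `ε`
  -- changes the height by at most `ε`, which gives the ratio bound `1 + ε / c`.
  obtain ⟨c, hc, hcK⟩ := hKc.exists_forall_le' (f := fun z : Sph n => height (z : Amb n))
    (continuous_height.comp continuous_subtype_val).continuousOn (a := 0) fun z hz => hΩ (hKΩ hz)
  obtain ⟨M₁, hM₁⟩ := (hasCompactSupport_polarField hFs).exists_bound_of_continuous
    (continuous_polarField hF.continuous)
  obtain ⟨M, hM⟩ := (hasCompactSupport_polarDiv hFs).exists_bound_of_continuous
    (continuous_polarDiv hF)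
  have hM0 : 0 ≤ M := (norm_nonneg _).trans (hM (Classical.arbitrary _, 0))
  obtain ⟨r, hr, hrΩ⟩ := hKc.exists_cthickening_subset_open hΩo hKΩ
  -- The parameter `t` serves both as the width of the step and as the `L¹` error of the smoothing.
  -- The limit `ε → 0` is taken first, with `t` fixed.
  have key : ∀ t : ℝ, 0 < t →
      ∫ p : Sph n × ℝ, (Iio (v p.1)).indicator (fun _ => (1 : ℝ)) p.2 * polarDiv F p
        ∂((surf n).prod volume) ≤ A + M * (t + t * (surf n).real univ) := fun t ht => by
    obtain ⟨ε₀, hε₀, hε₀t⟩ := exists_integral_zonal_sub_le hv ht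
    have hlim : Filter.Tendsto (fun ε : ℝ => (1 + ε / c) ^ n * A
        + 2 * n * ε * M₁ * (∫ z, |v z| ∂(surf n)) + M * (t + t * (surf n).real univ))
        (nhdsWithin 0 (Ioi 0)) (nhds (A + M * (t + t * (surf n).real univ))) := by
      have h : Continuous fun ε : ℝ => (1 + ε / c) ^ n * A
        + 2 * n * ε * M₁ * (∫ z, |v z| ∂(surf n)) + M * (t + t * (surf n).real univ) := by
        fun_prop
      simpa using (h.tendsto 0).mono_left nhdsWithin_le_nhds
    refine ge_of_tendsto hlim ?_
    filter_upwards [Ioo_mem_nhdsGT hε₀, Ioo_mem_nhdsGT hr, Ioo_mem_nhdsGT one_pos]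
      with ε h1 h2 h3
    have hε : 0 < ε := h1.1
    obtain ⟨k, hk⟩ := exists_isZonalKernel ε
    have hu : Continuous fun z : Sph n => zonal k (fun ζ => (mass n k)⁻¹ * v ζ) (z : Amb n) :=
      (contDiff_zonal hk.contDiff (hv.const_mul _)).continuous.comp continuous_subtype_val
    refine (integral_subgraph_le hF hFs hM hv hu ht).trans ?_
    refine add_le_add (integral_step_polarDiv_le hk hε h3.2.le hΩ hF hFc hFs hF1 hFK
      ((Metric.cthickening_mono h2.2.le _).trans hrΩ) (by positivity) (fun z hz ζ hd => ?_)
      hM₁ hv hv0 hA ht) (mul_le_mul_of_nonneg_left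
        (add_le_add_left (hε₀t ε k hε h1.2 hk) _) hM0)
    have e1 : height (ζ : Amb n) - height (z : Amb n) ≤ ε := by
      have e2 : height (ζ : Amb n) - height (z : Amb n) = height ((ζ : Amb n) - (z : Amb n)) := by
        simp [height]
      rw [e2]
      refine (le_abs_self _).trans ((abs_height_le _).trans ?_)
      rwa [← dist_eq_norm, ← Subtype.dist_eq]
    have e3 : ε ≤ ε / c * height (z : Amb n) := by
      rw [div_mul_eq_mul_div, le_div_iff₀ hc]
      exact mul_le_mul_of_nonneg_left (hcK z hz) hε.le
    linarith
  have hlim : Filter.Tendsto (fun t : ℝ => A + M * (t + t * (surf n).real univ))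
      (nhdsWithin 0 (Ioi 0)) (nhds A) := by
    have h : Continuous fun t : ℝ => A + M * (t + t * (surf n).real univ) := by fun_prop
    simpa using (h.tendsto 0).mono_left nhdsWithin_le_nhds
  exact ge_of_tendsto hlim (by filter_upwards [self_mem_nhdsWithin] with t ht using key t ht)

lemma polar_mem_truncSubgraph {p : Sph n × ℝ} : polar p ∈ truncSubgraph Ω v T ↔
    p.1 ∈ Ω ∧ p.2 < v p.1 ∧ -T - 1 < p.2 ∧ p.2 < T + 1 := by
  rw [truncSubgraph, mem_inter_iff, truncCone, polar_mem_coneSlab]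
  constructor
  · rintro ⟨⟨z, hz, w, hw, h⟩, h2⟩
    have : p = (z, w) := polar_injective h
    subst this
    exact ⟨hz, hw, h2.2⟩
  · rintro ⟨hz, hw, h⟩
    exact ⟨⟨p.1, hz, p.2, hw, rfl⟩, hz, h⟩

/-- The perimeter of a truncated subgraph is at most the area of the graph. -/
theorem perimeter_truncSubgraph_le (hΩo : IsOpen Ω) (hΩ : Ω ⊆ upperHemisphere n)
    (hv : IntegrableOn v Ω (surf n)) : perimeter Ω T (truncSubgraph Ω v T) ≤ areaEnergy Ω v := by
  by_cases htop : areaEnergy Ω v = ⊤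
  · rw [htop]; exact le_top
  have hbot : areaEnergy Ω v ≠ ⊥ := fun h => by
    have := zero_le_areaEnergy Ω v
    simp [h] at this
  -- The infinite case is settled and the area is nonnegative, so it may be treated as a real number
  -- from here on.
  have hA : areaEnergy Ω (Ω.indicator v) ≤ ((areaEnergy Ω v).toReal : EReal) := by
    rw [EReal.coe_toReal htop hbot,
      areaEnergy_congr hΩo.measurableSet fun z hz => indicator_of_mem hz v]
  rw [← EReal.coe_toReal htop hbot]
  refine iSup₂_le fun g ⟨hg, hgc, hgs, hg1⟩ => EReal.coe_le_coe_iff.2 ?_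
  have hsub : tsupport (fun x => (height x ^ n)⁻¹ • g x) ⊆ tsupport g :=
    tsupport_smul_subset_right _ _
  have hFs := hsub.trans hgs
  have hF1 : ∀ x, height x ^ n * ‖(height x ^ n)⁻¹ • g x‖ ≤ 1 := fun x => by
    by_cases hx : x ∈ tsupport g
    · have hy : 0 < height x ^ n := pow_pos (height_pos_of_mem_coneSlab hΩ (hgs hx)) n
      rw [norm_smul, norm_inv, Real.norm_of_nonneg hy.le, mul_inv_cancel_left₀ hy.ne']
      exact (sq_le_one_iff₀ (norm_nonneg _)).1 (hg1 x)
    · simp [image_eq_zero_of_notMem_tsupport hx]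
  refine le_trans (le_of_eq ?_) (integral_subgraph_polarDiv_le hΩo hΩ (contDiff_weight hΩ hg hgs)
    (hgc.of_isClosed_subset (isClosed_tsupport _) hsub) hFs hF1
    ((integrable_indicator_iff hΩo.measurableSet).2 hv) (fun z hz => indicator_of_notMem hz v) hA)
  have h0 : ∀ x ∉ truncCone Ω T, (truncSubgraph Ω v T).indicator (fun _ => (1 : ℝ)) x
      * ediv (fun ξ => (height ξ ^ n)⁻¹ • g ξ) x = 0 := fun x hx => by
    rw [indicator_of_notMem (fun h => hx h.2), zero_mul]
  rw [setIntegral_eq_integral_of_forall_compl_eq_zero h0, integral_polar]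
  refine integral_congr_ae (.of_forall fun p => ?_)
  dsimp only
  by_cases hp : polar p ∈ tsupport (fun x => (height x ^ n)⁻¹ • g x)
  · have h1 := polar_mem_coneSlab.1 (hFs hp)
    have h2 : (truncSubgraph Ω v T).indicator (fun _ => (1 : ℝ)) (polar p)
        = (Iio (Ω.indicator v p.1)).indicator (fun _ => (1 : ℝ)) p.2 := by
      rw [indicator_of_mem h1.1]
      by_cases h : p.2 < v p.1
      · rw [indicator_of_mem (polar_mem_truncSubgraph.2 ⟨h1.1, h, h1.2⟩), indicator_of_mem (mem_Iio.2 h)]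
      · rw [indicator_of_notMem (fun h' => h (polar_mem_truncSubgraph.1 h').2.1),
          indicator_of_notMem (mt mem_Iio.1 h)]
    rw [h2, polarDiv]
    ring
  · rw [polarDiv_eq_zero hp, ediv_eq_zero_of_notMem hp]
    simp

end

/-! ### Truncated subgraphs as competitors, and the conclusion. -/

section

variable {n : ℕ} {Ω : Set (Sph n)} {T : ℝ} {v : Sph n → ℝ} {E : Set (Amb n)}

lemma ae_abs_lt_of_eLpNorm_lt {α : Type*} [MeasurableSpace α] {μ : Measure α} {f : α → ℝ}
    (h : eLpNorm f ∞ μ < ENNReal.ofReal T) : ∀ᵐ z ∂μ, |f z| < T := by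
  rw [eLpNorm_exponent_top] at h
  filter_upwards [enorm_ae_le_eLpNormEssSup f μ] with z hz
  have h1 := hz.trans_lt h
  rw [← ofReal_norm, ENNReal.ofReal_lt_ofReal_iff_of_nonneg (norm_nonneg _)] at h1
  exact h1

/-- The subgraph is null measurable in the product coordinates. A measurable representative there is
carried to the cone by the measurable embedding `polar`, which respects null sets. -/
lemma nullMeasurableSet_truncSubgraph (hΩ : IsOpen Ω) (hv : IntegrableOn v Ω (surf n)) :
    NullMeasurableSet (truncSubgraph Ω v T) := by
  have h1 : AEMeasurable (fun p : Sph n × ℝ => Ω.indicator v p.1)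
      ((surf n).prod (volume : Measure ℝ)) :=
    ((integrable_indicator_iff hΩ.measurableSet).2 hv).aestronglyMeasurable.aemeasurable.comp_fst
  have h2 : NullMeasurableSet ({p : Sph n × ℝ | p.2 < Ω.indicator v p.1} ∩
      Ω ×ˢ Ioo (-T - 1) (T + 1)) ((surf n).prod volume) :=
    (nullMeasurableSet_lt measurable_snd.aemeasurable h1).inter
      (hΩ.measurableSet.prod measurableSet_Ioo).nullMeasurableSet
  obtain ⟨S, hS, hSe⟩ := h2
  refine ⟨polar '' S, measurableEmbedding_polar.measurableSet_image.2 hS, ?_⟩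
  refine Filter.eventuallyEq_set.2 (ae_polar.2 ?_)
  filter_upwards [Filter.eventuallyEq_set.1 hSe] with p hp
  rw [polar_injective.mem_set_image, ← hp, polar_mem_truncSubgraph]
  constructor
  · rintro ⟨h3, h4, h5⟩
    exact ⟨by rwa [mem_ofPred_eq, indicator_of_mem h3], h3, h5⟩
  · rintro ⟨h4, h3, h5⟩
    exact ⟨h3, by rwa [mem_ofPred_eq, indicator_of_mem h3] at h4, h5⟩

lemma isCompetitor_truncSubgraph (hΩ : IsOpen Ω) (hv : IntegrableOn v Ω (surf n))
    (hT : ∀ᵐ z ∂(surf n), z ∈ Ω → |v z| < T) : IsCompetitor Ω T (truncSubgraph Ω v T) := by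
  have h : ∀ᵐ p ∂((surf n).prod (volume : Measure ℝ)), p.1 ∈ Ω → |v p.1| < T :=
    Measure.quasiMeasurePreserving_fst.ae hT
  refine ⟨nullMeasurableSet_truncSubgraph hΩ hv, ae_polar.2 ?_, ae_polar.2 ?_⟩
  · filter_upwards [h] with p hp hpl
    obtain ⟨h1, h2, h3⟩ := polar_mem_coneSlab.1 hpl
    have h4 := abs_lt.1 (hp h1)
    exact polar_mem_truncSubgraph.2 ⟨h1, by linarith, h2, by linarith⟩
  · filter_upwards [h] with p hp hpl
    obtain ⟨h1, h2, h3, -⟩ := polar_mem_truncSubgraph.1 hpl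
    have h4 := abs_lt.1 (hp h1)
    exact polar_mem_coneSlab.2 ⟨h1, h3, by linarith⟩

/-- The slice is the interval `(-T - 1, v z)` of length `v z + T + 1`, which explains the subtracted
`T + 1` in `rearrange`. The bound on `v z` ensures that the truncation cuts nothing else off. -/
lemma rearrange_truncSubgraph {z : Sph n} (hz : z ∈ Ω) (hv : |v z| < T) :
    rearrange T (truncSubgraph Ω v T) z = v z := by
  obtain ⟨h1, h2⟩ := abs_lt.1 hv
  have e : ∀ w ∈ Ioo (-T - 1) (T + 1),
      (truncSubgraph Ω v T).indicator (fun _ => (1 : ℝ)) (polar (z, w))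
        = (Iio (v z)).indicator (fun _ => (1 : ℝ)) w := fun w hw => by
    by_cases h : w < v z
    · rw [indicator_of_mem ((polar_mem_truncSubgraph (p := (z, w))).2 ⟨hz, h, hw.1, hw.2⟩),
        indicator_of_mem (mem_Iio.2 h)]
    · rw [indicator_of_notMem (fun h' => h (polar_mem_truncSubgraph.1 h').2.1),
        indicator_of_notMem (mt mem_Iio.1 h)]
  have e2 : Ioo (-T - 1) (T + 1) ∩ Iio (v z) = Ioo (-T - 1) (v z) := by
    ext w
    simp only [mem_inter_iff, mem_Ioo, mem_Iio]
    constructor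
    · exact fun h => ⟨h.1.1, h.2⟩
    · exact fun h => ⟨⟨h.1, by linarith [h.2]⟩, h.2⟩
  rw [rearrange, setIntegral_congr_fun measurableSet_Ioo e, setIntegral_indicator measurableSet_Iio,
    e2, setIntegral_const, Real.volume_real_Ioo_of_le (by linarith), smul_eq_mul]
  ring

/-- A ray whose direction is not in `dir '' K` misses `K` entirely, so by Fubini almost every such
ray meets the two sets in the same slice up to a null set. -/
lemma rearrange_congr_ae {U K : Set (Amb n)}
    (h : ∀ᵐ x ∂(volume : Measure (Amb n)), x ∉ K → (x ∈ E ↔ x ∈ U)) :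
    ∀ᵐ z ∂(surf n), z ∉ dir '' K → rearrange T E z = rearrange T U z := by
  have h1 := Measure.ae_ae_of_ae_prod (ae_polar.1 h)
  filter_upwards [h1] with z hz hzK
  unfold rearrange
  congr 1
  refine integral_congr_ae (ae_restrict_of_ae ?_)
  filter_upwards [hz] with w hw
  have h2 := hw fun h' => hzK ⟨_, h', dir_polar _⟩
  by_cases h3 : polar (z, w) ∈ U
  · rw [indicator_of_mem h3, indicator_of_mem (h2.2 h3)]
  · rw [indicator_of_notMem h3, indicator_of_notMem (mt h2.1 h3)]

lemma volEnergy_congr_ae {u : Sph n → ℝ} (hΩ : MeasurableSet Ω)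
    (h : ∀ᵐ z ∂(surf n), z ∈ Ω → u z = v z) : volEnergy Ω u = volEnergy Ω v := by
  refine setIntegral_congr_ae hΩ ?_
  filter_upwards [h] with z hz hzΩ
  rw [hz hzΩ]

theorem locallyMinimizesSetEnergy_truncSubgraph {H : ℝ} (hΩ : IsOpen Ω)
    (hΩ_sub : Ω ⊆ upperHemisphere n)
    (hΩ_int : IntegrableOn (fun z : Sph n => (height (z : Amb n) ^ (n + 1))⁻¹) Ω (surf n))
    (hv : IsLocalMinimizer H Ω v) (hT0 : 0 < T) (hT : ∀ᵐ z ∂(surf n), z ∈ Ω → |v z| < T) :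
    LocallyMinimizesSetEnergy H Ω T (truncSubgraph Ω v T) := by
  have hvi := hv.1.1
  have hV : IsCompetitor Ω T (truncSubgraph Ω v T) := isCompetitor_truncSubgraph hΩ hvi hT
  refine ⟨hV, fun K hK hKs E hE hEV => ?_⟩
  -- Infinite perimeter is trivial and must be set aside: finiteness is what puts the rearrangement
  -- in `BV`.
  by_cases hP : perimeter Ω T E = ⊤
  · rw [setEnergy, setEnergy, hP, EReal.top_add_coe]
    exact le_top
  have hVr : ∀ᵐ z ∂(surf n), z ∈ Ω → rearrange T (truncSubgraph Ω v T) z = v z := by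
    filter_upwards [hT] with z hz hzΩ using rearrange_truncSubgraph hzΩ (hz hzΩ)
  have hmin := hv.2 (dir '' K) (isCompact_image_dir hK hKs) (image_dir_subset hKs) (rearrange T E)
    (isBV_rearrange hT0 hΩ_sub hE (lt_top_iff_ne_top.2 hP)) (by
      filter_upwards [hVr, rearrange_congr_ae (T := T) hEV] with z h1 h2 hz hzK
      rw [h2 hzK, h1 hz])
  -- Both volumes contain the same constant `(T + 1) ∫ y^{-(n+1)}`, which is split off so that only
  -- the graph energies remain to be compared.
  rw [setEnergy, setEnergy, hypVol_eq hT0 hΩ hΩ_int hV.measurable,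
    hypVol_eq hT0 hΩ hΩ_int hE.measurable, volEnergy_congr_ae hΩ.measurableSet hVr,
    mul_add, mul_add, EReal.coe_add, EReal.coe_add, ← add_assoc, ← add_assoc]
  refine add_le_add_left ?_ _
  calc _ ≤ energy H Ω v := add_le_add_left (perimeter_truncSubgraph_le hΩ hΩ_sub hvi) _
    _ ≤ energy H Ω (rearrange T E) := hmin
    _ ≤ _ := add_le_add_left (areaEnergy_rearrange_le hT0 hΩ_sub hE) _

end

end RadialGraph

end

theorem mainTheorem8 (n : ℕ) (hn : 1 ≤ n) (H : ℝ) (hH : |H| < 1)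
    (Ω : Set (RadialGraph.Sph n)) (hΩ : IsOpen Ω) (hΩ_sub : Ω ⊆ RadialGraph.upperHemisphere n)
    (hΩ_int : IntegrableOn
      (fun z : RadialGraph.Sph n => (RadialGraph.height (z : RadialGraph.Amb n) ^ (n + 1))⁻¹)
      Ω (RadialGraph.surf n))
    (v : RadialGraph.Sph n → ℝ) (hv_bv : RadialGraph.IsBV Ω v)
    (hv_bdd : MemLp v ∞ ((RadialGraph.surf n).restrict Ω))
    (hv_min : RadialGraph.IsLocalMinimizer H Ω v)
    (T : ℝ) (hT : eLpNorm v ∞ ((RadialGraph.surf n).restrict Ω) < ENNReal.ofReal T) :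
    RadialGraph.LocallyMinimizesSetEnergy H Ω T (RadialGraph.truncSubgraph Ω v T) := by
  -- Positivity of `T` is implicit: `ENNReal.ofReal T` lies strictly above a norm, hence above `0`.
  have hT0 : 0 < T := ENNReal.ofReal_pos.1 (bot_le.trans_lt hT)
  exact RadialGraph.locallyMinimizesSetEnergy_truncSubgraph hΩ hΩ_sub hΩ_int hv_min hT0
    ((ae_restrict_iff' hΩ.measurableSet).1 (RadialGraph.ae_abs_lt_of_eLpNorm_lt hT))
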